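/- **Conventions.** An *ultrafilter* is a non-principal ultrafilter $\omega$ on $\mathbb N$; *scaling constants* are reals $d=(d_n)$ with $\lim_\omega d_n=\infty$. For metric spaces $(X_n,\mathrm{dist}_n)$ with base points $e_n\in X_n$, the ultralimit $\lim_\omega (X_n,\frac1{d_n}\mathrm{dist}_n)_e$ is the space of sequences $(x_n)$, $x_n\in X_n$, for which $\mathrm{dist}_n(x_n,e_n)/d_n$ is $\omega$-almost surely bounded, with distance $\lim_\omega \mathrm{dist}_n(x_n,y_n)/d_n$ and sequences at distance $0$ identified. If all $X_n$ equal $X$ it is the asymptotic cone $\mathrm{Con}^\omega(X;e,d)$; for $A_n\subseteq X$, $\lim_\omega A_n$ is the set of all classes of sequences with $x_n\in A_n$ $\omega$-almost surely. A complete geodesic metric space $F$ is *tree-graded* with respect to a collection of closed geodesic subsets (*pieces*) if $(T_1)$ two different pieces have at most one common point, and $(T_2)$ every simple geodesic triangle (a simple loop composed of three geodesics, or a single point) lies in one piece. A metric space $X$ is *asymptotically tree-graded* with respect to a collection $\mathcal A$ of subsets if every cone $\mathrm{Con}^\omega(X;e,d)$ is tree-graded with respect to the sets $\lim_\omega A_n$,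 where $A_n\in\mathcal A$ and $\mathrm{dist}(e_n,A_n)/d_n$ is bounded; here sequences $(A_n)$, $(B_n)$ with $A_n\ne B_n$ $\omega$-almost surely count as giving different pieces, so $\lim_\omega A_n\cap\lim_\omega B_n$ has at most one point. A finitely generated group, with a word metric, is asymptotically tree-graded with respect to subgroups $H_1,\dots,H_k$ if it is so with respect to the collection of all left cosets $gH_i$. A space is *without cut-points* if it has at least two points and the complement of every point is connected. A metric space $B$ is *unconstricted* if there are $\omega$ and $d$ such that for every $e$ the cone $\mathrm{Con}^\omega(B;e,d)$ is without cut-points; a finitely generated group is unconstricted if it is so with a word metric. A family $\mathcal A$ of geodesic metric spaces is *uniformly unconstricted* if for every sequence $A_n\in\mathcal A$ there are $\omega$ and $d$ such that for all $b_n\in A_n$ the ultralimit $\lim_\omega(A_n,\frac1{d_n}\mathrm{dist}_n)_b$ is without cut-points. Finitely generated groups carry word metrics, subsets of metric spaces the induced metrics. **Theorem.** (A) Let $G$ be a finitely generated group that is asymptotically tree-graded with respect to subgroups $H_1,\dots,H_k$, each of which is infinite and (finitely generated and) unconstricted. Let $G'$ be a finitely generated group quasi-isometric to $G$. Then $G'$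 is asymptotically tree-graded, with respect to every word metric, with respect to a finite collection of subgroups $S_1,\dots,S_m$, each of which is finitely generated and quasi-isometric to one of the $H_j$. (B) Let $X$ be a metric space that is asymptotically tree-graded with respect to a collection $\mathcal A$ of non-empty subsets such that 1. $\mathcal A$ (with the induced metrics) is a uniformly unconstricted family of geodesic spaces; 2. for some constant $c$, every point of every $A\in\mathcal A$ is at distance at most $c$ from a bi-infinite geodesic contained in $A$; 3. for some $x_0\in X$ and every $R>0$, the ball $B(x_0,R)$ meets only finitely many $A\in\mathcal A$. Let $G'$ be a finitely generated group quasi-isometric to $X$. Then there are $A_1,\dots,A_m\in\mathcal A$ and subgroups $S_1,\dots,S_m$ of $G'$ such that (I) every $A\in\mathcal A$ is quasi-isometric to some $A_i$; (II) every $S_i$ is finitely generated and quasi-isometric to $A_i$; (III) $G'$ is asymptotically tree-graded, with respect to every word metric, with respect to $S_1,\dots,S_m$. -/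

import Mathlib

open Filter Topology

noncomputable section

/-! ### Quasi-isometries -/

/-- `f` is a quasi-isometric embedding. -/
def IsQuasiIsometricEmbedding {X Y : Type*} [MetricSpace X] [MetricSpace Y] (f : X → Y) : Prop :=
  ∃ L C : ℝ, 1 ≤ L ∧ 0 ≤ C ∧ ∀ x x' : X,
    L⁻¹ * dist x x' - C ≤ dist (f x) (f x') ∧ dist (f x) (f x') ≤ L * dist x x' + C

/-- Two metric spaces are quasi-isometric: there are quasi-isometric embeddings in both directions
whose two composites are at finite distance from the identity maps. -/
def QuasiIsometric (X Y : Type*) [MetricSpace X] [MetricSpace Y] : Prop :=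
  ∃ (f : X → Y) (g : Y → X), IsQuasiIsometricEmbedding f ∧ IsQuasiIsometricEmbedding g ∧
    (∃ K : ℝ, ∀ x, dist (g (f x)) x ≤ K) ∧ (∃ K : ℝ, ∀ y, dist (f (g y)) y ≤ K)

/-! ### Geodesics and tree-graded spaces -/

/-- `s` is (the image of) a geodesic joining `x` to `y`. -/
def IsGeodesicSegment {X : Type*} [MetricSpace X] (s : Set X) (x y : X) : Prop :=
  ∃ γ : ℝ → X, γ 0 = x ∧ γ (dist x y) = y ∧
    (∀ a ∈ Set.Icc 0 (dist x y), ∀ b ∈ Set.Icc 0 (dist x y), dist (γ a) (γ b) = |a - b|) ∧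
    s = γ '' Set.Icc 0 (dist x y)

/-- Any two points of `A` are joined by a geodesic contained in `A`. -/
def IsGeodesicSubset {X : Type*} [MetricSpace X] (A : Set X) : Prop :=
  ∀ x ∈ A, ∀ y ∈ A, ∃ s : Set X, IsGeodesicSegment s x y ∧ s ⊆ A

/-- The complete geodesic metric space `F` is tree-graded with respect to the collection of
pieces `P`.  In `triangle` the three sides meet only in the common vertices, so that they form a
simple loop; the case `x = y = z` is the one-point triangle, so the pieces cover `F`. -/
structure IsTreeGraded (F : Type*) [MetricSpace F] (P : Set (Set F)) : Prop where
  complete : CompleteSpace F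
  geodesic : IsGeodesicSubset (Set.univ : Set F)
  piece_closed : ∀ M ∈ P, IsClosed M
  piece_geodesic : ∀ M ∈ P, IsGeodesicSubset M
  inter_subsingleton : ∀ M ∈ P, ∀ N ∈ P, M ≠ N → (M ∩ N).Subsingleton
  triangle : ∀ (x y z : F) (s t u : Set F),
    IsGeodesicSegment s x y → IsGeodesicSegment t y z → IsGeodesicSegment u z x →
    s ∩ t = {y} → t ∩ u = {z} → u ∩ s = {x} → ∃ M ∈ P, s ∪ t ∪ u ⊆ M

/-- `F` has no global cut-point.  By convention a one-point space has a cut-point. -/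
def HasNoCutPoint (F : Type*) [TopologicalSpace F] : Prop :=
  Nontrivial F ∧ ∀ p : F, IsPreconnected ({p}ᶜ : Set F)

/-! ### Ultralimits and asymptotic cones -/

/-- A sequence of scaling constants with `ω`-limit `∞`.  (Its existence forces the
ultrafilter `ω` to be non-principal.) -/
structure ScalingSeq (ω : Ultrafilter ℕ) where
  /-- the scaling constants -/
  val : ℕ → ℝ
  tendsto_val : Tendsto val (ω : Filter ℕ) atTop

/-- Sequences at finite distance from the observation point `e` in the rescaled
ultraproduct of the `X n`. -/
def UltraPts (X : ℕ → Type*) [∀ n, MetricSpace (X n)] {ω : Ultrafilter ℕ} (d : ScalingSeq ω)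
    (e : ∀ n, X n) : Type _ :=
  {x : ∀ n, X n // ∃ C : ℝ, ∀ᶠ n in (ω : Filter ℕ), dist (x n) (e n) / d.val n ≤ C}

namespace UltraPts

variable {X : ℕ → Type*} [∀ n, MetricSpace (X n)] {ω : Ultrafilter ℕ} {d : ScalingSeq ω}
  {e : ∀ n, X n}

/-- The pseudo-distance `lim_ω dist (x n) (y n) / d n`. -/
def limDist (x y : UltraPts X d e) : ℝ :=
  limUnder (ω : Filter ℕ) fun n => dist (x.1 n) (y.1 n) / d.val n

theorem tendsto_limDist (x y : UltraPts X d e) :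
    Tendsto (fun n => dist (x.1 n) (y.1 n) / d.val n) (ω : Filter ℕ) (𝓝 (limDist x y)) := by
  apply tendsto_nhds_limUnder
  obtain ⟨C, hC⟩ := x.2
  obtain ⟨C', hC'⟩ := y.2
  have hmem : ∀ᶠ n in (ω : Filter ℕ),
      dist (x.1 n) (y.1 n) / d.val n ∈ Set.Icc (0 : ℝ) (C + C') := by
    filter_upwards [hC, hC', d.tendsto_val.eventually_gt_atTop 0] with n h h' hpos
    refine ⟨by positivity, le_trans ?_ (add_le_add h h')⟩
    rw [← add_div]
    gcongr
    exact dist_triangle_right _ _ _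
  obtain ⟨a, -, ha⟩ := (isCompact_Icc (a := (0 : ℝ)) (b := C + C')).ultrafilter_le_nhds'
    (ω.map fun n => dist (x.1 n) (y.1 n) / d.val n) hmem
  exact ⟨a, ha⟩

instance : PseudoMetricSpace (UltraPts X d e) where
  dist := limDist
  dist_self x := by
    refine tendsto_nhds_unique (tendsto_limDist x x) ?_
    simp
  dist_comm x y := by
    refine tendsto_nhds_unique (tendsto_limDist x y) ?_
    simpa only [dist_comm] using tendsto_limDist y x
  dist_triangle x y z := by
    refine le_of_tendsto_of_tendsto (tendsto_limDist x z)
      ((tendsto_limDist x y).add (tendsto_limDist y z)) ?_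
    filter_upwards [d.tendsto_val.eventually_gt_atTop 0] with n hpos
    rw [← add_div]
    gcongr
    exact dist_triangle _ _ _

end UltraPts

/-- The ultralimit `lim_ω (X n, dist / d n)` with observation point `e`: the points at finite
distance from `e`, with points at distance `0` identified. -/
abbrev Ultralimit (X : ℕ → Type*) [∀ n, MetricSpace (X n)] {ω : Ultrafilter ℕ} (d : ScalingSeq ω)
    (e : ∀ n, X n) : Type _ :=
  SeparationQuotient (UltraPts X d e)

/-- The asymptotic cone `Con^ω (X; e, d)`. -/
abbrev AsymptoticCone (X : Type*) [MetricSpace X] {ω : Ultrafilter ℕ} (d : ScalingSeq ω)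
    (e : ℕ → X) : Type _ :=
  Ultralimit (fun _ => X) d e

/-- The limit set `lim_ω A n` in the asymptotic cone: all `lim_ω x n` with `x n ∈ A n`
`ω`-almost surely. -/
def limSet {X : Type*} [MetricSpace X] {ω : Ultrafilter ℕ} (d : ScalingSeq ω) (e : ℕ → X)
    (A : ℕ → Set X) : Set (AsymptoticCone X d e) :=
  {p | ∃ x : UltraPts (fun _ => X) d e,
    SeparationQuotient.mk x = p ∧ ∀ᶠ n in (ω : Filter ℕ), x.1 n ∈ A n}

/-- The collection `𝒜_ω` of the limit sets of the sequences `A n ∈ 𝒜` for which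
`dist (e n) (A n) / d n` is bounded. -/
def limPieces {X : Type*} [MetricSpace X] (𝒜 : Set (Set X)) {ω : Ultrafilter ℕ}
    (d : ScalingSeq ω) (e : ℕ → X) : Set (Set (AsymptoticCone X d e)) :=
  {M | ∃ A : ℕ → Set X, (∀ n, A n ∈ 𝒜) ∧
    (∃ C : ℝ, ∀ᶠ n in (ω : Filter ℕ), ∃ a ∈ A n, dist (e n) a / d.val n ≤ C) ∧
    M = limSet d e A}

/-- `X` is asymptotically tree-graded with respect to `𝒜`: every asymptotic cone is tree-graded
with respect to `𝒜_ω`.  The pieces in `𝒜_ω` are labelled by the ultrapower of `𝒜`: sequences that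
are `ω`-almost surely different give different pieces, so these too have at most one common point
(otherwise two members of `𝒜` at finite Hausdorff distance would go unnoticed, and every group
would be asymptotically tree-graded with respect to each finite index subgroup). -/
def IsAsymptoticallyTreeGraded {X : Type*} [MetricSpace X] (𝒜 : Set (Set X)) : Prop :=
  ∀ (ω : Ultrafilter ℕ) (d : ScalingSeq ω) (e : ℕ → X),
    IsTreeGraded (AsymptoticCone X d e) (limPieces 𝒜 d e) ∧
    ∀ A B : ℕ → Set X, (∀ n, A n ∈ 𝒜) → (∀ n, B n ∈ 𝒜) →
      (∀ᶠ n in (ω : Filter ℕ), A n ≠ B n) → (limSet d e A ∩ limSet d e B).Subsingleton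

/-! ### Unconstricted spaces -/

/-- For some ultrafilter and some scaling constants, no asymptotic cone of `B` has a cut-point,
whatever the observation point. -/
def IsUnconstricted (B : Type*) [MetricSpace B] : Prop :=
  ∃ (ω : Ultrafilter ℕ) (d : ScalingSeq ω), ∀ e : ℕ → B, HasNoCutPoint (AsymptoticCone B d e)

/-- A family of geodesic subspaces of `X` (with the induced metrics) is uniformly unconstricted. -/
def IsUniformlyUnconstricted {X : Type*} [MetricSpace X] (𝒜 : Set (Set X)) : Prop :=
  (∀ A ∈ 𝒜, IsGeodesicSubset A) ∧
  ∀ A : ℕ → Set X, (∀ n, A n ∈ 𝒜) →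
    ∃ (ω : Ultrafilter ℕ) (d : ScalingSeq ω), ∀ b : ∀ n, A n,
      HasNoCutPoint (Ultralimit (fun n => A n) d b)

/-! ### Finitely generated groups as metric spaces -/

/-- A finite generating set of `G`. -/
structure FinGenSet (G : Type*) [Group G] where
  /-- the generators -/
  gens : Finset G
  closure_gens : Subgroup.closure (gens : Set G) = ⊤

/-- The vertex set of the Cayley graph of `G` with respect to `S`, that is `G` itself, to be
equipped with the word metric. -/
def CayleyVertices {G : Type*} [Group G] (_S : FinGenSet G) : Type _ := G

namespace CayleyVertices

variable {G : Type*} [Group G] (S : FinGenSet G)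

/-- The Cayley graph: `a` and `b ≠ a` are adjacent if `a⁻¹ * b` is a generator or the inverse of a
generator. -/
def graph : SimpleGraph G := SimpleGraph.mulCayley (S.gens : Set G)

theorem graph_connected : (graph S).Connected := by
  have key : ∀ g ∈ Subgroup.closure (S.gens : Set G), ∀ a, (graph S).Reachable a (a * g) := by
    intro g hg
    induction hg using Subgroup.closure_induction with
    | mem x hx =>
      intro a
      by_cases h : a = a * x
      · rw [← h]
      · refine SimpleGraph.Adj.reachable ?_
        rw [graph, SimpleGraph.mulCayley_adj']
        exact ⟨h, x, hx, Or.inl rfl⟩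
    | one => intro a; simp
    | mul x y _ _ hx hy =>
      intro a
      rw [← mul_assoc]
      exact (hx a).trans (hy (a * x))
    | inv x _ hx =>
      intro a
      simpa using (hx (a * x⁻¹)).symm
  have : Nonempty G := ⟨1⟩
  refine SimpleGraph.Connected.mk fun a b => ?_
  have := key (a⁻¹ * b) (by rw [S.closure_gens]; trivial) a
  simpa using this

/-- The word metric: the path distance between vertices of the Cayley graph. -/
instance : MetricSpace (CayleyVertices S) where
  dist a b := ((graph S).dist a b : ℝ)
  dist_self a := Nat.cast_eq_zero.2 SimpleGraph.dist_self
  dist_comm a b := congrArg Nat.cast SimpleGraph.dist_comm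
  dist_triangle a b c := by exact_mod_cast (graph_connected S).dist_triangle
  eq_of_dist_eq_zero {a b} h := by
    have h' : (graph S).dist a b = 0 := by exact_mod_cast h
    exact (graph_connected S).dist_eq_zero_iff.1 h'

end CayleyVertices

/-- A group that is finitely generated and quasi-isometric, with a word metric, to `X`. -/
def GroupQuasiIsometricToSpace (G : Type*) [Group G] (X : Type*) [MetricSpace X] : Prop :=
  ∃ S : FinGenSet G, QuasiIsometric (CayleyVertices S) X

/-- Two finitely generated groups are quasi-isometric with respect to word metrics. -/
def GroupsQuasiIsometric (G G' : Type*) [Group G] [Group G'] : Prop :=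
  ∃ (S : FinGenSet G) (T : FinGenSet G'), QuasiIsometric (CayleyVertices S) (CayleyVertices T)

/-- A finitely generated group that is unconstricted with respect to a word metric. -/
def IsUnconstrictedGroup (G : Type*) [Group G] : Prop :=
  ∃ S : FinGenSet G, IsUnconstricted (CayleyVertices S)

/-- The collection of all left cosets `g H i`, as subsets of the Cayley graph. -/
def leftCosets {G : Type*} [Group G] (S : FinGenSet G) {k : ℕ} (H : Fin k → Subgroup G) :
    Set (Set (CayleyVertices S)) :=
  {A | ∃ (g : G) (i : Fin k), A = {x : G | g⁻¹ * x ∈ H i}}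

/-- `G`, with the word metric of `S`, is asymptotically tree-graded with respect to the subgroups
`H i`, that is, with respect to the collection of all their left cosets. -/
def IsGroupTreeGraded {G : Type*} [Group G] (S : FinGenSet G) {k : ℕ}
    (H : Fin k → Subgroup G) : Prop :=
  IsAsymptoticallyTreeGraded (leftCosets S H)

end

/-! Let `f : Γ → X` and `f' : X → Γ` be quasi-inverse quasi-isometries. Left translation by `g`
becomes the map `x ↦ f (g * f' x)`, a quasi-isometry of `X` whose constants do not depend on `g`.
The proof shows that these maps permute the members of `𝒜` up to uniformly bounded error, so that
`Γ` acts on `𝒜`; the subgroups sought are the stabilizers of representatives of the orbits.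

The geometry takes place in asymptotic cones and rests on gates: every point has a nearest point in
a piece, through which every geodesic to the piece passes, and this gate does not change along a
connected set that avoids the piece. Hence a connected set without cut-points lies in one piece
(`IsTreeGraded.exists_piece_of_noCut`), and an arc with endpoints in a piece stays in it
(`IsGateMap.arc_mem`). Both statements are topological, which is why tree-gradedness survives
bilipschitz maps between geodesic spaces (`IsTreeGraded.of_bilipschitz`) although such maps do not
preserve geodesics.

Let `A ∈ 𝒜` be unconstricted. In suitable cones the image of `A` under a quasi-isometric embedding
has no cut-points, so it lies in one piece; moving the observation point along a chain shows that
one fixed member of `𝒜` serves for all of `A` (`exists_near_of_isUnconstricted`). The resulting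
bound is not uniform. It becomes so through the long geodesics near every point of `A`: a long
quasi-geodesic in the `D`-neighbourhood of a member of `𝒜` has its middle in the `D/2`-neighbourhood
when `D` is large (`exists_infDist_le_half`), so the least bound cannot be large
(`exists_uniform_near`). The target member is unique, because neighbourhoods of different members
have bounded intersection and `A` is unbounded; uniqueness yields the laws of an action
(`exists_isCoarseAction`).

Only finitely many members of `𝒜` come near a given point, so there are finitely many orbits and
stabilizers act coboundedly (`exists_cobounded`); a Milnor–Švarc argument then makes each stabilizer
finitely generated and quasi-isometric to its member of `𝒜`. The cosets of the stabilizers match the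
members of `𝒜` at bounded distance, and tree-gradedness passes to `Γ` by quasi-isometry invariance.
For groups, the same halving lemma shows that peripheral subgroups are undistorted
(`IsGroupTreeGraded.exists_wordDist_le`), so their own word metrics serve as models of the cosets.
-/

/-! ### Geodesic segments -/

namespace IsGeodesicSegment

variable {X : Type*} [MetricSpace X] {s t : Set X} {x y z : X}

theorem left_mem (h : IsGeodesicSegment s x y) : x ∈ s := by
  obtain ⟨γ, h0, -, -, rfl⟩ := h
  exact ⟨0, ⟨le_rfl, dist_nonneg⟩, h0⟩

theorem right_mem (h : IsGeodesicSegment s x y) : y ∈ s := by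
  obtain ⟨γ, -, h1, -, rfl⟩ := h
  exact ⟨_, ⟨dist_nonneg, le_rfl⟩, h1⟩

theorem continuousOn_of_dist {γ : ℝ → X} {T : Set ℝ}
    (h : ∀ a ∈ T, ∀ b ∈ T, dist (γ a) (γ b) = |a - b|) : ContinuousOn γ T := by
  have : LipschitzOnWith 1 γ T := by
    refine LipschitzOnWith.of_dist_le_mul fun a ha b hb => ?_
    rw [h a ha b hb, Real.dist_eq]; simp
  exact this.continuousOn

theorem isCompact (h : IsGeodesicSegment s x y) : IsCompact s := by
  obtain ⟨γ, -, -, hd, rfl⟩ := h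
  exact isCompact_Icc.image_of_continuousOn (continuousOn_of_dist hd)

theorem isPreconnected (h : IsGeodesicSegment s x y) : IsPreconnected s := by
  obtain ⟨γ, -, -, hd, rfl⟩ := h
  exact isPreconnected_Icc.image _ (continuousOn_of_dist hd)

/-- A map isometric on an interval gives a geodesic segment. -/
theorem of_dist {γ : ℝ → X} {a b : ℝ} (hab : a ≤ b)
    (h : ∀ u ∈ Set.Icc a b, ∀ v ∈ Set.Icc a b, dist (γ u) (γ v) = |u - v|) :
    IsGeodesicSegment (γ '' Set.Icc a b) (γ a) (γ b) := by
  have hd : dist (γ a) (γ b) = b - a := by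
    rw [h a ⟨le_rfl, hab⟩ b ⟨hab, le_rfl⟩, abs_sub_comm, abs_of_nonneg (by linarith)]
  refine ⟨fun u => γ (a + u), by simp, by simp [hd], ?_, ?_⟩
  · rw [hd]
    rintro u ⟨hu, hu'⟩ v ⟨hv, hv'⟩
    rw [h _ ⟨by linarith, by linarith⟩ _ ⟨by linarith, by linarith⟩]
    congr 1; ring
  · rw [hd]
    ext p
    constructor
    · rintro ⟨u, ⟨hu, hu'⟩, rfl⟩
      exact ⟨u - a, ⟨by linarith, by linarith⟩, by simp⟩
    · rintro ⟨u, ⟨hu, hu'⟩, rfl⟩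
      exact ⟨a + u, ⟨by linarith, by linarith⟩, rfl⟩

theorem symm (h : IsGeodesicSegment s x y) : IsGeodesicSegment s y x := by
  obtain ⟨γ, h0, h1, hd, rfl⟩ := h
  refine ⟨fun u => γ (dist x y - u), by simpa using h1, by simpa [dist_comm y x] using h0, ?_, ?_⟩
  · rw [dist_comm y x]
    rintro u ⟨hu, hu'⟩ v ⟨hv, hv'⟩
    rw [hd _ ⟨by linarith, by linarith⟩ _ ⟨by linarith, by linarith⟩, abs_sub_comm]
    congr 1; ring
  · rw [dist_comm y x]
    ext p
    constructor
    · rintro ⟨u, ⟨hu, hu'⟩, rfl⟩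
      exact ⟨dist x y - u, ⟨by linarith, by linarith⟩, by simp⟩
    · rintro ⟨u, ⟨hu, hu'⟩, rfl⟩
      exact ⟨dist x y - u, ⟨by linarith, by linarith⟩, rfl⟩

theorem dist_add (h : IsGeodesicSegment s x y) (hz : z ∈ s) :
    dist x z + dist z y = dist x y := by
  obtain ⟨γ, h0, h1, hd, rfl⟩ := h
  obtain ⟨u, ⟨hu, hu'⟩, rfl⟩ := hz
  have e1 := hd 0 ⟨le_rfl, dist_nonneg⟩ u ⟨hu, hu'⟩
  have e2 := hd u ⟨hu, hu'⟩ _ ⟨dist_nonneg, le_rfl⟩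
  rw [h0, zero_sub, abs_neg, abs_of_nonneg hu] at e1
  rw [h1, abs_sub_comm, abs_of_nonneg (by linarith)] at e2
  linarith

/-- Any two points of a segment are joined by a subsegment. -/
theorem exists_sub (h : IsGeodesicSegment s x y) {a b : X} (ha : a ∈ s) (hb : b ∈ s) :
    ∃ r ⊆ s, IsGeodesicSegment r a b := by
  obtain ⟨γ, h0, h1, hd, rfl⟩ := h
  obtain ⟨u, ⟨hu, hu'⟩, rfl⟩ := ha
  obtain ⟨v, ⟨hv, hv'⟩, rfl⟩ := hb
  have key : ∀ u v : ℝ, 0 ≤ u → v ≤ dist x y → u ≤ v →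
      ∃ r ⊆ γ '' Set.Icc 0 (dist x y), IsGeodesicSegment r (γ u) (γ v) := by
    intro u v hu hv huv
    have hsub : Set.Icc u v ⊆ Set.Icc 0 (dist x y) := Set.Icc_subset_Icc hu hv
    exact ⟨_, Set.image_mono hsub, of_dist huv fun a ha b hb => hd a (hsub ha) b (hsub hb)⟩
  rcases le_total u v with huv | huv
  · exact key u v hu hv' huv
  · obtain ⟨r, hr, h⟩ := key v u hv hu' huv
    exact ⟨r, hr, h.symm⟩

theorem concat (hs : IsGeodesicSegment s x y) (ht : IsGeodesicSegment t y z)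
    (hd : dist x z = dist x y + dist y z) : IsGeodesicSegment (s ∪ t) x z := by
  obtain ⟨γ, h0, h1, hγ, rfl⟩ := hs
  obtain ⟨η, k0, k1, hη, rfl⟩ := ht
  set a := dist x y with ha
  set b := dist y z with hb
  have ha0 : 0 ≤ a := dist_nonneg
  have hb0 : 0 ≤ b := dist_nonneg
  have hx : ∀ u ∈ Set.Icc 0 a, dist x (γ u) = u := fun u hu => by
    rw [← h0, hγ 0 ⟨le_rfl, ha0⟩ u hu, zero_sub, abs_neg, abs_of_nonneg hu.1]
  have hy : ∀ u ∈ Set.Icc 0 a, dist (γ u) y = a - u := fun u hu => by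
    rw [← h1, hγ u hu a ⟨ha0, le_rfl⟩, abs_sub_comm, abs_of_nonneg (by linarith [hu.2])]
  have hy' : ∀ u ∈ Set.Icc 0 b, dist y (η u) = u := fun u hu => by
    rw [← k0, hη 0 ⟨le_rfl, hb0⟩ u hu, zero_sub, abs_neg, abs_of_nonneg hu.1]
  have hz : ∀ u ∈ Set.Icc 0 b, dist (η u) z = b - u := fun u hu => by
    rw [← k1, hη u hu b ⟨hb0, le_rfl⟩, abs_sub_comm, abs_of_nonneg (by linarith [hu.2])]
  have hmix : ∀ u ∈ Set.Icc 0 a, ∀ v ∈ Set.Icc 0 b, dist (γ u) (η v) = a - u + v := by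
    intro u hu v hv
    have e1 := dist_triangle (γ u) y (η v)
    have e2 := dist_triangle4 x (γ u) (η v) z
    rw [hy u hu, hy' v hv] at e1
    rw [hx u hu, hz v hv] at e2
    linarith
  let δ : ℝ → X := fun u => if u ≤ a then γ u else η (u - a)
  have δ1 : ∀ u, u ≤ a → δ u = γ u := fun u hu => if_pos hu
  have δ2 : ∀ u, a ≤ u → δ u = η (u - a) := fun u hu => by
    rcases hu.eq_or_lt with rfl | hu
    · rw [δ1 _ le_rfl, h1, sub_self, k0]
    · exact if_neg (not_le.2 hu)
  refine ⟨δ, by rw [δ1 _ ha0, h0], ?_, ?_, ?_⟩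
  · rw [hd, δ2 _ (by linarith)]; simpa using k1
  · rw [hd]
    rintro u ⟨hu, hu'⟩ v ⟨hv, hv'⟩
    rcases le_total u a with h | h <;> rcases le_total v a with h' | h'
    · rw [δ1 u h, δ1 v h', hγ u ⟨hu, h⟩ v ⟨hv, h'⟩]
    · rw [δ1 u h, δ2 v h', hmix u ⟨hu, h⟩ _ ⟨by linarith, by linarith⟩, abs_sub_comm,
        abs_of_nonneg (by linarith)]
      ring
    · rw [dist_comm, δ2 u h, δ1 v h', hmix v ⟨hv, h'⟩ _ ⟨by linarith, by linarith⟩,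
        abs_of_nonneg (by linarith)]
      ring
    · rw [δ2 u h, δ2 v h', hη _ ⟨by linarith, by linarith⟩ _ ⟨by linarith, by linarith⟩]
      congr 1; ring
  · rw [hd]
    ext p
    constructor
    · rintro (⟨u, ⟨hu, hu'⟩, rfl⟩ | ⟨u, ⟨hu, hu'⟩, rfl⟩)
      · exact ⟨u, ⟨hu, by linarith⟩, δ1 u hu'⟩
      · exact ⟨a + u, ⟨by linarith, by linarith⟩, by rw [δ2 _ (by linarith)]; simp⟩
    · rintro ⟨u, ⟨hu, hu'⟩, rfl⟩
      rcases le_total u a with h | h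
      · exact Or.inl ⟨u, ⟨hu, h⟩, (δ1 u h).symm⟩
      · exact Or.inr ⟨u - a, ⟨by linarith, by linarith⟩, (δ2 u h).symm⟩

/-- The first point of a closed set on a segment. -/
theorem exists_first (h : IsGeodesicSegment s x y) {M : Set X} (hM : IsClosed M) (hy : y ∈ M) :
    ∃ p ∈ M, ∃ r ⊆ s, IsGeodesicSegment r x p ∧ (∀ w ∈ r, w ∈ M → w = p) ∧
      dist x p + dist p y = dist x y := by
  obtain ⟨p, ⟨hps, hpM⟩, hmin⟩ := (h.isCompact.inter_right hM).exists_isMinOn ⟨y, h.right_mem, hy⟩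
    (continuous_const.dist continuous_id : Continuous fun w => dist x w).continuousOn
  obtain ⟨r, hrs, hr⟩ := h.exists_sub h.left_mem hps
  refine ⟨p, hpM, r, hrs, hr, fun w hw hwM => ?_, h.dist_add hps⟩
  have h1 : dist x p ≤ dist x w := hmin ⟨hrs hw, hwM⟩
  have h2 := hr.dist_add hw
  exact dist_le_zero.1 (by linarith)

end IsGeodesicSegment

/-! ### Gate maps -/

/-- `π` maps every point to its gate in `M`, and is constant along segments that avoid `M`. -/
structure IsGateMap {F : Type*} [MetricSpace F] (M : Set F) (π : F → F) : Prop where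
  mem : ∀ x, π x ∈ M
  dist_eq : ∀ x, ∀ z ∈ M, dist x z = dist x (π x) + dist (π x) z
  const : ∀ x y s, IsGeodesicSegment s x y → Disjoint s M → π x = π y

section gates

variable {F : Type*} [MetricSpace F] {M : Set F}

/-- Every simple geodesic triangle with two distinct points in `M` is contained in `M`. -/
def AbsorbsTriangles (M : Set F) : Prop :=
  ∀ (x y z : F) (s t u : Set F),
    IsGeodesicSegment s x y → IsGeodesicSegment t y z → IsGeodesicSegment u z x →
    s ∩ t = {y} → t ∩ u = {z} → u ∩ s = {x} →
    ∀ a ∈ s ∪ t ∪ u, ∀ b ∈ s ∪ t ∪ u, a ∈ M → b ∈ M → a ≠ b → s ∪ t ∪ u ⊆ M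

/-- Let `o` be the last common point of the two segments. If `p ≠ q`, the pieces of the segments
beyond `o` and a geodesic from `p` to `q` in `M` form a simple triangle with two points in `M`; it
is absorbed, so `o ∈ M`, whereas `s` and `t` meet `M` only at `p` and `q`. -/
theorem AbsorbsTriangles.first_eq (hgM : IsGeodesicSubset M) (hT : AbsorbsTriangles M)
    {x p q : F} {s t : Set F} (hs : IsGeodesicSegment s x p)
    (ht : IsGeodesicSegment t x q) (hp : p ∈ M) (hq : q ∈ M) (hsM : ∀ w ∈ s, w ∈ M → w = p)
    (htM : ∀ w ∈ t, w ∈ M → w = q) : p = q := by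
  by_contra hpq
  obtain ⟨o, ⟨hos, hot⟩, hmax⟩ := (hs.isCompact.inter ht.isCompact).exists_isMaxOn
    ⟨x, hs.left_mem, ht.left_mem⟩
    (continuous_const.dist continuous_id : Continuous fun w => dist x w).continuousOn
  have hoM : o ∉ M := fun h => hpq ((hsM o hos h).symm.trans (htM o hot h))
  obtain ⟨s', hs's, hs'⟩ := hs.exists_sub hos hs.right_mem
  obtain ⟨t', ht't, ht'⟩ := ht.exists_sub ht.right_mem hot
  obtain ⟨r, hr, hrM⟩ := hgM p hp q hq
  have hsub : s' ∪ r ∪ t' ⊆ M := by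
    refine hT o p q s' r t' hs' hr ht' ?_ ?_ ?_ p (Or.inl (Or.inr hr.left_mem)) q
      (Or.inl (Or.inr hr.right_mem)) hp hq hpq
    · refine Set.eq_singleton_iff_unique_mem.2 ⟨⟨hs'.right_mem, hr.left_mem⟩, ?_⟩
      rintro w ⟨hw, hw'⟩
      exact hsM w (hs's hw) (hrM hw')
    · refine Set.eq_singleton_iff_unique_mem.2 ⟨⟨hr.right_mem, ht'.left_mem⟩, ?_⟩
      rintro w ⟨hw, hw'⟩
      exact htM w (ht't hw') (hrM hw)
    · refine Set.eq_singleton_iff_unique_mem.2 ⟨⟨ht'.right_mem, hs'.left_mem⟩, ?_⟩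
      rintro w ⟨hw, hw'⟩
      have h1 : dist x w ≤ dist x o := hmax ⟨hs's hw', ht't hw⟩
      have e1 := hs'.dist_add hw'
      have e2 := hs.dist_add (hs's hw')
      have e3 := hs.dist_add hos
      have : dist o w ≤ 0 := by linarith
      exact (dist_le_zero.1 this).symm
  exact hoM (hsub (Or.inl (Or.inl hs'.left_mem)))

/-- All segments from `x` to points of `M` enter `M` at the same point, by `first_eq`. -/
theorem AbsorbsTriangles.exists_gate (hF : IsGeodesicSubset (Set.univ : Set F)) (hM : IsClosed M)
    (hgM : IsGeodesicSubset M) (hne : M.Nonempty) (hT : AbsorbsTriangles M) (x : F) :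
    ∃ p ∈ M, ∀ z ∈ M, dist x z = dist x p + dist p z := by
  obtain ⟨z₀, hz₀⟩ := hne
  obtain ⟨s₀, hs₀, -⟩ := hF x trivial z₀ trivial
  obtain ⟨p, hp, r, -, hr, hrM, -⟩ := hs₀.exists_first hM hz₀
  refine ⟨p, hp, fun z hz => ?_⟩
  obtain ⟨s, hs, -⟩ := hF x trivial z trivial
  obtain ⟨q, hq, r', -, hr', hrM', hd⟩ := hs.exists_first hM hz
  rw [hT.first_eq hgM hr hr' hp hq hrM hrM']
  exact hd.symm

/-- Constancy is the point. If a segment from `x` to `y` avoids `M` and the gates differ, then this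
segment, the geodesics to the two gates and a geodesic in `M` between the gates bound a
quadrilateral. Two of its sides together are geodesic, so it is a simple triangle, and absorbing it
puts a point of the segment into `M`. -/
theorem AbsorbsTriangles.exists_isGateMap (hF : IsGeodesicSubset (Set.univ : Set F))
    (hM : IsClosed M) (hgM : IsGeodesicSubset M) (hne : M.Nonempty) (hT : AbsorbsTriangles M) :
    ∃ π : F → F, IsGateMap M π := by
  choose π hπ hd using hT.exists_gate hF hM hgM hne
  refine ⟨π, hπ, hd, fun x y h hh hdisj => ?_⟩
  by_contra hne
  obtain ⟨g, hg, -⟩ := hF x trivial (π x) trivial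
  obtain ⟨k, hk, -⟩ := hF y trivial (π y) trivial
  have gate : ∀ x g, IsGeodesicSegment g x (π x) → ∀ w ∈ g, ∀ z ∈ M,
      dist w z = dist w (π x) + dist (π x) z := by
    intro x g hg w hw z hz
    have e1 := hg.dist_add hw
    have e2 := hd x z hz
    have e3 := dist_triangle x w z
    have e4 := dist_triangle w (π x) z
    linarith
  have gateM : ∀ x g, IsGeodesicSegment g x (π x) → ∀ w ∈ g, w ∈ M → w = π x := by
    intro x g hg w hw hwM
    have := gate x g hg w hw w hwM
    rw [dist_self] at this
    have h0 := dist_nonneg (x := π x) (y := w)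
    exact dist_le_zero.1 (by linarith)
  have hgk : ∀ w ∈ g, w ∉ k := by
    intro w hw hw'
    have e1 := gate x g hg w hw (π y) (hπ y)
    have e2 := gate y k hk w hw' (π x) (hπ x)
    rw [dist_comm (π y) (π x)] at e2
    exact hne (dist_le_zero.1 (by linarith))
  have hc : Continuous fun o : F × F => dist o.1 o.2 := continuous_fst.dist continuous_snd
  -- A closest pair of points where `h` meets `g` and `k`: between them `h` meets neither again, so
  -- the triangle will be simple.
  obtain ⟨⟨a, b⟩, ⟨⟨ha, ha'⟩, hb, hb'⟩, hmin⟩ :=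
    ((hh.isCompact.inter hg.isCompact).prod (hh.isCompact.inter hk.isCompact)).exists_isMinOn
    ⟨(x, y), ⟨hh.left_mem, hg.left_mem⟩, hh.right_mem, hk.left_mem⟩ hc.continuousOn
  have hmin' : ∀ v ∈ h, ∀ w ∈ h, v ∈ g → w ∈ k → dist a b ≤ dist v w := fun v hv w hw hv' hw' =>
    hmin (a := (v, w)) ⟨⟨hv, hv'⟩, hw, hw'⟩
  obtain ⟨h', hh'h, hh'⟩ := hh.exists_sub ha hb
  obtain ⟨g', hg'g, hg'⟩ := hg.exists_sub hg.right_mem ha'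
  obtain ⟨k', hk'k, hk'⟩ := hk.exists_sub hb' hk.right_mem
  obtain ⟨r, hr, hrM⟩ := hgM _ (hπ y) _ (hπ x)
  -- By the gate property the path from `b` through `π y` to `π x` is geodesic and counts as one
  -- side.
  have hkr := hk'.concat hr (gate y k hk b hb' _ (hπ x))
  have haM : a ∉ M := fun h => Set.disjoint_left.1 hdisj ha h
  have hsub : h' ∪ (k' ∪ r) ∪ g' ⊆ M := by
    refine hT a b (π x) h' (k' ∪ r) g' hh' hkr hg' ?_ ?_ ?_ (π x) (Or.inr hg'.left_mem) (π y)
      (Or.inl (Or.inr (Or.inl hk'.right_mem))) (hπ x) (hπ y) hne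
    · refine Set.eq_singleton_iff_unique_mem.2 ⟨⟨hh'.right_mem, Or.inl hk'.left_mem⟩, ?_⟩
      rintro w ⟨hw, hw' | hw'⟩
      · have e1 := hmin' a ha w (hh'h hw) ha' (hk'k hw')
        have e2 := hh'.dist_add hw
        exact dist_le_zero.1 (by linarith)
      · exact absurd (hrM hw') (Set.disjoint_left.1 hdisj (hh'h hw))
    · refine Set.eq_singleton_iff_unique_mem.2 ⟨⟨Or.inr hr.right_mem, hg'.left_mem⟩, ?_⟩
      rintro w ⟨hw | hw, hw'⟩
      · exact absurd (hk'k hw) (hgk w (hg'g hw'))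
      · exact gateM x g hg w (hg'g hw') (hrM hw)
    · refine Set.eq_singleton_iff_unique_mem.2 ⟨⟨hg'.right_mem, hh'.left_mem⟩, ?_⟩
      rintro w ⟨hw, hw'⟩
      have e1 := hmin' w (hh'h hw') b hb (hg'g hw) hb'
      have e2 := hh'.dist_add hw'
      exact (dist_le_zero.1 (by linarith)).symm
  exact haM (hsub (Or.inr hg'.right_mem))

end gates

/-! ### Topological consequences of the gate property -/

namespace IsGateMap

variable {F : Type*} [MetricSpace F] {M : Set F} {π : F → F}

theorem eq_self (h : IsGateMap M π) {x : F} (hx : x ∈ M) : π x = x := by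
  have := h.dist_eq x x hx
  rw [dist_self] at this
  have h0 := dist_nonneg (x := π x) (y := x)
  exact (dist_le_zero.1 (by linarith)).symm

theorem dist_le (h : IsGateMap M π) (x : F) {z : F} (hz : z ∈ M) : dist x (π x) ≤ dist x z := by
  linarith [h.dist_eq x z hz, dist_nonneg (x := π x) (y := z)]

/-- The map is 1-Lipschitz: a segment from `x` to `y` either misses `M`, and the gates agree, or
meets `M`, and its length accounts for the passage through both gates. -/
theorem continuous (h : IsGateMap M π) (hF : IsGeodesicSubset (Set.univ : Set F)) :
    Continuous π := by
  refine LipschitzWith.continuous (K := 1) (LipschitzWith.of_dist_le_mul fun x y => ?_)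
  simp only [NNReal.coe_one, one_mul]
  obtain ⟨s, hs, -⟩ := hF x trivial y trivial
  by_cases hd : Disjoint s M
  · rw [h.const x y s hs hd, dist_self]
    exact dist_nonneg
  · obtain ⟨m, hm, hmM⟩ := Set.not_disjoint_iff.1 hd
    have e1 := hs.dist_add hm
    have e2 := h.dist_eq x m hmM
    have e3 := h.dist_eq y m hmM
    have e4 := dist_triangle (π x) m (π y)
    rw [dist_comm m y, e2, e3] at e1
    rw [dist_comm m] at e4
    linarith [dist_nonneg (x := x) (y := π x), dist_nonneg (x := y) (y := π y)]

/-- A segment from `x` of length less than `dist x (π x)` cannot reach `M`, so the gate is locally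
constant off `M`. -/
theorem isOpen_fiber (h : IsGateMap M π) (hF : IsGeodesicSubset (Set.univ : Set F)) (p : F) :
    IsOpen {x | x ∉ M ∧ π x = p} := by
  refine Metric.isOpen_iff.2 ?_
  rintro x ⟨hx, rfl⟩
  have hpos : 0 < dist x (π x) := dist_pos.2 fun e => hx (e ▸ h.mem x)
  refine ⟨_, hpos, fun y hy => ?_⟩
  obtain ⟨s, hs, -⟩ := hF x trivial y trivial
  have hdis : Disjoint s M := by
    refine Set.disjoint_left.2 fun m hm hmM => ?_
    have e1 := hs.dist_add hm
    have e2 := h.dist_le x hmM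
    have e3 : dist y x < dist x (π x) := hy
    rw [dist_comm] at e3
    linarith [dist_nonneg (x := m) (y := y)]
  exact ⟨Set.disjoint_left.1 hdis hs.right_mem, (h.const x y s hs hdis).symm⟩

/-- A connected set avoiding the gate of one of its points projects to that gate. -/
theorem eq_of_isPreconnected (h : IsGateMap M π) (hF : IsGeodesicSubset (Set.univ : Set F))
    {C : Set F} (hC : IsPreconnected C) {w w' : F} (hw : w ∈ C) (hw' : w' ∈ C) (hp : π w ∉ C) :
    π w' = π w := by
  by_contra hne
  have hwM : w ∉ M := fun hM => hp (by rwa [h.eq_self hM])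
  have hsub : C ⊆ {x | x ∉ M ∧ π x = π w} ∪ {x | π x ≠ π w} := fun x hx => by
    by_cases hx' : π x = π w
    · exact Or.inl ⟨fun hM => hp (by rw [← hx', h.eq_self hM]; exact hx), hx'⟩
    · exact Or.inr hx'
  obtain ⟨v, -, hv, hv'⟩ := hC _ {x | π x ≠ π w} (h.isOpen_fiber hF (π w))
    (isOpen_ne.preimage (h.continuous hF)) hsub ⟨w, hw, hwM, rfl⟩ ⟨w', hw', hne⟩
  exact hv' hv.2

/-- The gate map is constant on a connected set that avoids `M`. -/
theorem eq_of_disjoint (h : IsGateMap M π) (hF : IsGeodesicSubset (Set.univ : Set F))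
    {C : Set F} (hC : IsPreconnected C) (hd : Disjoint C M) {w w' : F} (hw : w ∈ C)
    (hw' : w' ∈ C) : π w = π w' :=
  h.eq_of_isPreconnected hF hC hw' hw fun h' => Set.disjoint_left.1 hd h' (h.mem w')

/-- An arc with endpoints in `M` is contained in `M`. -/
theorem arc_mem (h : IsGateMap M π) (hF : IsGeodesicSubset (Set.univ : Set F))
    {α : ℝ → F} {a b : ℝ} (hα : ContinuousOn α (Set.Icc a b)) (hinj : Set.InjOn α (Set.Icc a b))
    (ha : α a ∈ M) (hb : α b ∈ M) {t : ℝ} (ht : t ∈ Set.Icc a b) : α t ∈ M := by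
  by_contra htM
  -- Leaving `M` and returning forces both halves of the arc through the gate of `α t`, which
  -- contradicts injectivity.
  have side : ∀ u v : ℝ, Set.Icc u v ⊆ Set.Icc a b → ∀ c ∈ Set.Icc u v, ∀ c' ∈ Set.Icc u v,
      α c' ∈ M → π (α c) = α c ∨ ∃ c'' ∈ Set.Icc u v, α c'' = π (α c) := by
    intro u v huv c hc c' hc' hM
    by_contra! hcon
    have := h.eq_of_isPreconnected hF (isPreconnected_Icc.image α (hα.mono huv))
      (Set.mem_image_of_mem α hc) (Set.mem_image_of_mem α hc')
      (fun ⟨c'', h1, h2⟩ => hcon.2 c'' h1 h2)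
    rw [h.eq_self hM] at this
    exact hcon.2 c' hc' this
  have hπt : π (α t) ≠ α t := fun e => htM (e ▸ h.mem _)
  obtain ⟨c, hc, hc'⟩ := (side a t (Set.Icc_subset_Icc le_rfl ht.2) t ⟨ht.1, le_rfl⟩ a
    ⟨le_rfl, ht.1⟩ ha).resolve_left hπt
  obtain ⟨c₂, hc₂, hc₂'⟩ := (side t b (Set.Icc_subset_Icc ht.1 le_rfl) t ⟨le_rfl, ht.2⟩ b
    ⟨ht.2, le_rfl⟩ hb).resolve_left hπt
  have : c = c₂ := hinj ⟨hc.1, hc.2.trans ht.2⟩ ⟨ht.1.trans hc₂.1, hc₂.2⟩ (hc'.trans hc₂'.symm)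
  have hct : c = t := le_antisymm hc.2 (this ▸ hc₂.1)
  exact hπt (hct ▸ hc'.symm)

/-- A set without cut-points that has two points in `M` is contained in `M`. -/
theorem subset_of_noCut (h : IsGateMap M π) (hF : IsGeodesicSubset (Set.univ : Set F))
    {Y : Set F} (hY : ∀ p, IsPreconnected (Y \ {p})) {a b : F} (ha : a ∈ Y) (hb : b ∈ Y)
    (haM : a ∈ M) (hbM : b ∈ M) (hab : a ≠ b) : Y ⊆ M := by
  intro x hx
  by_contra hxM
  have hxp : x ≠ π x := fun e => hxM (e ▸ h.mem x)
  -- `Y` without the gate of `x` is connected, so all of it projects to that gate; no other point of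
  -- `Y` can lie in `M`.
  have key : ∀ z ∈ Y, z ∈ M → z = π x := by
    intro z hz hzM
    by_contra hne
    have := h.eq_of_isPreconnected hF (hY (π x)) (w := x) (w' := z) ⟨hx, hxp⟩ ⟨hz, hne⟩
      (fun h' => h'.2 rfl)
    rw [h.eq_self hzM] at this
    exact hne this
  exact hab ((key a ha haM).trans (key b hb hbM).symm)

end IsGateMap

/-! ### Simple geodesic triangles with a point removed -/

namespace IsGeodesicSegment

variable {X : Type*} [MetricSpace X] {s t u : Set X} {x y z p : X}

theorem eq_of_dist_eq (h : IsGeodesicSegment s x y) {v w : X} (hv : v ∈ s) (hw : w ∈ s)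
    (hvw : dist x v = dist x w) : v = w := by
  obtain ⟨γ, h0, -, hd, rfl⟩ := h
  obtain ⟨a, ha, rfl⟩ := hv
  obtain ⟨b, hb, rfl⟩ := hw
  have hx : ∀ c ∈ Set.Icc 0 (dist x y), dist x (γ c) = c := fun c hc => by
    conv_lhs => rw [← h0]
    rw [hd 0 ⟨le_rfl, dist_nonneg⟩ c hc, zero_sub, abs_neg, abs_of_nonneg hc.1]
  rw [hx a ha, hx b hb] at hvw
  rw [hvw]

theorem isGeodesicSubset (h : IsGeodesicSegment s x y) : IsGeodesicSubset s :=
  fun _ ha _ hb => let ⟨r, hr, hr'⟩ := h.exists_sub ha hb; ⟨r, hr', hr⟩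

theorem singleton (x : X) : IsGeodesicSegment {x} x x :=
  ⟨fun _ => x, rfl, rfl, by simp, by simp⟩

theorem eq_singleton (h : IsGeodesicSegment s x x) : s = {x} := by
  refine Set.eq_singleton_iff_unique_mem.2 ⟨h.left_mem, fun w hw => ?_⟩
  have := h.dist_add hw
  rw [dist_self] at this
  have h0 := dist_nonneg (x := x) (y := w)
  exact dist_le_zero.1 (by linarith)

theorem exists_mid (h : IsGeodesicSegment s x y) (hxy : x ≠ y) : ∃ m ∈ s, m ≠ x ∧ m ≠ y := by
  obtain ⟨γ, h0, h1, hd, rfl⟩ := h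
  have hpos : 0 < dist x y := dist_pos.2 hxy
  have hm : dist x y / 2 ∈ Set.Icc 0 (dist x y) := ⟨by linarith, by linarith⟩
  refine ⟨_, ⟨_, hm, rfl⟩, ?_, ?_⟩
  · intro e
    have := hd _ hm 0 ⟨le_rfl, hpos.le⟩
    rw [e, h0, dist_self, sub_zero, abs_of_pos (by linarith)] at this
    linarith
  · intro e
    have := hd _ hm _ ⟨hpos.le, le_rfl⟩
    rw [e, h1, dist_self, abs_sub_comm, abs_of_nonneg (by linarith)] at this
    linarith

theorem isPreconnected_diff_left (h : IsGeodesicSegment s x y) : IsPreconnected (s \ {x}) := by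
  obtain ⟨γ, h0, h1, hd, rfl⟩ := h
  have : γ '' Set.Icc 0 (dist x y) \ {x} = γ '' Set.Ioc 0 (dist x y) := by
    ext w
    constructor
    · rintro ⟨⟨a, ha, rfl⟩, hne⟩
      refine ⟨a, ⟨lt_of_le_of_ne ha.1 ?_, ha.2⟩, rfl⟩
      rintro rfl
      exact hne h0
    · rintro ⟨a, ha, rfl⟩
      refine ⟨⟨a, ⟨ha.1.le, ha.2⟩, rfl⟩, fun e : γ a = x => ?_⟩
      have := hd a ⟨ha.1.le, ha.2⟩ 0 ⟨le_rfl, dist_nonneg⟩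
      rw [e, h0, dist_self, sub_zero, abs_of_pos ha.1] at this
      exact ha.1.ne this
  rw [this]
  exact isPreconnected_Ioc.image _ ((continuousOn_of_dist hd).mono Set.Ioc_subset_Icc_self)

theorem exists_split (h : IsGeodesicSegment s x y) (hp : p ∈ s) :
    ∃ s₁ s₂, IsGeodesicSegment s₁ x p ∧ IsGeodesicSegment s₂ p y ∧ s₁ ∪ s₂ = s := by
  obtain ⟨γ, h0, h1, hd, rfl⟩ := h
  obtain ⟨a, ha, rfl⟩ := hp
  have e1 := of_dist ha.1 fun u hu v hv => hd u ⟨hu.1, hu.2.trans ha.2⟩ v ⟨hv.1, hv.2.trans ha.2⟩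
  have e2 := of_dist ha.2 fun u hu v hv => hd u ⟨ha.1.trans hu.1, hu.2⟩ v ⟨ha.1.trans hv.1, hv.2⟩
  rw [h0] at e1
  rw [h1] at e2
  refine ⟨_, _, e1, e2, ?_⟩
  rw [← Set.image_union, Set.Icc_union_Icc_eq_Icc ha.1 ha.2]

/-- If `p` cuts `s`, the half ending at `y` reaches `t` directly, and the half starting at `x`
reaches it around the other way along `u`. -/
theorem exists_connected_of_triangle (hs : IsGeodesicSegment s x y)
    (ht : IsGeodesicSegment t y z) (hu : IsGeodesicSegment u z x) (hus : u ∩ s = {x})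
    (hpt : p ∉ t) {w : X} (hw : w ∈ s) (hwp : w ≠ p) :
    ∃ C ⊆ (s ∪ t ∪ u) \ {p}, t ⊆ C ∧ w ∈ C ∧ IsPreconnected C := by
  have hyp : y ≠ p := fun e => hpt (e ▸ ht.left_mem)
  have htsub : t ⊆ (s ∪ t ∪ u) \ {p} := fun v hv =>
    ⟨Or.inl (Or.inr hv), fun e : v = p => hpt (e ▸ hv)⟩
  by_cases hps : p ∈ s
  · obtain ⟨s₁, s₂, hs₁, hs₂, rfl⟩ := hs.exists_split hps
    rcases hw with hw | hw
    · have hxp : x ≠ p := by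
        rintro rfl
        rw [hs₁.eq_singleton] at hw
        exact hwp hw
      have hpu : p ∉ u := fun h => hxp ((show p ∈ ({x} : Set X) from hus ▸ ⟨h, hps⟩).symm)
      refine ⟨(s₁ \ {p} ∪ u) ∪ t, ?_, Set.subset_union_right, Or.inl (Or.inl ⟨hw, hwp⟩), ?_⟩
      · refine Set.union_subset (Set.union_subset ?_ ?_) htsub
        · exact fun v hv => ⟨Or.inl (Or.inl (Or.inl hv.1)), hv.2⟩
        · exact fun v hv => ⟨Or.inr hv, fun e : v = p => hpu (e ▸ hv)⟩
      · refine IsPreconnected.union z (Or.inr hu.left_mem) ht.right_mem ?_ ht.isPreconnected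
        exact IsPreconnected.union x ⟨hs₁.left_mem, hxp⟩ hu.right_mem
          hs₁.symm.isPreconnected_diff_left hu.isPreconnected
    · refine ⟨s₂ \ {p} ∪ t, ?_, Set.subset_union_right, Or.inl ⟨hw, hwp⟩, ?_⟩
      · exact Set.union_subset (fun v hv => ⟨Or.inl (Or.inl (Or.inr hv.1)), hv.2⟩) htsub
      · exact IsPreconnected.union y ⟨hs₂.right_mem, hyp⟩ ht.left_mem
          hs₂.isPreconnected_diff_left ht.isPreconnected
  · refine ⟨s ∪ t, ?_, Set.subset_union_right, Or.inl hw, ?_⟩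
    · exact Set.union_subset
        (fun v hv => ⟨Or.inl (Or.inl hv), fun e : v = p => hps (e ▸ hv)⟩) htsub
    · exact IsPreconnected.union y hs.right_mem ht.left_mem hs.isPreconnected ht.isPreconnected

theorem isPreconnected_triangle_diff_of_notMem (hs : IsGeodesicSegment s x y)
    (ht : IsGeodesicSegment t y z) (hu : IsGeodesicSegment u z x) (hus : u ∩ s = {x})
    (hpt : p ∉ t) : IsPreconnected ((s ∪ t ∪ u) \ {p}) := by
  refine isPreconnected_of_forall y ?_
  rintro w ⟨(hw | hw) | hw, hwp⟩
  · obtain ⟨C, h1, h2, h3, h4⟩ := hs.exists_connected_of_triangle ht hu hus hpt hw hwp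
    exact ⟨C, h1, h2 ht.left_mem, h3, h4⟩
  · exact ⟨t, fun v hv => ⟨Or.inl (Or.inr hv), fun e : v = p => hpt (e ▸ hv)⟩, ht.left_mem, hw,
      ht.isPreconnected⟩
  · obtain ⟨C, h1, h2, h3, h4⟩ := hu.symm.exists_connected_of_triangle ht.symm hs.symm
      (by rwa [Set.inter_comm]) hpt hw hwp
    refine ⟨C, ?_, h2 ht.left_mem, h3, h4⟩
    rwa [Set.union_assoc, Set.union_comm u, Set.union_comm t s] at h1

/-- A simple geodesic triangle has no cut-point. -/
theorem isPreconnected_triangle_diff (hs : IsGeodesicSegment s x y)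
    (ht : IsGeodesicSegment t y z) (hu : IsGeodesicSegment u z x) (hst : s ∩ t = {y})
    (htu : t ∩ u = {z}) (hus : u ∩ s = {x}) (hxy : x ≠ y) (p : X) :
    IsPreconnected ((s ∪ t ∪ u) \ {p}) := by
  -- Some side misses `p`, since `s ∩ t` and `u ∩ s` are different points; rotate the triangle so
  -- that this side takes the role of `t`.
  by_cases hpt : p ∈ t
  · by_cases hps : p ∈ s
    · have hpu : p ∉ u := fun hpu => hxy
        ((show p ∈ ({x} : Set X) from hus ▸ ⟨hpu, hps⟩).symm.trans
          (show p ∈ ({y} : Set X) from hst ▸ ⟨hps, hpt⟩))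
      have := ht.isPreconnected_triangle_diff_of_notMem hu hs hst hpu
      rwa [Set.union_comm (t ∪ u), ← Set.union_assoc] at this
    · have := hu.isPreconnected_triangle_diff_of_notMem hs ht htu hps
      rwa [Set.union_assoc, Set.union_comm u] at this
  · exact hs.isPreconnected_triangle_diff_of_notMem ht hu hus hpt

end IsGeodesicSegment

/-! ### Tree-graded spaces -/

namespace IsTreeGraded

variable {F : Type*} [MetricSpace F] {P : Set (Set F)}

theorem exists_mem_piece (h : IsTreeGraded F P) (x : F) : ∃ M ∈ P, x ∈ M := by
  have hs := IsGeodesicSegment.singleton x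
  obtain ⟨M, hM, hsub⟩ := h.triangle x x x _ _ _ hs hs hs (Set.inter_self _) (Set.inter_self _)
    (Set.inter_self _)
  exact ⟨M, hM, hsub (Or.inr rfl)⟩

/-- The piece containing the triangle shares two points with `M`, hence equals `M`. -/
theorem absorbsTriangles (h : IsTreeGraded F P) {M : Set F} (hM : M ∈ P) :
    AbsorbsTriangles M := by
  intro x y z s t u hs ht hu hst htu hus a ha b hb haM hbM hab
  obtain ⟨N, hN, hsub⟩ := h.triangle x y z s t u hs ht hu hst htu hus
  have : N = M := by
    by_contra hne
    exact hab (h.inter_subsingleton N hN M hM hne ⟨hsub ha, haM⟩ ⟨hsub hb, hbM⟩)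
  exact this ▸ hsub

theorem exists_isGateMap (h : IsTreeGraded F P) {M : Set F} (hM : M ∈ P) (hne : M.Nonempty) :
    ∃ π : F → F, IsGateMap M π :=
  (h.absorbsTriangles hM).exists_isGateMap h.geodesic (h.piece_closed M hM)
    (h.piece_geodesic M hM) hne

/-- An interior point of a segment that meets no piece in two points separates its endpoints. -/
theorem not_isPreconnected_diff (h : IsTreeGraded F P) {Y g : Set F} {a b m : F}
    (hg : IsGeodesicSegment g a b)
    (hgP : ∀ M ∈ P, ∀ z ∈ g, ∀ z' ∈ g, z ∈ M → z' ∈ M → z = z')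
    (ha : a ∈ Y) (hb : b ∈ Y) (hm : m ∈ g) (hma : m ≠ a) (hmb : m ≠ b) :
    ¬ IsPreconnected (Y \ {m}) := by
  intro hY
  -- Holds vacuously: a triangle lies in a piece, and `g` meets no piece in two points. Thus `g`
  -- itself has a gate map.
  have hT : AbsorbsTriangles g := by
    intro x y z s t u hs ht hu hst htu hus v hv w hw hvg hwg hvw
    obtain ⟨N, hN, hsub⟩ := h.triangle x y z s t u hs ht hu hst htu hus
    exact absurd (hgP N hN v hvg w hwg (hsub hv) (hsub hw)) hvw
  obtain ⟨π, hπ⟩ := hT.exists_isGateMap h.geodesic hg.isCompact.isClosed hg.isGeodesicSubset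
    ⟨a, hg.left_mem⟩
  have hc : Continuous fun x => dist a (π x) := continuous_const.dist (hπ.continuous h.geodesic)
  have hmd : dist a m < dist a b := by
    linarith [hg.dist_add hm, dist_pos.2 hmb]
  -- The two open sets consist of the points projecting before `m`, or onto `m` from outside `g`,
  -- and of those projecting beyond `m`.
  obtain ⟨v, -, hv | hv, hv'⟩ := hY ({x | x ∉ g ∧ π x = m} ∪ {x | dist a (π x) < dist a m})
    {x | dist a m < dist a (π x)}
    ((hπ.isOpen_fiber h.geodesic m).union (isOpen_lt hc continuous_const))
    (isOpen_lt continuous_const hc)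
    (fun x hx => by
      rcases lt_trichotomy (dist a (π x)) (dist a m) with hlt | heq | hgt
      · exact Or.inl (Or.inr hlt)
      · have e := hg.eq_of_dist_eq (hπ.mem x) hm heq
        refine Or.inl (Or.inl ⟨fun hxg => hx.2 ?_, e⟩)
        rw [← e, hπ.eq_self hxg]; rfl
      · exact Or.inr hgt)
    ⟨a, ⟨ha, hma.symm⟩, Or.inr (by
      simpa [hπ.eq_self hg.left_mem, dist_comm] using dist_pos.2 hma)⟩
    ⟨b, ⟨hb, hmb.symm⟩, by simpa [hπ.eq_self hg.right_mem] using hmd⟩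
  · rw [Set.mem_ofPred_eq, hv.2] at hv'
    exact lt_irrefl _ hv'
  · rw [Set.mem_ofPred_eq] at hv hv'
    exact lt_asymm hv hv'

/-- A connected subset without cut-points is contained in a piece. -/
theorem exists_piece_of_noCut (h : IsTreeGraded F P) {Y : Set F} (hYc : IsPreconnected Y)
    (hY : ∀ p, IsPreconnected (Y \ {p})) {a b : F} (ha : a ∈ Y) (hb : b ∈ Y) (hab : a ≠ b) :
    ∃ M ∈ P, Y ⊆ M := by
  obtain ⟨g, hg, -⟩ := h.geodesic a trivial b trivial
  by_cases hgP : ∀ M ∈ P, ∀ z ∈ g, ∀ z' ∈ g, z ∈ M → z' ∈ M → z = z'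
  · obtain ⟨m, hm, hma, hmb⟩ := hg.exists_mid hab
    exact absurd (hY m) (h.not_isPreconnected_diff hg hgP ha hb hm hma hmb)
  push Not at hgP
  obtain ⟨M, hM, z, hz, z', hz', hzM, hzM', hne⟩ := hgP
  obtain ⟨π, hπ⟩ := h.exists_isGateMap hM ⟨z, hzM⟩
  -- With a common gate, the geodesic from `a` to `b` could meet `M` only in that gate.
  have hπab : π a ≠ π b := by
    intro e
    have key : ∀ w ∈ g, w ∈ M → w = π a := by
      intro w hw hwM
      have e1 := hg.dist_add hw
      have e2 := hπ.dist_eq a w hwM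
      have e3 := hπ.dist_eq b w hwM
      have e4 := dist_triangle_right a b (π a)
      rw [← e] at e3
      rw [dist_comm w b] at e1
      exact (dist_le_zero.1 (by linarith)).symm
    exact hne ((key z hz hzM).trans (key z' hz' hzM').symm)
  -- If the gate of `a` were not in the connected set `Y`, all of `Y` would project to it.
  have hπa : π a ∈ Y := by
    by_contra hn
    exact hπab (hπ.eq_of_isPreconnected h.geodesic hYc ha hb hn).symm
  have hπb : π b ∈ Y := by
    by_contra hn
    exact hπab (hπ.eq_of_isPreconnected h.geodesic hYc hb ha hn)
  exact ⟨M, hM, hπ.subset_of_noCut h.geodesic hY hπa hπb (hπ.mem a) (hπ.mem b) hπab⟩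

/-- Tree-gradedness is invariant under bilipschitz homeomorphisms between geodesic spaces. -/
theorem of_bilipschitz {F' : Type*} [MetricSpace F'] (h : IsTreeGraded F P) {P' : Set (Set F')}
    (Φ : F' → F) {K K' : NNReal} (hL : LipschitzWith K Φ) (hA : AntilipschitzWith K' Φ)
    (hs : Function.Surjective Φ) (hF' : IsGeodesicSubset (Set.univ : Set F'))
    (h1 : ∀ M' ∈ P', Φ '' M' ∈ P) (h2 : ∀ M ∈ P, ∃ M' ∈ P', Φ '' M' = M) :
    IsTreeGraded F' P' := by
  have hinj := hA.injective
  have hpre : ∀ M' : Set F', Φ ⁻¹' (Φ '' M') = M' := fun M' => Set.preimage_image_eq _ hinj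
  have hc := h.complete
  refine ⟨?_, hF', ?_, ?_, ?_, ?_⟩
  · have hu := hA.isUniformInducing hL.uniformContinuous
    refine (completeSpace_iff_isComplete_range hu).2 ?_
    rw [hs.range_eq]
    exact completeSpace_iff_isComplete_univ.1 hc
  · intro M' hM'
    rw [← hpre M']
    exact (h.piece_closed _ (h1 M' hM')).preimage hL.continuous
  · intro M' hM' x hx y hy
    obtain ⟨s, hseg, -⟩ := hF' x trivial y trivial
    refine ⟨s, hseg, ?_⟩
    obtain ⟨γ, h0, hd1, hd, rfl⟩ := hseg
    -- `Φ` sends the geodesic to a mere arc, but an arc with endpoints in a piece stays in the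
    -- piece.
    obtain ⟨π, hπ⟩ := h.exists_isGateMap (h1 M' hM') ⟨Φ x, x, hx, rfl⟩
    rintro _ ⟨t, ht, rfl⟩
    rw [← hpre M']
    refine hπ.arc_mem h.geodesic (α := fun t => Φ (γ t)) (a := 0) (b := dist x y) ?_ ?_ ?_ ?_ ht
    · exact hL.continuous.comp_continuousOn (IsGeodesicSegment.continuousOn_of_dist hd)
    · intro u hu v hv e
      have := hd u hu v hv
      rw [hinj e, dist_self] at this
      exact sub_eq_zero.1 (abs_eq_zero.1 this.symm)
    · exact ⟨x, hx, by simp only [h0]⟩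
    · exact ⟨y, hy, by simp only [hd1]⟩
  · intro M' hM' N' hN' hne x hx y hy
    have hne' : Φ '' M' ≠ Φ '' N' := fun e => hne (by rw [← hpre M', e, hpre])
    exact hinj (h.inter_subsingleton _ (h1 M' hM') _ (h1 N' hN') hne'
      ⟨⟨x, hx.1, rfl⟩, ⟨x, hx.2, rfl⟩⟩ ⟨⟨y, hy.1, rfl⟩, ⟨y, hy.2, rfl⟩⟩)
  · intro x y z s t u hs' ht hu hst htu hus
    have lift : (∃ M ∈ P, Φ '' (s ∪ t ∪ u) ⊆ M) → ∃ M' ∈ P', s ∪ t ∪ u ⊆ M' := by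
      rintro ⟨M, hM, hsub⟩
      obtain ⟨M', hM', rfl⟩ := h2 M hM
      exact ⟨M', hM', fun w hw => by rw [← hpre M']; exact hsub ⟨w, hw, rfl⟩⟩
    apply lift
    by_cases hxy : x = y
    · subst hxy
      have hxz : x = z := by
        have : x ∈ t ∩ u := ⟨ht.left_mem, hu.right_mem⟩
        rw [htu] at this
        exact this
      subst hxz
      obtain ⟨M, hM, hx⟩ := h.exists_mem_piece (Φ x)
      refine ⟨M, hM, ?_⟩
      rw [hs'.eq_singleton, ht.eq_singleton, hu.eq_singleton]
      simpa using hx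
    -- The image of a simple triangle need not be geodesic, but it is still connected and without
    -- cut-points.
    · refine h.exists_piece_of_noCut ?_ ?_ (a := Φ x) (b := Φ y)
        ⟨x, Or.inl (Or.inl hs'.left_mem), rfl⟩ ⟨y, Or.inl (Or.inl hs'.right_mem), rfl⟩
        (fun e => hxy (hinj e))
      · refine IsPreconnected.image ?_ _ hL.continuous.continuousOn
        exact (hs'.isPreconnected.union y hs'.right_mem ht.left_mem ht.isPreconnected).union z
          (Or.inr ht.right_mem) hu.left_mem hu.isPreconnected
      · intro q
        obtain ⟨p, rfl⟩ := hs q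
        rw [← Set.image_singleton, ← Set.image_sdiff hinj]
        exact (hs'.isPreconnected_triangle_diff ht hu hst htu hus hxy p).image _
          hL.continuous.continuousOn

end IsTreeGraded

/-! ### Quasi-isometric embeddings with given constants -/

/-- `f` is an `(L, C)`-quasi-isometric embedding. -/
def QIEWith {X Y : Type*} [MetricSpace X] [MetricSpace Y] (L C : ℝ) (f : X → Y) : Prop :=
  ∀ x x' : X, L⁻¹ * dist x x' - C ≤ dist (f x) (f x') ∧ dist (f x) (f x') ≤ L * dist x x' + C

namespace QIEWith

variable {X Y Z : Type*} [MetricSpace X] [MetricSpace Y] [MetricSpace Z] {L C : ℝ} {f : X → Y}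

theorem mono (h : QIEWith L C f) (hL : 1 ≤ L) {L' C' : ℝ} (hL' : L ≤ L') (hC' : C ≤ C') :
    QIEWith L' C' f := by
  intro x x'
  obtain ⟨h1, h2⟩ := h x x'
  have : L'⁻¹ ≤ L⁻¹ := inv_anti₀ (by linarith) hL'
  have hd := dist_nonneg (x := x) (y := x')
  constructor <;> nlinarith

theorem dist_le (h : QIEWith L C f) (hL : 1 ≤ L) (x x' : X) :
    dist x x' ≤ L * dist (f x) (f x') + L * C := by
  have h1 := (h x x').1
  have hpos : 0 < L := by linarith
  have h2 := mul_le_mul_of_nonneg_left h1 hpos.le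
  rw [mul_sub, mul_inv_cancel_left₀ hpos.ne'] at h2
  linarith

theorem comp {L' C' : ℝ} {g : Y → Z} (hg : QIEWith L' C' g) (hf : QIEWith L C f)
    (hL' : 1 ≤ L') (hC : 0 ≤ C) : QIEWith (L' * L) (L' * C + C') (fun x => g (f x)) := by
  intro x x'
  obtain ⟨h1, h2⟩ := hf x x'
  obtain ⟨h3, h4⟩ := hg (f x) (f x')
  have hpos : 0 < L' := by linarith
  constructor
  · have e1 := mul_le_mul_of_nonneg_left h1 (inv_nonneg.2 hpos.le)
    have e2 : L'⁻¹ * C ≤ L' * C :=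
      mul_le_mul_of_nonneg_right ((inv_le_one_of_one_le₀ hL').trans hL') hC
    rw [mul_inv]
    linarith
  · have e1 := mul_le_mul_of_nonneg_left h2 hpos.le
    linarith

/-- A coarsely surjective quasi-isometric embedding is a quasi-isometry. -/
theorem quasiIsometric (h : QIEWith L C f) (hL : 1 ≤ L) (hC : 0 ≤ C) {K : ℝ}
    (hK : ∀ y, ∃ x, dist (f x) y ≤ K) : QuasiIsometric X Y := by
  choose g hg using hK
  have hL0 : 0 < L := by linarith
  refine ⟨f, g, ⟨L, C, hL, hC, h⟩, ⟨L, L * (2 * |K| + C), hL, by positivity, ?_⟩,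
    ⟨L * (K + C), fun x => ?_⟩, ⟨K, hg⟩⟩
  · intro y y'
    have h1 := h.dist_le hL (g y) (g y')
    have h2 := (h (g y) (g y')).2
    have e1 := dist_triangle4 y (f (g y)) (f (g y')) y'
    rw [dist_comm y (f (g y))] at e1
    have e2 := dist_triangle4_right (f (g y)) (f (g y')) y y'
    have e3 := hg y
    have e4 := hg y'
    have e5 := le_abs_self K
    constructor
    · rw [sub_le_iff_le_add, inv_mul_le_iff₀ hL0]
      have : 0 ≤ L * (L * (2 * |K| + C)) - (2 * |K| + C) := by
        have : 1 ≤ L * L := one_le_mul_of_one_le_of_one_le hL hL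
        nlinarith [abs_nonneg K]
      nlinarith
    · nlinarith
  · have h1 := h.dist_le hL (g (f x)) x
    have h2 := hg (f x)
    nlinarith

end QIEWith

/-! ### Points of asymptotic cones -/

section cones

variable {X : Type*} [MetricSpace X] {ω : Ultrafilter ℕ} {d : ScalingSeq ω} {e : ℕ → X}

theorem ScalingSeq.eventually_ge (d : ScalingSeq ω) (r : ℝ) :
    ∀ᶠ n in (ω : Filter ℕ), r ≤ d.val n :=
  d.tendsto_val.eventually_ge_atTop r

theorem ScalingSeq.tendsto_div (d : ScalingSeq ω) (K : ℝ) :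
    Tendsto (fun n => K / d.val n) (ω : Filter ℕ) (𝓝 0) :=
  d.tendsto_val.const_div_atTop K

namespace UltraPts

/-- A sequence at linearly bounded distance from the base points. -/
def ofBound (x : ℕ → X) (r K : ℝ) (h : ∀ᶠ n in (ω : Filter ℕ), dist (x n) (e n) ≤ r * d.val n + K) :
    UltraPts (fun _ => X) d e :=
  ⟨x, r + |K|, by
    filter_upwards [h, d.eventually_ge 1] with n hn h1
    rw [div_le_iff₀ (by linarith)]
    nlinarith [le_abs_self K, abs_nonneg K]⟩

@[simp] theorem ofBound_val (x : ℕ → X) (r K : ℝ)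
    (h : ∀ᶠ n in (ω : Filter ℕ), dist (x n) (e n) ≤ r * d.val n + K) :
    (ofBound x r K h).1 = x := rfl

theorem exists_bound (x : UltraPts (fun _ => X) d e) :
    ∃ r : ℝ, ∀ᶠ n in (ω : Filter ℕ), dist (x.1 n) (e n) ≤ r * d.val n := by
  obtain ⟨r, hr⟩ := x.2
  refine ⟨r, ?_⟩
  filter_upwards [hr, d.eventually_ge 1] with n hn h1
  rwa [div_le_iff₀ (by linarith)] at hn

theorem tendsto_dist_mk (x y : UltraPts (fun _ => X) d e) :
    Tendsto (fun n => dist (x.1 n) (y.1 n) / d.val n) (ω : Filter ℕ)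
      (𝓝 (dist (SeparationQuotient.mk x) (SeparationQuotient.mk y))) :=
  tendsto_limDist x y

theorem dist_mk_le {x y : UltraPts (fun _ => X) d e} {r K : ℝ}
    (h : ∀ᶠ n in (ω : Filter ℕ), dist (x.1 n) (y.1 n) ≤ r * d.val n + K) :
    dist (SeparationQuotient.mk x) (SeparationQuotient.mk y) ≤ r := by
  have h2 : Tendsto (fun n => r + K / d.val n) (ω : Filter ℕ) (𝓝 (r + 0)) :=
    tendsto_const_nhds.add (d.tendsto_div K)
  rw [add_zero] at h2
  refine le_of_tendsto_of_tendsto (tendsto_dist_mk x y) h2 ?_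
  filter_upwards [h, d.eventually_ge 1] with n hn h1
  have : 0 < d.val n := by linarith
  rw [div_le_iff₀ this, add_mul, div_mul_cancel₀ _ this.ne']
  exact hn

theorem le_dist_mk {x y : UltraPts (fun _ => X) d e} {r K : ℝ}
    (h : ∀ᶠ n in (ω : Filter ℕ), r * d.val n - K ≤ dist (x.1 n) (y.1 n)) :
    r ≤ dist (SeparationQuotient.mk x) (SeparationQuotient.mk y) := by
  have h2 : Tendsto (fun n => r - K / d.val n) (ω : Filter ℕ) (𝓝 (r - 0)) :=
    tendsto_const_nhds.sub (d.tendsto_div K)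
  rw [sub_zero] at h2
  refine le_of_tendsto_of_tendsto h2 (tendsto_dist_mk x y) ?_
  filter_upwards [h, d.eventually_ge 1] with n hn h1
  have : 0 < d.val n := by linarith
  rw [le_div_iff₀ this, sub_mul, div_mul_cancel₀ _ this.ne']
  exact hn

theorem mk_eq_mk {x y : UltraPts (fun _ => X) d e} {K : ℝ}
    (h : ∀ᶠ n in (ω : Filter ℕ), dist (x.1 n) (y.1 n) ≤ K) :
    SeparationQuotient.mk x = SeparationQuotient.mk y := by
  refine dist_le_zero.1 (dist_mk_le (K := K) ?_)
  simpa using h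

theorem eventually_dist_lt {x y : UltraPts (fun _ => X) d e} {r : ℝ}
    (h : dist (SeparationQuotient.mk x) (SeparationQuotient.mk y) < r) :
    ∀ᶠ n in (ω : Filter ℕ), dist (x.1 n) (y.1 n) < r * d.val n := by
  filter_upwards [(tendsto_dist_mk x y).eventually_lt_const h, d.eventually_ge 1] with n hn h1
  rwa [div_lt_iff₀ (by linarith)] at hn

end UltraPts

open UltraPts

/-! ### Limit sets -/

theorem exists_mem_limSet_dist_le {A : ℕ → Set X} {x : UltraPts (fun _ => X) d e} {r K : ℝ}
    (h : ∀ᶠ n in (ω : Filter ℕ), ∃ a ∈ A n, dist (x.1 n) a ≤ r * d.val n + K) :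
    ∃ p ∈ limSet d e A, dist (SeparationQuotient.mk x) p ≤ r := by
  classical
  obtain ⟨r', hr'⟩ := x.exists_bound
  -- The default `x.1 n` is used only on an `ω`-null set of indices.
  let a : ℕ → X := fun n =>
    if hn : ∃ a ∈ A n, dist (x.1 n) a ≤ r * d.val n + K then hn.choose else x.1 n
  have ha : ∀ᶠ n in (ω : Filter ℕ), a n ∈ A n ∧ dist (x.1 n) (a n) ≤ r * d.val n + K := by
    filter_upwards [h] with n hn
    simp only [a, dif_pos hn]
    exact hn.choose_spec
  have hb : ∀ᶠ n in (ω : Filter ℕ), dist (a n) (e n) ≤ (r' + r) * d.val n + K := by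
    filter_upwards [ha, hr'] with n h1 h2
    have := dist_triangle_left (a n) (e n) (x.1 n)
    linarith [h1.2]
  exact ⟨_, ⟨ofBound a _ _ hb, rfl, ha.mono fun n h => h.1⟩, dist_mk_le (ha.mono fun n h => h.2)⟩

theorem mem_limSet_of_near {A : ℕ → Set X} {x : UltraPts (fun _ => X) d e} {K : ℝ}
    (h : ∀ᶠ n in (ω : Filter ℕ), ∃ a ∈ A n, dist (x.1 n) a ≤ K) :
    SeparationQuotient.mk x ∈ limSet d e A := by
  obtain ⟨p, hp, hd⟩ := exists_mem_limSet_dist_le (A := A) (x := x) (r := 0) (K := K)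
    (by simpa using h)
  rwa [dist_le_zero.1 hd]

theorem eventually_near_of_mem_limSet {A : ℕ → Set X} {x : UltraPts (fun _ => X) d e}
    (h : SeparationQuotient.mk x ∈ limSet d e A) {ε : ℝ} (hε : 0 < ε) :
    ∀ᶠ n in (ω : Filter ℕ), ∃ a ∈ A n, dist (x.1 n) a < ε * d.val n := by
  obtain ⟨y, hy, hA⟩ := h
  have : dist (SeparationQuotient.mk x) (SeparationQuotient.mk y) < ε := by
    rw [hy, dist_self]; exact hε
  filter_upwards [eventually_dist_lt this, hA] with n h1 h2
  exact ⟨_, h2, h1⟩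

theorem limSet_mem_limPieces {𝒜 : Set (Set X)} {A : ℕ → Set X} (hA : ∀ n, A n ∈ 𝒜)
    (hne : (limSet d e A).Nonempty) : limSet d e A ∈ limPieces 𝒜 d e := by
  obtain ⟨_, x, -, hx⟩ := hne
  obtain ⟨C, hC⟩ := x.2
  refine ⟨A, hA, ⟨C, ?_⟩, rfl⟩
  filter_upwards [hC, hx] with n h1 h2
  exact ⟨_, h2, by rwa [dist_comm]⟩

theorem limSet_congr {A B : ℕ → Set X} (h : ∀ᶠ n in (ω : Filter ℕ), A n = B n) :
    limSet d e A = limSet d e B := by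
  ext p
  constructor
  · rintro ⟨x, hx, hA⟩
    exact ⟨x, hx, by filter_upwards [h, hA] with n h1 h2; exact h1 ▸ h2⟩
  · rintro ⟨x, hx, hA⟩
    exact ⟨x, hx, by filter_upwards [h, hA] with n h1 h2; exact h1 ▸ h2⟩

theorem limPieces_nonempty {𝒜 : Set (Set X)} {M : Set (AsymptoticCone X d e)}
    (hM : M ∈ limPieces 𝒜 d e) : M.Nonempty := by
  obtain ⟨A, -, ⟨C, hC⟩, rfl⟩ := hM
  obtain ⟨p, hp, -⟩ := exists_mem_limSet_dist_le (A := A) (d := d) (e := e) (r := C) (K := 0)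
    (x := ofBound e 0 0 (by simp)) (by
      filter_upwards [hC, d.eventually_ge 1] with n ⟨a, ha, h⟩ h1
      refine ⟨a, ha, ?_⟩
      rw [div_le_iff₀ (by linarith)] at h
      simpa using h)
  exact ⟨p, hp⟩

/-! ### The map of cones induced by a quasi-isometric embedding -/

variable {Y : Type*} [MetricSpace Y] {L C : ℝ} {f : Y → X}

/-- The map induced on sequences by a quasi-isometric embedding. -/
def UltraPts.map (hf : QIEWith L C f) (hL : 1 ≤ L) {e : ℕ → Y} (y : UltraPts (fun _ => Y) d e) :
    UltraPts (fun _ => X) d (fun n => f (e n)) :=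
  ⟨fun n => f (y.1 n), by
    obtain ⟨r, hr⟩ := y.exists_bound
    refine (ofBound (d := d) (e := fun n => f (e n)) (fun n => f (y.1 n)) (L * r) C ?_).2
    filter_upwards [hr] with n hn
    have := (hf (y.1 n) (e n)).2
    nlinarith⟩

theorem UltraPts.dist_map_le (hf : QIEWith L C f) (hL : 1 ≤ L) {e : ℕ → Y}
    (y z : UltraPts (fun _ => Y) d e) :
    dist (SeparationQuotient.mk (y.map hf hL)) (SeparationQuotient.mk (z.map hf hL)) ≤
      L * dist (SeparationQuotient.mk y) (SeparationQuotient.mk z) := by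
  refine le_of_tendsto_of_tendsto (tendsto_dist_mk _ _)
    (((tendsto_dist_mk y z).const_mul L).add (d.tendsto_div C) |>.trans (by simp)) ?_
  filter_upwards [d.eventually_ge 1] with n h1
  rw [← mul_div_assoc, ← add_div]
  gcongr
  exact (hf _ _).2

theorem UltraPts.le_dist_map (hf : QIEWith L C f) (hL : 1 ≤ L) {e : ℕ → Y}
    (y z : UltraPts (fun _ => Y) d e) :
    dist (SeparationQuotient.mk y) (SeparationQuotient.mk z) ≤
      L * dist (SeparationQuotient.mk (y.map hf hL)) (SeparationQuotient.mk (z.map hf hL)) := by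
  refine le_of_tendsto_of_tendsto (tendsto_dist_mk y z)
    (((tendsto_dist_mk (y.map hf hL) (z.map hf hL)).const_mul L).add
      (d.tendsto_div (L * C)) |>.trans (by simp)) ?_
  filter_upwards [d.eventually_ge 1] with n h1
  rw [← mul_div_assoc, ← add_div]
  gcongr
  exact hf.dist_le hL _ _

/-- The map of asymptotic cones induced by a quasi-isometric embedding. -/
noncomputable def coneMap (hf : QIEWith L C f) (hL : 1 ≤ L) (d : ScalingSeq ω) (e : ℕ → Y) :
    AsymptoticCone Y d e → AsymptoticCone X d (fun n => f (e n)) :=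
  SeparationQuotient.lift (fun y => SeparationQuotient.mk (y.map hf hL)) fun y z hyz => by
    have h1 := UltraPts.dist_map_le hf hL y z
    rw [SeparationQuotient.mk_eq_mk.2 hyz, dist_self, mul_zero] at h1
    exact dist_le_zero.1 h1

theorem lipschitzWith_coneMap (hf : QIEWith L C f) (hL : 1 ≤ L) (d : ScalingSeq ω) (e : ℕ → Y) :
    LipschitzWith L.toNNReal (coneMap hf hL d e) := by
  refine LipschitzWith.of_dist_le_mul fun p q => ?_
  obtain ⟨y, rfl⟩ := SeparationQuotient.surjective_mk p
  obtain ⟨z, rfl⟩ := SeparationQuotient.surjective_mk q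
  rw [Real.coe_toNNReal _ (by linarith)]
  exact UltraPts.dist_map_le hf hL y z

theorem antilipschitzWith_coneMap (hf : QIEWith L C f) (hL : 1 ≤ L) (d : ScalingSeq ω)
    (e : ℕ → Y) : AntilipschitzWith L.toNNReal (coneMap hf hL d e) := by
  refine AntilipschitzWith.of_le_mul_dist fun p q => ?_
  obtain ⟨y, rfl⟩ := SeparationQuotient.surjective_mk p
  obtain ⟨z, rfl⟩ := SeparationQuotient.surjective_mk q
  rw [Real.coe_toNNReal _ (by linarith)]
  exact UltraPts.le_dist_map hf hL y z

theorem exists_map_near (hf : QIEWith L C f) (hL : 1 ≤ L) {e : ℕ → Y} {K : ℝ}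
    (x : UltraPts (fun _ => X) d (fun n => f (e n))) (y : ℕ → Y)
    (hy : ∀ᶠ n in (ω : Filter ℕ), dist (f (y n)) (x.1 n) ≤ K) :
    ∃ z : UltraPts (fun _ => Y) d e, z.1 = y ∧
      SeparationQuotient.mk (z.map hf hL) = SeparationQuotient.mk x := by
  obtain ⟨r, hr⟩ := x.exists_bound
  refine ⟨ofBound y (L * r) (L * K + L * C) ?_, rfl, mk_eq_mk (K := K) hy⟩
  filter_upwards [hy, hr] with n h1 h2
  have h3 := hf.dist_le hL (y n) (e n)
  have h4 := dist_triangle (f (y n)) (x.1 n) (f (e n))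
  have : L * dist (f (y n)) (f (e n)) ≤ L * (K + r * d.val n) := by gcongr; linarith
  linarith

theorem surjective_coneMap (hf : QIEWith L C f) (hL : 1 ≤ L) {K : ℝ}
    (hK : ∀ x, ∃ y, dist (f y) x ≤ K) (d : ScalingSeq ω) (e : ℕ → Y) :
    Function.Surjective (coneMap hf hL d e) := by
  intro p
  obtain ⟨x, rfl⟩ := SeparationQuotient.surjective_mk p
  choose g hg using hK
  obtain ⟨z, -, hz⟩ := exists_map_near hf hL x (fun n => g (x.1 n))
    (Eventually.of_forall fun n => hg (x.1 n))
  exact ⟨SeparationQuotient.mk z, hz⟩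

theorem image_coneMap_limSet (hf : QIEWith L C f) (hL : 1 ≤ L) {e : ℕ → Y} {K : ℝ}
    {A : ℕ → Set X} {B : ℕ → Set Y}
    (h1 : ∀ᶠ n in (ω : Filter ℕ), ∀ b ∈ B n, ∃ a ∈ A n, dist (f b) a ≤ K)
    (h2 : ∀ᶠ n in (ω : Filter ℕ), ∀ a ∈ A n, ∃ b ∈ B n, dist (f b) a ≤ K) :
    coneMap hf hL d e '' limSet d e B = limSet d (fun n => f (e n)) A := by
  classical
  ext p
  constructor
  · rintro ⟨_, ⟨y, rfl, hy⟩, rfl⟩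
    refine mem_limSet_of_near (K := K) ?_
    filter_upwards [h1, hy] with n hn hyn
    exact hn _ hyn
  · rintro ⟨x, rfl, hx⟩
    let b : ℕ → Y := fun n => if h : ∃ b ∈ B n, dist (f b) (x.1 n) ≤ K then h.choose else e n
    have hb : ∀ᶠ n in (ω : Filter ℕ), b n ∈ B n ∧ dist (f (b n)) (x.1 n) ≤ K := by
      filter_upwards [h2, hx] with n hn hxn
      have := hn _ hxn
      simp only [b, dif_pos this]
      exact this.choose_spec
    obtain ⟨z, hz, hz'⟩ := exists_map_near hf hL x b (hb.mono fun n h => h.2)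
    exact ⟨SeparationQuotient.mk z, ⟨z, rfl, by simpa only [hz] using hb.mono fun n h => h.1⟩, hz'⟩

end cones

/-- Asymptotic tree-gradedness is a quasi-isometry invariant. -/
theorem IsAsymptoticallyTreeGraded.of_quasiIsometry {X Y : Type*} [MetricSpace X] [MetricSpace Y]
    {𝒜 : Set (Set X)} {ℬ : Set (Set Y)} (h : IsAsymptoticallyTreeGraded 𝒜) {L C K : ℝ} {f : Y → X}
    (hf : QIEWith L C f) (hL : 1 ≤ L) (hK : ∀ x, ∃ y, dist (f y) x ≤ K)
    (hgeo : ∀ (ω : Ultrafilter ℕ) (d : ScalingSeq ω) (e : ℕ → Y),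
      IsGeodesicSubset (Set.univ : Set (AsymptoticCone Y d e)))
    (R : Set X → Set Y → Prop) (hℬ : ∀ B ∈ ℬ, ∃ A ∈ 𝒜, R A B) (h𝒜 : ∀ A ∈ 𝒜, ∃ B ∈ ℬ, R A B)
    (huniq : ∀ A B B', R A B → R A B' → B = B')
    (h1 : ∀ A B, R A B → ∀ b ∈ B, ∃ a ∈ A, dist (f b) a ≤ K)
    (h2 : ∀ A B, R A B → ∀ a ∈ A, ∃ b ∈ B, dist (f b) a ≤ K) :
    IsAsymptoticallyTreeGraded ℬ := by
  intro ω d e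
  obtain ⟨htg, hdisj⟩ := h ω d (fun n => f (e n))
  have himg : ∀ (A : ℕ → Set X) (B : ℕ → Set Y), (∀ n, R (A n) (B n)) →
      coneMap hf hL d e '' limSet d e B = limSet d (fun n => f (e n)) A := fun A B hR =>
    image_coneMap_limSet hf hL (Eventually.of_forall fun n => h1 _ _ (hR n))
      (Eventually.of_forall fun n => h2 _ _ (hR n))
  refine ⟨htg.of_bilipschitz (coneMap hf hL d e) (lipschitzWith_coneMap hf hL d e)
    (antilipschitzWith_coneMap hf hL d e) (surjective_coneMap hf hL hK d e) (hgeo ω d e) ?_ ?_, ?_⟩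
  · intro M' hM'
    have hne := limPieces_nonempty hM'
    obtain ⟨B, hB, -, rfl⟩ := hM'
    choose A hA hR using fun n => hℬ (B n) (hB n)
    rw [himg A B hR]
    exact limSet_mem_limPieces hA (himg A B hR ▸ hne.image _)
  · intro M hM
    have hne := limPieces_nonempty hM
    obtain ⟨A, hA, -, rfl⟩ := hM
    choose B hB hR using fun n => h𝒜 (A n) (hA n)
    refine ⟨limSet d e B, limSet_mem_limPieces hB ?_, himg A B hR⟩
    rw [← himg A B hR] at hne
    exact hne.of_image
  · intro B B' hB hB' hne p hp q hq
    choose A hA hR using fun n => hℬ (B n) (hB n)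
    choose A' hA' hR' using fun n => hℬ (B' n) (hB' n)
    refine (antilipschitzWith_coneMap hf hL d e).injective (hdisj A A' hA hA' ?_ ?_ ?_)
    -- `R` attaches only one member of `ℬ` to each member of `𝒜`, so almost surely different `B n`,
    -- `B' n` come from almost surely different `A n`, `A' n`.
    · filter_upwards [hne] with n hn heq
      exact hn (huniq _ _ _ (hR n) (heq ▸ hR' n))
    · rw [← himg A B hR, ← himg A' B' hR']
      exact ⟨⟨p, hp.1, rfl⟩, ⟨p, hp.2, rfl⟩⟩
    · rw [← himg A B hR, ← himg A' B' hR']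
      exact ⟨⟨q, hq.1, rfl⟩, ⟨q, hq.2, rfl⟩⟩

/-! ### Word metrics -/

/-- The word metric of `S`, as a function on the group. -/
noncomputable def wordDist {G : Type*} [Group G] (S : FinGenSet G) (a b : G) : ℝ :=
  dist (α := CayleyVertices S) a b

section word

variable {G : Type*} [Group G] (S : FinGenSet G)

theorem CayleyVertices.dist_eq (a b : CayleyVertices S) : dist a b = wordDist S a b := rfl

theorem wordDist_eq (a b : G) : wordDist S a b = ((CayleyVertices.graph S).dist a b : ℝ) := rfl

theorem wordDist_self (a : G) : wordDist S a a = 0 := dist_self (α := CayleyVertices S) a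

theorem wordDist_nonneg (a b : G) : 0 ≤ wordDist S a b := dist_nonneg (α := CayleyVertices S)

theorem wordDist_comm (a b : G) : wordDist S a b = wordDist S b a :=
  dist_comm (α := CayleyVertices S) a b

theorem wordDist_triangle (a b c : G) : wordDist S a c ≤ wordDist S a b + wordDist S b c :=
  dist_triangle (α := CayleyVertices S) a b c

theorem CayleyVertices.adj_mul_left_iff (g a b : G) :
    (graph S).Adj (g * a) (g * b) ↔ (graph S).Adj a b := by
  simp only [graph, SimpleGraph.mulCayley_adj', ne_eq, mul_right_inj, mul_assoc]

theorem wordDist_mul_left (g a b : G) : wordDist S (g * a) (g * b) = wordDist S a b := by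
  have key : ∀ g a b : G, (CayleyVertices.graph S).dist (g * a) (g * b) ≤
      (CayleyVertices.graph S).dist a b := by
    intro g a b
    obtain ⟨p, hp⟩ := (CayleyVertices.graph_connected S).exists_walk_length_eq_dist a b
    let φ : CayleyVertices.graph S →g CayleyVertices.graph S :=
      ⟨fun x => g * x, fun h => (CayleyVertices.adj_mul_left_iff S g _ _).2 h⟩
    rw [← hp, ← SimpleGraph.Walk.length_map φ p]
    exact SimpleGraph.dist_le _
  rw [wordDist_eq, wordDist_eq]
  refine congrArg _ (le_antisymm (key g a b) ?_)
  simpa using key g⁻¹ (g * a) (g * b)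

theorem wordDist_inv_mul (a b : G) : wordDist S 1 (a⁻¹ * b) = wordDist S a b := by
  rw [← wordDist_mul_left S a, mul_one, mul_inv_cancel_left]

theorem wordDist_self_mul (a b : G) : wordDist S a (a * b) = wordDist S 1 b := by
  rw [← wordDist_inv_mul, inv_mul_cancel_left]

theorem wordDist_mul_right_le (a b u : G) :
    wordDist S (a * u) (b * u) ≤ wordDist S a b + 2 * wordDist S 1 u := by
  have h1 := wordDist_triangle S (a * u) a (b * u)
  have h2 := wordDist_triangle S a b (b * u)
  rw [wordDist_comm S (a * u) a, wordDist_self_mul] at h1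
  rw [wordDist_self_mul] at h2
  linarith

theorem wordDist_gen_le {s : G} (hs : s ∈ S.gens) : wordDist S 1 s ≤ 1 := by
  by_cases h : (1 : G) = s
  · rw [← h, wordDist_self]; exact zero_le_one
  · have : (CayleyVertices.graph S).Adj 1 s := by
      rw [CayleyVertices.graph, SimpleGraph.mulCayley_adj']
      exact ⟨h, s, hs, Or.inl (one_mul s)⟩
    rw [wordDist_eq, SimpleGraph.dist_eq_one_iff_adj.2 this]
    simp

/-- Points of word metrics are joined by discrete geodesics. -/
theorem exists_word_geodesic (a b : G) : ∃ (N : ℕ) (γ : ℕ → G), (N : ℝ) = wordDist S a b ∧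
    γ 0 = a ∧ γ N = b ∧ (∀ i < N, (CayleyVertices.graph S).Adj (γ i) (γ (i + 1))) ∧
    ∀ i ≤ N, ∀ j ≤ N, wordDist S (γ i) (γ j) = |(i : ℝ) - j| := by
  obtain ⟨p, hp⟩ := (CayleyVertices.graph_connected S).exists_walk_length_eq_dist a b
  have hadj : ∀ i < p.length, (CayleyVertices.graph S).Adj (p.getVert i) (p.getVert (i + 1)) :=
    fun i hi => p.adj_getVert_succ hi
  have up : ∀ k i, i + k ≤ p.length → wordDist S (p.getVert i) (p.getVert (i + k)) ≤ k := by
    intro k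
    induction k with
    | zero => intro i _; simp [wordDist_self]
    | succ k ih =>
      intro i hi
      have h1 := ih i (by omega)
      have h2 : wordDist S (p.getVert (i + k)) (p.getVert (i + k + 1)) = 1 := by
        rw [wordDist_eq, SimpleGraph.dist_eq_one_iff_adj.2 (hadj (i + k) (by omega))]; simp
      have h3 := wordDist_triangle S (p.getVert i) (p.getVert (i + k)) (p.getVert (i + (k + 1)))
      rw [← add_assoc, h2] at h3
      push_cast
      rw [← add_assoc]
      linarith
  have key : ∀ i j, i ≤ j → j ≤ p.length →
      wordDist S (p.getVert i) (p.getVert j) = (j : ℝ) - i := by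
    intro i j hij hj
    obtain ⟨k, rfl⟩ := Nat.exists_eq_add_of_le hij
    obtain ⟨l, hl⟩ := Nat.exists_eq_add_of_le hj
    refine le_antisymm (by simpa using up k i hj) ?_
    have h1 := up i 0 (by omega)
    have h2 := up l (i + k) (by omega)
    rw [← hl, p.getVert_length] at h2
    rw [zero_add, p.getVert_zero] at h1
    have h3 := wordDist_triangle S a (p.getVert i) b
    have h4 := wordDist_triangle S (p.getVert i) (p.getVert (i + k)) b
    have h5 : wordDist S a b = (i : ℝ) + k + l := by
      rw [wordDist_eq, ← hp, hl]; push_cast; ring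
    push_cast
    linarith
  refine ⟨p.length, p.getVert, by rw [wordDist_eq, hp], p.getVert_zero, p.getVert_length, hadj,
    fun i hi j hj => ?_⟩
  rcases le_total i j with h | h
  · rw [key i j h hj, abs_sub_comm, abs_of_nonneg (sub_nonneg.2 (by exact_mod_cast h))]
  · rw [wordDist_comm, key j i h hi, abs_of_nonneg (sub_nonneg.2 (by exact_mod_cast h))]

/-- Sum the bound over the edges of a discrete geodesic. -/
theorem dist_le_mul_wordDist {Y : Type*} [MetricSpace Y] (q : G → Y) {K : ℝ}
    (hq : ∀ a, ∀ s ∈ S.gens, dist (q a) (q (a * s)) ≤ K) (a b : G) :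
    dist (q a) (q b) ≤ K * wordDist S a b := by
  obtain ⟨N, γ, hN, rfl, rfl, hadj, -⟩ := exists_word_geodesic S a b
  rw [← hN]
  have : ∀ i ≤ N, dist (q (γ 0)) (q (γ i)) ≤ K * i := by
    intro i
    induction i with
    | zero => simp
    | succ i ih =>
      intro hi
      have h1 := ih (by omega)
      have h2 : dist (q (γ i)) (q (γ (i + 1))) ≤ K := by
        have := hadj i (by omega)
        rw [CayleyVertices.graph, SimpleGraph.mulCayley_adj'] at this
        obtain ⟨-, s, hs, h | h⟩ := this
        · rw [← h]; exact hq _ s hs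
        · rw [h, dist_comm]; exact hq _ s hs
      have h3 := dist_triangle (q (γ 0)) (q (γ i)) (q (γ (i + 1)))
      push_cast
      linarith
  exact this N le_rfl

/-- An element of length `n + 1` is one of length `n` times a generator or its inverse. This
finiteness later turns bounded distances into finite generating sets and uniform bounds. -/
theorem finite_wordDist_le (R : ℝ) : {g : G | wordDist S 1 g ≤ R}.Finite := by
  have key : ∀ n : ℕ, {g : G | wordDist S 1 g ≤ n}.Finite := by
    intro n
    induction n with
    | zero =>
      refine (Set.finite_singleton (1 : G)).subset fun g hg => ?_
      have : wordDist S 1 g ≤ 0 := by simpa using hg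
      exact ((dist_le_zero (γ := CayleyVertices S)).1 this).symm
    | succ n ih =>
      have hS := S.gens.finite_toSet
      refine (ih.union ((Set.Finite.image2 (fun a s => a * s) ih hS).union
        (Set.Finite.image2 (fun a s => a * s⁻¹) ih hS))).subset fun g hg => ?_
      obtain ⟨N, γ, hN, h0, h1, hadj, hd⟩ := exists_word_geodesic S 1 g
      have hg' : wordDist S 1 g ≤ n + 1 := by simpa using hg
      rw [← hN] at hg'
      have hN' : N ≤ n + 1 := by exact_mod_cast hg'
      rcases Nat.eq_zero_or_pos N with rfl | hpos
      · refine Or.inl ?_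
        rw [Set.mem_ofPred_eq, ← hN]
        simp
      · obtain ⟨m, rfl⟩ := Nat.exists_eq_add_of_lt hpos
        rw [zero_add] at *
        have hm : γ m ∈ {g : G | wordDist S 1 g ≤ n} := by
          rw [Set.mem_ofPred_eq, ← h0, hd 0 (by omega) m (by omega)]
          simpa using (by omega : m ≤ n)
        have := hadj m (by omega)
        rw [h1, CayleyVertices.graph, SimpleGraph.mulCayley_adj'] at this
        obtain ⟨-, s, hs, h | h⟩ := this
        · exact Or.inr (Or.inl ⟨γ m, hm, s, hs, h⟩)
        · exact Or.inr (Or.inr ⟨γ m, hm, s, hs, by rw [h]; simp⟩)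
  obtain ⟨n, hn⟩ := exists_nat_ge R
  exact (key n).subset fun g hg => by
    rw [Set.mem_ofPred_eq] at hg ⊢
    exact hg.trans hn

/-- Any two word metrics are bilipschitz equivalent. -/
theorem exists_wordDist_le_mul (T : FinGenSet G) :
    ∃ L : ℝ, 1 ≤ L ∧ ∀ a b : G, wordDist S a b ≤ L * wordDist T a b := by
  obtain ⟨L, hL⟩ := (T.gens.finite_toSet.image (wordDist S 1)).bddAbove
  refine ⟨max L 1, le_max_right _ _, fun a b => ?_⟩
  refine dist_le_mul_wordDist (Y := CayleyVertices S) T (fun a => a) (fun a s hs => ?_) a b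
  change wordDist S a (a * s) ≤ _
  rw [wordDist_self_mul]
  exact (hL ⟨s, hs, rfl⟩).trans (le_max_left _ _)

end word

/-! ### Cones of discretely geodesic spaces -/

/-- The points at scale `t` on discrete geodesics converge. -/
theorem tendsto_min_floor_div {ω : Ultrafilter ℕ} (d : ScalingSeq ω) (N : ℕ → ℕ) {t D : ℝ}
    (ht : t ∈ Set.Icc 0 D) (hN : Tendsto (fun n => (N n : ℝ) / d.val n) (ω : Filter ℕ) (𝓝 D)) :
    Tendsto (fun n => ((min ⌊t * d.val n⌋₊ (N n) : ℕ) : ℝ) / d.val n) (ω : Filter ℕ) (𝓝 t) := by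
  have h1 : Tendsto (fun n => ((⌊t * d.val n⌋₊ : ℕ) : ℝ) / d.val n) (ω : Filter ℕ) (𝓝 t) :=
    (tendsto_nat_floor_mul_div_atTop ht.1).comp d.tendsto_val
  have h2 := h1.min hN
  rw [min_eq_left ht.2] at h2
  refine h2.congr' ?_
  filter_upwards [d.eventually_ge 1] with n hn
  rw [Nat.cast_min, min_div_div_right (by linarith)]

theorem isGeodesicSubset_cone {Y : Type*} [MetricSpace Y]
    (hY : ∀ a b : Y, ∃ (N : ℕ) (γ : ℕ → Y), γ 0 = a ∧ γ N = b ∧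
      ∀ i ≤ N, ∀ j ≤ N, dist (γ i) (γ j) = |(i : ℝ) - j|)
    (ω : Ultrafilter ℕ) (d : ScalingSeq ω) (e : ℕ → Y) :
    IsGeodesicSubset (Set.univ : Set (AsymptoticCone Y d e)) := by
  intro p _ q _
  obtain ⟨x, rfl⟩ := SeparationQuotient.surjective_mk p
  obtain ⟨y, rfl⟩ := SeparationQuotient.surjective_mk q
  choose N γ h0 h1 hd using fun n => hY (x.1 n) (y.1 n)
  have hN : ∀ n, dist (x.1 n) (y.1 n) = N n := fun n => by
    rw [← h0, ← h1, hd n 0 (Nat.zero_le _) _ le_rfl]; simp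
  have hlim := UltraPts.tendsto_dist_mk x y
  simp only [hN] at hlim
  set D := dist (SeparationQuotient.mk x) (SeparationQuotient.mk y) with hD
  obtain ⟨r, hr⟩ := x.exists_bound
  obtain ⟨r', hr'⟩ := y.exists_bound
  -- The limit geodesic at time `t` is the class of the discrete geodesics at index about `t * d n`,
  -- capped at the endpoint.
  let k : ℝ → ℕ → ℕ := fun t n => min ⌊t * d.val n⌋₊ (N n)
  have hk : ∀ t n, k t n ≤ N n := fun t n => min_le_right _ _
  have hb : ∀ t, ∀ᶠ n in (ω : Filter ℕ), dist (γ n (k t n)) (e n) ≤ (2 * r + r') * d.val n + 0 := by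
    intro t
    filter_upwards [hr, hr'] with n h2 h3
    have e1 := dist_triangle (γ n (k t n)) (x.1 n) (e n)
    have e2 := dist_triangle_right (x.1 n) (y.1 n) (e n)
    have e3 : dist (γ n (k t n)) (x.1 n) ≤ dist (x.1 n) (y.1 n) := by
      rw [hN, ← h0 n, hd n _ (hk t n) 0 (Nat.zero_le _)]
      simpa using hk t n
    linarith
  let Γ : ℝ → UltraPts (fun _ => Y) d e := fun t => UltraPts.ofBound (fun n => γ n (k t n)) _ _ (hb t)
  have hΓ : ∀ s ∈ Set.Icc 0 D, ∀ t ∈ Set.Icc 0 D,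
      dist (SeparationQuotient.mk (Γ s)) (SeparationQuotient.mk (Γ t)) = |s - t| := by
    intro s hs t ht
    refine tendsto_nhds_unique (UltraPts.tendsto_dist_mk (Γ s) (Γ t)) ?_
    refine ((tendsto_min_floor_div d N hs hlim).sub (tendsto_min_floor_div d N ht hlim)).abs.congr' ?_
    filter_upwards [d.eventually_ge 1] with n hn
    change _ = dist (γ n (k s n)) (γ n (k t n)) / d.val n
    rw [hd n _ (hk s n) _ (hk t n), ← sub_div, abs_div, abs_of_nonneg (a := d.val n) (by linarith)]
  have hD0 : 0 ≤ D := dist_nonneg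
  refine ⟨_, ⟨fun t => SeparationQuotient.mk (Γ t), ?_, ?_, hΓ, rfl⟩, Set.subset_univ _⟩
  · refine UltraPts.mk_eq_mk (K := 0) (Eventually.of_forall fun n => ?_)
    simp [Γ, k, h0]
  · refine dist_le_zero.1 (le_of_eq ?_)
    refine tendsto_nhds_unique (UltraPts.tendsto_dist_mk (Γ D) y) ?_
    have := (hlim.sub (tendsto_min_floor_div d N ⟨hD0, le_rfl⟩ hlim)).abs
    rw [sub_self, abs_zero] at this
    refine this.congr' ?_
    filter_upwards [d.eventually_ge 1] with n hn
    change _ = dist (γ n (k D n)) (y.1 n) / d.val n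
    rw [← h1 n, hd n _ (hk D n) _ le_rfl, ← sub_div, abs_div, abs_sub_comm,
      abs_of_nonneg (a := d.val n) (by linarith)]

theorem isGeodesicSubset_cone_cayley {G : Type*} [Group G] (S : FinGenSet G) (ω : Ultrafilter ℕ)
    (d : ScalingSeq ω) (e : ℕ → CayleyVertices S) :
    IsGeodesicSubset (Set.univ : Set (AsymptoticCone (CayleyVertices S) d e)) :=
  isGeodesicSubset_cone (Y := CayleyVertices S) (fun a b =>
    let ⟨N, γ, _, h0, h1, _, hd⟩ := exists_word_geodesic S a b
    ⟨N, γ, h0, h1, hd⟩) ω d e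

/-! ### Separation of pieces -/

/-- The scaling sequence given by reals `v n ≥ n`, for the standard non-principal ultrafilter. -/
noncomputable def ScalingSeq.ofGe (v : ℕ → ℝ) (h : ∀ n : ℕ, (n : ℝ) ≤ v n) :
    ScalingSeq (hyperfilter ℕ) :=
  ⟨v, (tendsto_atTop_mono h tendsto_natCast_atTop_atTop).mono_left Nat.hyperfilter_le_atTop⟩

namespace IsAsymptoticallyTreeGraded

variable {X : Type*} [MetricSpace X] {𝒜 : Set (Set X)}

/-- Neighbourhoods of two different members of `𝒜` have intersections of bounded diameter. -/
theorem exists_dist_le (h : IsAsymptoticallyTreeGraded 𝒜) (δ : ℝ) :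
    ∃ R : ℝ, ∀ A ∈ 𝒜, ∀ B ∈ 𝒜, A ≠ B → ∀ x y : X, (∃ a ∈ A, dist x a ≤ δ) →
      (∃ b ∈ B, dist x b ≤ δ) → (∃ a ∈ A, dist y a ≤ δ) → (∃ b ∈ B, dist y b ≤ δ) →
      dist x y ≤ R := by
  by_contra! hcon
  choose A hA B hB hAB x y h1 h2 h3 h4 hd using fun n : ℕ => hcon n
  -- In this scale the limits of `x` and `y` are at distance 1, yet both lie in the same two
  -- different pieces.
  let d := ScalingSeq.ofGe (fun n => dist (x n) (y n)) fun n => (hd n).le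
  obtain ⟨-, hdisj⟩ := h _ d x
  let p : UltraPts (fun _ => X) d x := UltraPts.ofBound x 0 0 (by simp)
  let q : UltraPts (fun _ => X) d x := UltraPts.ofBound y 1 0 (Eventually.of_forall fun n => by
    simp [d, ScalingSeq.ofGe, dist_comm])
  have hpq := hdisj A B hA hB (Eventually.of_forall hAB)
    (x := SeparationQuotient.mk p)
    ⟨mem_limSet_of_near (Eventually.of_forall h1), mem_limSet_of_near (Eventually.of_forall h2)⟩
    (y := SeparationQuotient.mk q)
    ⟨mem_limSet_of_near (Eventually.of_forall h3), mem_limSet_of_near (Eventually.of_forall h4)⟩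
  have h1 : (1 : ℝ) ≤ dist (SeparationQuotient.mk p) (SeparationQuotient.mk q) :=
    UltraPts.le_dist_mk (K := 0) (Eventually.of_forall fun n => by
      change 1 * dist (x n) (y n) - 0 ≤ dist (x n) (y n)
      linarith)
  rw [hpq, dist_self] at h1
  linarith

end IsAsymptoticallyTreeGraded

/-! ### Quasi-geodesics near a piece -/

theorem exists_tendsto_of_mem_Icc (ω : Ultrafilter ℕ) {f : ℕ → ℝ} {a b : ℝ}
    (h : ∀ n, f n ∈ Set.Icc a b) : ∃ s ∈ Set.Icc a b, Tendsto f (ω : Filter ℕ) (𝓝 s) :=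
  isCompact_Icc.ultrafilter_le_nhds' (ω.map f)
    (show f ⁻¹' Set.Icc a b ∈ (ω : Filter ℕ) from Filter.univ_mem' h)

/-- Truncating the rescaled integer parts to intervals that exhaust the limit interval. -/
theorem tendsto_clamp_floor_div {ω : Ultrafilter ℕ} (d : ScalingSeq ω) {r₁ r₂ : ℕ → ℕ}
    {s₁ s₂ : ℕ → ℝ} {s t u : ℝ} (h₁ : ∀ᶠ n in (ω : Filter ℕ), s₁ n ≤ r₁ n / d.val n)
    (h₂ : ∀ᶠ n in (ω : Filter ℕ), s₂ n ≤ r₂ n / d.val n)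
    (hs : Tendsto s₁ (ω : Filter ℕ) (𝓝 s)) (ht : Tendsto s₂ (ω : Filter ℕ) (𝓝 t))
    (hu : u ∈ Set.Icc (-s) t) :
    Tendsto (fun n => ((max (-(r₁ n : ℤ)) (min ⌊u * d.val n⌋ (r₂ n)) : ℤ) : ℝ) / d.val n)
      (ω : Filter ℕ) (𝓝 u) := by
  have hf : Tendsto (fun n => (⌊u * d.val n⌋ : ℝ) / d.val n) (ω : Filter ℕ) (𝓝 u) := by
    have hlow : Tendsto (fun n => u - 1 / d.val n) (ω : Filter ℕ) (𝓝 (u - 0)) :=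
      tendsto_const_nhds.sub (d.tendsto_div 1)
    rw [sub_zero] at hlow
    refine tendsto_of_tendsto_of_tendsto_of_le_of_le' hlow tendsto_const_nhds ?_ ?_
    · filter_upwards [d.eventually_ge 1] with n hn
      have : 0 < d.val n := by linarith
      rw [le_div_iff₀ this, sub_mul, div_mul_cancel₀ _ this.ne']
      linarith [Int.sub_one_lt_floor (u * d.val n)]
    · filter_upwards [d.eventually_ge 1] with n hn
      rw [div_le_iff₀ (by linarith)]
      exact Int.floor_le _
  have hup := hs.neg.max hf
  have hlo := hf.min ht
  rw [max_eq_right hu.1] at hup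
  rw [min_eq_left hu.2] at hlo
  refine tendsto_of_tendsto_of_tendsto_of_le_of_le' hlo hup ?_ ?_
  · filter_upwards [d.eventually_ge 1, h₂] with n hn h2
    have hd : 0 ≤ d.val n := by linarith
    push_cast
    refine (min_le_min le_rfl h2).trans ?_
    rw [min_div_div_right hd]
    gcongr
    exact le_max_right _ _
  · filter_upwards [d.eventually_ge 1, h₁] with n hn h1
    have hd : 0 ≤ d.val n := by linarith
    push_cast
    refine le_trans ?_ (max_le_max (neg_le_neg h1) le_rfl)
    rw [← neg_div, max_div_div_right hd]
    gcongr
    exact min_le_left _ _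

/-- `γ` is an `(L, C)`-quasi-geodesic on the integer interval `[a, b]`. -/
def IsQuasiGeodesicOn {X : Type*} [MetricSpace X] (L C : ℝ) (γ : ℤ → X) (a b : ℤ) : Prop :=
  ∀ i ∈ Set.Icc a b, ∀ j ∈ Set.Icc a b, L⁻¹ * |(i : ℝ) - j| - C ≤ dist (γ i) (γ j) ∧
    dist (γ i) (γ j) ≤ L * |(i : ℝ) - j| + C

section limitArcs

variable {X : Type*} [MetricSpace X] {ω : Ultrafilter ℕ} {d : ScalingSeq ω} {e : ℕ → X}
  {L C : ℝ} {γ : ℕ → ℤ → X} {a b : ℕ → ℤ} {i j : ℕ → ℤ} {u v : ℝ}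

theorem dist_mk_quasiGeodesic_le (hγ : ∀ n, IsQuasiGeodesicOn L C (γ n) (a n) (b n))
    (hi : ∀ n, i n ∈ Set.Icc (a n) (b n)) (hj : ∀ n, j n ∈ Set.Icc (a n) (b n))
    (hiu : Tendsto (fun n => (i n : ℝ) / d.val n) (ω : Filter ℕ) (𝓝 u))
    (hjv : Tendsto (fun n => (j n : ℝ) / d.val n) (ω : Filter ℕ) (𝓝 v))
    {x y : UltraPts (fun _ => X) d e} (hx : ∀ n, x.1 n = γ n (i n)) (hy : ∀ n, y.1 n = γ n (j n)) :
    dist (SeparationQuotient.mk x) (SeparationQuotient.mk y) ≤ L * |u - v| := by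
  have hlim := (((hiu.sub hjv).abs).const_mul L).add (d.tendsto_div C)
  rw [add_zero] at hlim
  refine le_of_tendsto_of_tendsto (UltraPts.tendsto_dist_mk x y) hlim ?_
  filter_upwards [d.eventually_ge 1] with n hn
  have hd : 0 ≤ d.val n := by linarith
  rw [← sub_div, abs_div, abs_of_nonneg hd, ← mul_div_assoc, ← add_div, hx, hy]
  gcongr
  exact (hγ n _ (hi n) _ (hj n)).2

theorem le_dist_mk_quasiGeodesic (hγ : ∀ n, IsQuasiGeodesicOn L C (γ n) (a n) (b n))
    (hi : ∀ n, i n ∈ Set.Icc (a n) (b n)) (hj : ∀ n, j n ∈ Set.Icc (a n) (b n))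
    (hiu : Tendsto (fun n => (i n : ℝ) / d.val n) (ω : Filter ℕ) (𝓝 u))
    (hjv : Tendsto (fun n => (j n : ℝ) / d.val n) (ω : Filter ℕ) (𝓝 v))
    {x y : UltraPts (fun _ => X) d e} (hx : ∀ n, x.1 n = γ n (i n)) (hy : ∀ n, y.1 n = γ n (j n)) :
    L⁻¹ * |u - v| ≤ dist (SeparationQuotient.mk x) (SeparationQuotient.mk y) := by
  have hlim := (((hiu.sub hjv).abs).const_mul L⁻¹).sub (d.tendsto_div C)
  rw [sub_zero] at hlim
  refine le_of_tendsto_of_tendsto hlim (UltraPts.tendsto_dist_mk x y) ?_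
  filter_upwards [d.eventually_ge 1] with n hn
  have hd : 0 ≤ d.val n := by linarith
  rw [← sub_div, abs_div, abs_of_nonneg hd, ← mul_div_assoc, ← sub_div, hx, hy]
  gcongr
  exact (hγ n _ (hi n) _ (hj n)).1

end limitArcs

namespace IsAsymptoticallyTreeGraded

variable {X : Type*} [MetricSpace X] {𝒜 : Set (Set X)}

/-- A long quasi-geodesic (or one with endpoints in `A`) in the `D`-neighbourhood of `A ∈ 𝒜` has
its middle point in the `D/2`-neighbourhood, if `D` is large. -/
theorem exists_infDist_le_half (h : IsAsymptoticallyTreeGraded 𝒜) {L : ℝ} (hL : 1 ≤ L) (C : ℝ) :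
    ∃ D₀ : ℝ, 0 < D₀ ∧ ∀ D ≥ D₀, ∀ A ∈ 𝒜, A.Nonempty → ∀ (r₁ r₂ : ℕ) (γ : ℤ → X),
      IsQuasiGeodesicOn L C γ (-r₁) r₂ →
      (∀ i ∈ Set.Icc (-(r₁ : ℤ)) r₂, Metric.infDist (γ i) A ≤ D) →
      (3 * L * D ≤ r₁ ∨ γ (-r₁) ∈ A) → (3 * L * D ≤ r₂ ∨ γ r₂ ∈ A) →
      Metric.infDist (γ 0) A ≤ D / 2 := by
  by_contra! hcon
  choose D hD A hA hne r₁ r₂ γ hγ hnear hend₁ hend₂ hfar using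
    fun n : ℕ => hcon (n + 1) (by positivity)
  -- Rescale counterexamples by `D n`, observing from their middle points: the limit is an arc
  -- within distance 1 of a piece, with middle point `α 0`.
  have hL0 : 0 < L := by linarith
  have hDn : ∀ n : ℕ, (n : ℝ) ≤ D n := fun n => by linarith [hD n]
  have hDpos : ∀ n, 0 < D n := fun n => by
    have := hD n
    have : (0 : ℝ) ≤ n := Nat.cast_nonneg n
    linarith
  let d := ScalingSeq.ofGe D hDn
  let e : ℕ → X := fun n => γ n 0
  obtain ⟨htg, -⟩ := h _ d e
  -- Rescaled lengths are capped at `3 * L`, so that they converge; the rest of the quasi-geodesic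
  -- is not needed.
  obtain ⟨s, hs, hslim⟩ := exists_tendsto_of_mem_Icc (hyperfilter ℕ)
    (f := fun n => min (r₁ n / D n) (3 * L)) (a := 0) (b := 3 * L) fun n =>
      ⟨le_min (div_nonneg (Nat.cast_nonneg _) (hDpos n).le) (by positivity), min_le_right _ _⟩
  obtain ⟨t, ht, htlim⟩ := exists_tendsto_of_mem_Icc (hyperfilter ℕ)
    (f := fun n => min (r₂ n / D n) (3 * L)) (a := 0) (b := 3 * L) fun n =>
      ⟨le_min (div_nonneg (Nat.cast_nonneg _) (hDpos n).le) (by positivity), min_le_right _ _⟩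
  let k : ℝ → ℕ → ℤ := fun u n => max (-(r₁ n : ℤ)) (min ⌊u * d.val n⌋ (r₂ n))
  have hk : ∀ u n, k u n ∈ Set.Icc (-(r₁ n : ℤ)) (r₂ n) := fun u n =>
    ⟨le_max_left _ _, max_le (by omega) (min_le_right _ _)⟩
  have hk0 : ∀ n, k 0 n = 0 := fun n => by simp [k]
  have hklim : ∀ u ∈ Set.Icc (-s) t,
      Tendsto (fun n => (k u n : ℝ) / d.val n) (hyperfilter ℕ : Filter ℕ) (𝓝 u) := fun u hu =>
    tendsto_clamp_floor_div d (s₁ := fun n => min (r₁ n / D n) (3 * L))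
      (s₂ := fun n => min (r₂ n / D n) (3 * L)) (Eventually.of_forall fun n => min_le_left _ _)
      (Eventually.of_forall fun n => min_le_left _ _) hslim htlim hu
  have hzero : ∀ n, (0 : ℤ) ∈ Set.Icc (-(r₁ n : ℤ)) (r₂ n) := fun n => ⟨by omega, by omega⟩
  have hb : ∀ u, ∀ᶠ n in (hyperfilter ℕ : Filter ℕ),
      dist (γ n (k u n)) (e n) ≤ L * |u| * d.val n + (L + C) := by
    intro u
    filter_upwards [] with n
    have h1 := (hγ n _ (hk u n) 0 (hzero n)).2
    have h2 : |(k u n : ℝ)| ≤ |u| * d.val n + 1 := by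
      have h3 : |(⌊u * d.val n⌋ : ℝ)| ≤ |u| * d.val n + 1 := by
        have e1 := Int.floor_le (u * d.val n)
        have e2 := Int.sub_one_lt_floor (u * d.val n)
        have e3 : |u * d.val n| = |u| * d.val n := by
          rw [abs_mul, abs_of_pos (show 0 < d.val n from hDpos n)]
        have e4 := abs_le.1 e3.le
        rw [abs_le]
        constructor <;> linarith
      refine le_trans ?_ h3
      have : |k u n| ≤ |⌊u * d.val n⌋| := by
        simp only [k]
        rw [abs_le]
        have := abs_nonneg ⌊u * d.val n⌋
        have := le_abs_self ⌊u * d.val n⌋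
        have := neg_abs_le ⌊u * d.val n⌋
        constructor <;> omega
      exact_mod_cast this
    rw [Int.cast_zero, sub_zero] at h1
    have h3 := mul_le_mul_of_nonneg_left h2 hL0.le
    simp only [e]
    linarith
  let P : ℝ → UltraPts (fun _ => X) d e := fun u => UltraPts.ofBound (fun n => γ n (k u n)) _ _ (hb u)
  let α : ℝ → AsymptoticCone X d e := fun u => SeparationQuotient.mk (P u)
  have hαle : ∀ u ∈ Set.Icc (-s) t, ∀ v ∈ Set.Icc (-s) t, dist (α u) (α v) ≤ L * |u - v| :=
    fun u hu v hv => dist_mk_quasiGeodesic_le hγ (hk u) (hk v) (hklim u hu) (hklim v hv)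
      (fun _ => rfl) (fun _ => rfl)
  have hαge : ∀ u ∈ Set.Icc (-s) t, ∀ v ∈ Set.Icc (-s) t, L⁻¹ * |u - v| ≤ dist (α u) (α v) :=
    fun u hu v hv => le_dist_mk_quasiGeodesic hγ (hk u) (hk v) (hklim u hu) (hklim v hv)
      (fun _ => rfl) (fun _ => rfl)
  have hαc : ContinuousOn α (Set.Icc (-s) t) := by
    refine LipschitzOnWith.continuousOn (K := L.toNNReal) (LipschitzOnWith.of_dist_le_mul ?_)
    intro u hu v hv
    rw [Real.coe_toNNReal _ hL0.le, Real.dist_eq]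
    exact hαle u hu v hv
  have hαinj : Set.InjOn α (Set.Icc (-s) t) := by
    intro u hu v hv huv
    have := hαge u hu v hv
    rw [huv, dist_self] at this
    have h2 : |u - v| ≤ 0 := by
      by_contra! hpos
      have : 0 < L⁻¹ * |u - v| := by positivity
      linarith
    exact sub_eq_zero.1 (abs_nonpos_iff.1 h2)
  have hαM : ∀ u, ∃ p ∈ limSet d e A, dist (α u) p ≤ 1 := by
    intro u
    refine exists_mem_limSet_dist_le (K := 1) (Eventually.of_forall fun n => ?_)
    have h1 : Metric.infDist (γ n (k u n)) (A n) < D n + 1 := by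
      linarith [hnear n _ (hk u n)]
    obtain ⟨a, ha, hlt⟩ := (Metric.infDist_lt_iff (hne n)).1 h1
    exact ⟨a, ha, by rw [one_mul]; exact hlt.le⟩
  have hMne : (limSet d e A).Nonempty := let ⟨p, hp, _⟩ := hαM 0; ⟨p, hp⟩
  obtain ⟨π, hπ⟩ := htg.exists_isGateMap (limSet_mem_limPieces hA hMne) hMne
  have h0mem : (0 : ℝ) ∈ Set.Icc (-s) t := ⟨by linarith [hs.1], ht.1⟩
  have side : ∀ v ∈ Set.Icc (-s) t, (|v| = 3 * L ∨ ∃ j : ℕ → ℤ,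
      (∀ n, j n ∈ Set.Icc (-(r₁ n : ℤ)) (r₂ n)) ∧
      Tendsto (fun n => (j n : ℝ) / d.val n) (hyperfilter ℕ : Filter ℕ) (𝓝 v) ∧
      ∀ᶠ n in (hyperfilter ℕ : Filter ℕ), γ n (j n) ∈ A n) →
      ∃ u ∈ Set.uIcc v 0, α u ∈ limSet d e A := by
    rintro v hv (hv3 | ⟨j, hj, hjv, hjA⟩)
    -- An end of length `3 * L` that misses the piece has one gate throughout; then `α v` and `α 0`
    -- are within `1 + 1` of each other, although their distance is at least `L⁻¹ * (3 * L) = 3`.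
    · by_contra! hout
      have hsub : Set.uIcc v 0 ⊆ Set.Icc (-s) t := Set.uIcc_subset_Icc hv h0mem
      have hpre : IsPreconnected (α '' Set.uIcc v 0) :=
        isPreconnected_uIcc.image α (hαc.mono hsub)
      have hdis : Disjoint (α '' Set.uIcc v 0) (limSet d e A) := by
        rw [Set.disjoint_left]
        rintro _ ⟨u, hu, rfl⟩
        exact hout u hu
      have heq := hπ.eq_of_disjoint htg.geodesic hpre hdis ⟨v, Set.left_mem_uIcc, rfl⟩
        ⟨0, Set.right_mem_uIcc, rfl⟩
      have hle : ∀ u, dist (α u) (π (α u)) ≤ 1 := fun u =>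
        let ⟨p, hp, hd⟩ := hαM u; (hπ.dist_le _ hp).trans hd
      have h1 := hle v
      have h2 := hle 0
      have h3 := hαge v hv 0 h0mem
      rw [sub_zero, hv3, mul_comm 3 L, inv_mul_cancel_left₀ hL0.ne'] at h3
      rw [heq] at h1
      linarith [dist_triangle_right (α v) (α 0) (π (α 0))]
    · refine ⟨v, Set.left_mem_uIcc, ?_⟩
      obtain ⟨c, hc⟩ : ∃ c : ℝ, ∀ᶠ n in (hyperfilter ℕ : Filter ℕ),
          dist (γ n (j n)) (e n) ≤ c * d.val n + C := by
        refine ⟨L * (|v| + 1), ?_⟩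
        filter_upwards [hjv.abs.eventually_lt_const (lt_add_one |v|)] with n hn
        have h1 := (hγ n _ (hj n) 0 (hzero n)).2
        have hdp : 0 < d.val n := hDpos n
        rw [abs_div, abs_of_pos hdp, div_lt_iff₀ hdp] at hn
        rw [Int.cast_zero, sub_zero] at h1
        have h2 := mul_le_mul_of_nonneg_left hn.le hL0.le
        simp only [e]
        linarith
      have hdist : dist (α v) (SeparationQuotient.mk (UltraPts.ofBound _ c C hc)) ≤ L * |v - v| :=
        dist_mk_quasiGeodesic_le hγ (hk v) hj (hklim v hv) hjv (fun _ => rfl) (fun _ => rfl)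
      rw [sub_self, abs_zero, mul_zero] at hdist
      rw [dist_le_zero.1 hdist]
      exact ⟨_, rfl, hjA⟩
  have ends : ∀ (r : ℕ → ℕ) (t : ℝ), t ∈ Set.Icc 0 (3 * L) →
      Tendsto (fun n => min (r n / D n) (3 * L)) (hyperfilter ℕ : Filter ℕ) (𝓝 t) →
      t = 3 * L ∨ (Tendsto (fun n => (r n : ℝ) / d.val n) (hyperfilter ℕ : Filter ℕ) (𝓝 t) ∧
        ∀ᶠ n in (hyperfilter ℕ : Filter ℕ), ¬ 3 * L * D n ≤ r n) := by
    intro r t ht hlim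
    rcases (hyperfilter ℕ).em fun n => 3 * L * D n ≤ r n with hev | hev
    · refine Or.inl (tendsto_nhds_unique hlim (tendsto_const_nhds.congr' ?_))
      filter_upwards [hev] with n hn
      rw [min_eq_right]
      rwa [le_div_iff₀ (hDpos n)]
    · refine Or.inr ⟨hlim.congr' ?_, hev⟩
      filter_upwards [hev] with n hn
      refine min_eq_left ?_
      rw [div_le_iff₀ (hDpos n)]
      exact (not_le.1 hn).le
  obtain ⟨u₁, hu₁, hM₁⟩ := side (-s) ⟨le_rfl, h0mem.1.trans h0mem.2⟩ <| by
    rcases ends r₁ s hs hslim with h3 | ⟨hlim, hev⟩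
    · left; rw [abs_neg, abs_of_nonneg hs.1, h3]
    · refine Or.inr ⟨fun n => -(r₁ n : ℤ), fun n => ⟨le_rfl, (hzero n).1.trans (hzero n).2⟩, ?_, ?_⟩
      · simpa [neg_div] using hlim.neg
      · filter_upwards [hev] with n hn
        exact (hend₁ n).resolve_left hn
  obtain ⟨u₂, hu₂, hM₂⟩ := side t ⟨h0mem.1.trans h0mem.2, le_rfl⟩ <| by
    rcases ends r₂ t ht htlim with h3 | ⟨hlim, hev⟩
    · left; rw [abs_of_nonneg ht.1, h3]
    · refine Or.inr ⟨fun n => (r₂ n : ℤ), fun n => ⟨(hzero n).1.trans (hzero n).2, le_rfl⟩, ?_, ?_⟩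
      · simpa using hlim
      · filter_upwards [hev] with n hn
        exact (hend₂ n).resolve_left hn
  rw [Set.uIcc_of_le h0mem.1] at hu₁
  rw [Set.uIcc_of_ge h0mem.2] at hu₂
  have hsub : Set.Icc u₁ u₂ ⊆ Set.Icc (-s) t := Set.Icc_subset_Icc hu₁.1 hu₂.2
  -- The arc meets the piece on both sides of 0, so its middle point is in the piece; this
  -- contradicts a rescaled distance greater than `1/2`.
  have hα0 : α 0 ∈ limSet d e A := hπ.arc_mem htg.geodesic (hαc.mono hsub) (hαinj.mono hsub)
    hM₁ hM₂ ⟨hu₁.2, hu₂.1⟩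
  obtain ⟨n, a, ha, hlt⟩ :=
    (eventually_near_of_mem_limSet hα0 (show (0 : ℝ) < 1 / 4 by norm_num)).exists
  have h1 : dist (γ n 0) a < 1 / 4 * D n := by
    have : (P 0).1 n = γ n 0 := by
      change γ n (k 0 n) = _
      rw [hk0]
    rwa [this] at hlt
  linarith [Metric.infDist_le_dist_of_mem (x := γ n 0) ha, hfar n, hDpos n]

end IsAsymptoticallyTreeGraded

/-! ### Unconstricted spaces in asymptotically tree-graded ones -/

/-- The complements of `a` and `b` are connected, cover the space and share `c`. A third point is
needed: a discrete two-point space also satisfies `HasNoCutPoint`. -/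
theorem HasNoCutPoint.isPreconnected_univ {F : Type*} [TopologicalSpace F] (h : HasNoCutPoint F)
    {a b c : F} (hab : a ≠ b) (hca : c ≠ a) (hcb : c ≠ b) : IsPreconnected (Set.univ : Set F) := by
  have : (Set.univ : Set F) = {a}ᶜ ∪ {b}ᶜ := by
    ext x
    simp only [Set.mem_univ, Set.mem_union, Set.mem_compl_iff, Set.mem_singleton_iff, true_iff]
    by_contra! hx
    exact hab (hx.1.symm.trans hx.2)
  rw [this]
  exact (h.2 a).union c hca hcb (h.2 b)

namespace IsAsymptoticallyTreeGraded

variable {X B : Type*} [MetricSpace X] [MetricSpace B] {𝒜 : Set (Set X)} {L C r₀ : ℝ} {q : B → X}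
  {ω : Ultrafilter ℕ} {d : ScalingSeq ω}

/-- The limit of a quasi-isometrically embedded space without cut-points is in one piece. -/
theorem exists_limSet_of_hasNoCutPoint (h : IsAsymptoticallyTreeGraded 𝒜) (hL : 1 ≤ L)
    (hq : QIEWith L C q) (hfar : ∀ r ≥ r₀, ∀ b : B, ∃ y, r ≤ dist b y ∧ dist b y ≤ 2 * r)
    (e : ℕ → B) (hcut : HasNoCutPoint (AsymptoticCone B d e)) :
    ∃ A : ℕ → Set X, (∀ n, A n ∈ 𝒜) ∧ ∀ y : UltraPts (fun _ => B) d e,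
      SeparationQuotient.mk (y.map hq hL) ∈ limSet d (fun n => q (e n)) A := by
  obtain ⟨htg, -⟩ := h ω d (fun n => q (e n))
  have far : ∀ r : ℝ, 0 < r → ∃ y : UltraPts (fun _ => B) d e,
      ∀ᶠ n in (ω : Filter ℕ), r * d.val n ≤ dist (y.1 n) (e n) ∧
        dist (y.1 n) (e n) ≤ 2 * r * d.val n := by
    intro r hr
    have hev : ∀ᶠ n in (ω : Filter ℕ), ∃ y, r * d.val n ≤ dist y (e n) ∧
        dist y (e n) ≤ 2 * r * d.val n := by
      filter_upwards [d.eventually_ge (r₀ / r)] with n hn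
      rw [div_le_iff₀ hr, mul_comm] at hn
      obtain ⟨y, h1, h2⟩ := hfar _ hn (e n)
      rw [dist_comm] at h1 h2
      exact ⟨y, h1, by linarith⟩
    have : Nonempty B := ⟨e 0⟩
    obtain ⟨y, hy⟩ := hev.choice
    exact ⟨UltraPts.ofBound y (2 * r) 0 (hy.mono fun n h => by linarith [h.2]), hy⟩
  -- Rescaled distances to the base point are in `[1, 2]` for `y` and at least 3 for `z`, so the
  -- cone has three distinct points.
  obtain ⟨y, hy⟩ := far 1 one_pos
  obtain ⟨z, hz⟩ := far 3 (by norm_num)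
  let o : UltraPts (fun _ => B) d e := UltraPts.ofBound e 0 0 (by simp)
  have hy1 : 1 ≤ dist (SeparationQuotient.mk y) (SeparationQuotient.mk o) :=
    UltraPts.le_dist_mk (K := 0) (hy.mono fun n h => by simpa [o] using h.1)
  have hy2 : dist (SeparationQuotient.mk y) (SeparationQuotient.mk o) ≤ 2 :=
    UltraPts.dist_mk_le (K := 0) (hy.mono fun n h => by simpa [o] using h.2)
  have hz1 : 3 ≤ dist (SeparationQuotient.mk z) (SeparationQuotient.mk o) :=
    UltraPts.le_dist_mk (K := 0) (hz.mono fun n h => by simpa [o] using h.1)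
  have hyo : SeparationQuotient.mk y ≠ SeparationQuotient.mk o := by
    intro e1; rw [e1, dist_self] at hy1; linarith
  have hzo : SeparationQuotient.mk z ≠ SeparationQuotient.mk o := by
    intro e1; rw [e1, dist_self] at hz1; linarith
  have hzy : SeparationQuotient.mk z ≠ SeparationQuotient.mk y := by
    intro e1; rw [e1] at hz1; linarith
  have hpre := hcut.isPreconnected_univ hyo hzy hzo
  set Φ := coneMap hq hL d e with hΦ
  have hc : Continuous Φ := (lipschitzWith_coneMap hq hL d e).continuous
  have hinj : Function.Injective Φ := (antilipschitzWith_coneMap hq hL d e).injective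
  have hYc : IsPreconnected (Set.range Φ) := by
    rw [← Set.image_univ]
    exact hpre.image _ hc.continuousOn
  obtain ⟨M, ⟨A, hA, -, rfl⟩, hM⟩ := htg.exists_piece_of_noCut hYc (fun p => by
    by_cases hp : p ∈ Set.range Φ
    · obtain ⟨x, rfl⟩ := hp
      rw [← Set.image_univ, ← Set.image_singleton, ← Set.image_sdiff hinj, ← Set.compl_eq_univ_sdiff]
      exact (hcut.2 x).image _ hc.continuousOn
    · rwa [Set.sdiff_singleton_eq_self hp]) ⟨_, rfl⟩ ⟨_, rfl⟩ (hinj.ne hyo)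
  exact ⟨A, hA, fun y => hM ⟨SeparationQuotient.mk y, rfl⟩⟩

/-- Two distinct points of a piece are far from each other piece. -/
theorem eventually_near_of_near (h : IsAsymptoticallyTreeGraded 𝒜) (hL : 1 ≤ L)
    (hq : QIEWith L C q) (hfar : ∀ r ≥ r₀, ∀ b : B, ∃ y, r ≤ dist b y ∧ dist b y ≤ 2 * r)
    [Nonempty B] (hcut : ∀ e, HasNoCutPoint (AsymptoticCone B d e)) {A : ℕ → Set X}
    (hA : ∀ n, A n ∈ 𝒜) {ε : ℝ} (hε : 0 < ε) (hεL : 2 * ε * L < 1) :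
    ∀ᶠ n in (ω : Filter ℕ), ∀ x y z : B, (∃ a ∈ A n, dist (q x) a ≤ ε * d.val n) →
      (∃ a ∈ A n, dist (q y) a ≤ ε * d.val n) → d.val n ≤ dist x y → dist x y ≤ 2 * d.val n →
      dist x z ≤ 10 * d.val n → ∃ a ∈ A n, dist (q z) a ≤ ε * d.val n := by
  by_contra hcon
  rw [← Ultrafilter.eventually_not] at hcon
  push Not at hcon
  obtain ⟨x, hcon⟩ := hcon.choice
  obtain ⟨y, hcon⟩ := hcon.choice
  obtain ⟨z, hcon⟩ := hcon.choice
  obtain ⟨A', hA', hmem⟩ := h.exists_limSet_of_hasNoCutPoint hL hq hfar x (hcut x)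
  obtain ⟨htg, hdisj⟩ := h ω d (fun n => q (x n))
  let x' : UltraPts (fun _ => B) d x := UltraPts.ofBound x 0 0 (by simp)
  let y' : UltraPts (fun _ => B) d x := UltraPts.ofBound y 2 0
    (hcon.mono fun n h => by rw [dist_comm]; linarith [h.2.2.2.1])
  let z' : UltraPts (fun _ => B) d x := UltraPts.ofBound z 10 0
    (hcon.mono fun n h => by rw [dist_comm]; linarith [h.2.2.2.2.1])
  have hzfar : SeparationQuotient.mk (z'.map hq hL) ∉ limSet d (fun n => q (x n)) A := by
    intro hz
    obtain ⟨n, ⟨a, ha, hlt⟩, hn⟩ := ((eventually_near_of_mem_limSet hz hε).and hcon).exists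
    exact lt_asymm hlt (hn.2.2.2.2.2 a ha)
  -- If the piece of `A` were the one containing the whole image, the limit of `z` would lie in it.
  have hne : ∀ᶠ n in (ω : Filter ℕ), A n ≠ A' n := by
    rcases ω.em fun n => A n = A' n with heq | hne
    · refine absurd ?_ hzfar
      rw [limSet_congr heq]
      exact hmem z'
    · exact hne
  obtain ⟨p, hp, hpd⟩ := exists_mem_limSet_dist_le (A := A) (x := x'.map hq hL) (r := ε) (K := 0)
    (hcon.mono fun n h => let ⟨a, ha, h'⟩ := h.1; ⟨a, ha, by rw [add_zero]; exact h'⟩)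
  obtain ⟨p', hp', hpd'⟩ := exists_mem_limSet_dist_le (A := A) (x := y'.map hq hL) (r := ε) (K := 0)
    (hcon.mono fun n h => let ⟨a, ha, h'⟩ := h.2.1; ⟨a, ha, by rw [add_zero]; exact h'⟩)
  have hMne : (limSet d (fun n => q (x n)) A).Nonempty := ⟨p, hp⟩
  obtain ⟨π, hπ⟩ := htg.exists_isGateMap (limSet_mem_limPieces hA hMne) hMne
  obtain ⟨s, hs, hsM⟩ := htg.piece_geodesic _ (limSet_mem_limPieces hA' ⟨_, hmem x'⟩) _ (hmem x')
    _ (hmem y')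
  have hsub := hdisj A A' hA hA' hne
  -- If the gates differed, the geodesic `s`, which stays in the piece of `A'`, would pass through
  -- both, and two different pieces would share two points. With a common gate the images are at
  -- distance at most `2 * ε`, less than `1 / L`.
  have hππ : π (SeparationQuotient.mk (x'.map hq hL)) = π (SeparationQuotient.mk (y'.map hq hL)) := by
    by_contra hneq
    have h1 : π (SeparationQuotient.mk (x'.map hq hL)) ∈ s := by
      by_contra hn
      exact hneq (hπ.eq_of_isPreconnected htg.geodesic hs.isPreconnected hs.left_mem hs.right_mem
        hn).symm
    have h2 : π (SeparationQuotient.mk (y'.map hq hL)) ∈ s := by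
      by_contra hn
      exact hneq (hπ.eq_of_isPreconnected htg.geodesic hs.isPreconnected hs.right_mem hs.left_mem hn)
    exact hneq (hsub ⟨hπ.mem _, hsM h1⟩ ⟨hπ.mem _, hsM h2⟩)
  have hxy : 1 ≤ dist (SeparationQuotient.mk x') (SeparationQuotient.mk y') :=
    UltraPts.le_dist_mk (K := 0) (hcon.mono fun n h => by
      change 1 * d.val n - 0 ≤ dist (x n) (y n)
      linarith [h.2.2.1])
  have h1 := UltraPts.le_dist_map hq hL x' y'
  have h2 := (hπ.dist_le _ hp).trans hpd
  have h3 := (hπ.dist_le _ hp').trans hpd'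
  rw [hππ] at h2
  have h4 := dist_triangle_right (SeparationQuotient.mk (x'.map hq hL))
    (SeparationQuotient.mk (y'.map hq hL)) (π (SeparationQuotient.mk (y'.map hq hL)))
  have h5 : L * dist (SeparationQuotient.mk (x'.map hq hL)) (SeparationQuotient.mk (y'.map hq hL)) ≤
      L * (2 * ε) := mul_le_mul_of_nonneg_left (by linarith) (by linarith)
  linarith

/-- A quasi-isometrically embedded unconstricted space is in a neighbourhood of a member of `𝒜`. -/
theorem exists_near_of_isUnconstricted (h : IsAsymptoticallyTreeGraded 𝒜) (hL : 1 ≤ L)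
    (hq : QIEWith L C q) (hB : IsUnconstricted B) [Nonempty B]
    (hchain : ∀ b b' : B, ∃ (n : ℕ) (u : ℕ → B), u 0 = b ∧ u n = b' ∧
      ∀ i < n, dist (u i) (u (i + 1)) ≤ 1)
    (hfar : ∀ r ≥ r₀, ∀ b : B, ∃ y, r ≤ dist b y ∧ dist b y ≤ 2 * r) :
    ∃ A ∈ 𝒜, ∃ D : ℝ, ∀ b, ∃ a ∈ A, dist (q b) a ≤ D := by
  obtain ⟨ω, d, hcut⟩ := hB
  obtain ⟨b₀⟩ := ‹Nonempty B›
  have hL0 : 0 < L := by linarith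
  set ε : ℝ := 1 / (3 * L) with hεdef
  have hε : 0 < ε := by positivity
  have hεL : 2 * ε * L < 1 := by rw [hεdef]; field_simp; norm_num
  obtain ⟨A, hA, hmem⟩ := h.exists_limSet_of_hasNoCutPoint hL hq hfar (fun _ => b₀)
    (hcut fun _ => b₀)
  have hstart : ∀ᶠ n in (ω : Filter ℕ), ∀ z, dist b₀ z ≤ 10 * d.val n →
      ∃ a ∈ A n, dist (q z) a ≤ ε * d.val n := by
    by_contra hcon
    rw [← Ultrafilter.eventually_not] at hcon
    push Not at hcon
    have : Nonempty B := ⟨b₀⟩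
    obtain ⟨z, hz⟩ := hcon.choice
    obtain ⟨n, ⟨a, ha, hlt⟩, hn⟩ := ((eventually_near_of_mem_limSet (hmem
      (UltraPts.ofBound z 10 0 (hz.mono fun n h => by rw [dist_comm]; linarith [h.1]))) hε).and
        hz).exists
    exact lt_asymm hlt (hn.2 a ha)
  have : Nonempty B := ⟨b₀⟩
  -- From here on a single index `n` is fixed; its `A n` serves for all of `B`.
  obtain ⟨n, ⟨hn₀, hstep⟩, hn1, hnr⟩ := ((hstart.and
    (h.eventually_near_of_near hL hq hfar hcut hA hε hεL)).and
      ((d.eventually_ge 1).and (d.eventually_ge r₀))).exists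
  refine ⟨A n, hA n, ε * d.val n, fun b => ?_⟩
  obtain ⟨N, u, h0, hN, hu⟩ := hchain b₀ b
  -- The ball of radius `10 * d n` about `u i` contains `u (i + 1)` and a point `y` at distance
  -- between `d n` and `2 * d n` from it, because `1 + 2 * d n ≤ 10 * d n`; these two points carry
  -- the property to the next ball.
  have key : ∀ i ≤ N, ∀ z, dist (u i) z ≤ 10 * d.val n →
      ∃ a ∈ A n, dist (q z) a ≤ ε * d.val n := by
    intro i
    induction i with
    | zero => intro _ z hz; rw [h0] at hz; exact hn₀ z hz
    | succ i ih =>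
      intro hi z hz
      have hui := hu i (by omega)
      obtain ⟨y, hy1, hy2⟩ := hfar _ hnr (u (i + 1))
      refine hstep (u (i + 1)) y z (ih (by omega) _ (by linarith)) (ih (by omega) y ?_) hy1 hy2 hz
      linarith [dist_triangle (u i) (u (i + 1)) y]
  exact key N le_rfl b (by rw [hN, dist_self]; linarith)

end IsAsymptoticallyTreeGraded

/-- `B` is a model of the subset `A` of `X`: an unconstricted, coarsely geodesic space with long
geodesics near all its points, quasi-isometrically embedded in `X` with image close to `A`. -/
structure IsCoarseModel {X B : Type*} [MetricSpace X] [MetricSpace B] (A : Set X) (f : B → X)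
    (L C c : ℝ) : Prop where
  qie : QIEWith L C f
  near : ∀ b, ∃ a ∈ A, dist (f b) a ≤ c
  dense : ∀ a ∈ A, ∃ b, dist (f b) a ≤ c
  unconstricted : IsUnconstricted B
  chain : ∀ b b' : B, ∃ (n : ℕ) (u : ℕ → B), u 0 = b ∧ u n = b' ∧
    (∀ i < n, dist (u i) (u (i + 1)) ≤ 1) ∧ (n : ℝ) ≤ dist b b' + 1
  line : ∀ (b : B) (r : ℕ), ∃ γ : ℤ → B, dist (γ 0) b ≤ c ∧
    ∀ i ∈ Set.Icc (-(r : ℤ)) r, ∀ j ∈ Set.Icc (-(r : ℤ)) r, dist (γ i) (γ j) = |(i : ℝ) - j|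

namespace IsCoarseModel

variable {X B : Type*} [MetricSpace X] [MetricSpace B] {A : Set X} {f : B → X} {L C c : ℝ}

theorem far (h : IsCoarseModel A f L C c) (r : ℝ) (hr : r ≥ 2 * |c| + 1) (b : B) :
    ∃ y, r ≤ dist b y ∧ dist b y ≤ 2 * r := by
  have hc := le_abs_self c
  have hc0 := abs_nonneg c
  obtain ⟨γ, h0, hγ⟩ := h.line b ⌈r + |c|⌉₊
  have hd := hγ 0 ⟨by omega, by omega⟩ ⌈r + |c|⌉₊ ⟨by omega, le_rfl⟩
  have h1 := Nat.le_ceil (r + |c|)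
  have h2 := Nat.ceil_lt_add_one (a := r + |c|) (by linarith)
  rw [Int.cast_zero, zero_sub, abs_neg, Int.cast_natCast, Nat.abs_cast] at hd
  refine ⟨γ ⌈r + |c|⌉₊, ?_, ?_⟩
  · have := dist_triangle (γ 0) b (γ ⌈r + |c|⌉₊)
    linarith
  · have := dist_triangle_left b (γ ⌈r + |c|⌉₊) (γ 0)
    linarith

end IsCoarseModel

/-- Images of models under quasi-isometric embeddings are uniformly close to members of `𝒜`. -/
theorem IsAsymptoticallyTreeGraded.exists_uniform_near {X : Type*} [MetricSpace X]
    {𝒜 : Set (Set X)} (h : IsAsymptoticallyTreeGraded 𝒜) (hne : ∀ A ∈ 𝒜, A.Nonempty)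
    {L C L' C' c : ℝ} (hL : 1 ≤ L) (hC : 0 ≤ C) (hL' : 1 ≤ L') :
    ∃ M : ℝ, ∀ (B : Type*) [MetricSpace B] [Nonempty B] (A : Set X) (f : B → X)
      (_ : IsCoarseModel A f L C c) (φ : X → X) (_ : QIEWith L' C' φ),
      ∃ A' ∈ 𝒜, ∀ b, ∃ a ∈ A', dist (φ (f b)) a ≤ M := by
  have hLL : 1 ≤ L' * L := one_le_mul_of_one_le_of_one_le hL' hL
  obtain ⟨D₀, hD₀, hhalf⟩ := h.exists_infDist_le_half hLL (L' * C + C')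
  refine ⟨max D₀ (2 * (L' * L * c + (L' * C + C'))) + 1, ?_⟩
  intro B _ _ A f hf φ hφ
  have hq := hφ.comp hf.qie hL' hC
  obtain ⟨A', hA', D, hD⟩ := h.exists_near_of_isUnconstricted hLL hq hf.unconstricted
    (fun b b' => let ⟨n, u, h0, h1, h2, _⟩ := hf.chain b b'; ⟨n, u, h0, h1, h2⟩) hf.far
  refine ⟨A', hA', fun b => ?_⟩
  have hbdd : BddAbove (Set.range fun b => Metric.infDist (φ (f b)) A') := by
    refine ⟨D, ?_⟩
    rintro _ ⟨b, rfl⟩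
    obtain ⟨a, ha, hd⟩ := hD b
    exact (Metric.infDist_le_dist_of_mem ha).trans hd
  -- The supremum is finite by the non-uniform bound `D`. If it exceeded the threshold, halving
  -- would give `E ≤ E / 2` plus the cost of moving `b` to a geodesic at distance `c`.
  set E := ⨆ b, Metric.infDist (φ (f b)) A' with hE
  have hle : ∀ b, Metric.infDist (φ (f b)) A' ≤ E := fun b => le_ciSup hbdd b
  have hEle : E ≤ max D₀ (2 * (L' * L * c + (L' * C + C'))) := by
    by_contra! hlt
    have hED : D₀ ≤ E := (le_max_left _ _).trans hlt.le
    have hE2 : 2 * (L' * L * c + (L' * C + C')) < E := (le_max_right _ _).trans_lt hlt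
    have : E ≤ E / 2 + (L' * L * c + (L' * C + C')) := by
      refine ciSup_le fun b => ?_
      obtain ⟨γ, h0, hγ⟩ := hf.line b ⌈3 * (L' * L) * E⌉₊
      have hmid := hhalf E hED A' hA' (hne A' hA') _ _ (fun i => φ (f (γ i)))
        (fun i hi j hj => by
          rw [← hγ i hi j hj]
          exact hq (γ i) (γ j)) (fun i _ => hle _) (Or.inl (Nat.le_ceil _)) (Or.inl (Nat.le_ceil _))
      have h1 := Metric.infDist_le_infDist_add_dist (s := A') (x := φ (f b)) (y := φ (f (γ 0)))
      have h2 := (hq b (γ 0)).2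
      rw [dist_comm b] at h2
      have h3 := mul_le_mul_of_nonneg_left h0 (show 0 ≤ L' * L by linarith)
      linarith
    linarith
  obtain ⟨a, ha, hlt⟩ := (Metric.infDist_lt_iff (hne A' hA')).1
    (show Metric.infDist (φ (f b)) A' < max D₀ (2 * (L' * L * c + (L' * C + C'))) + 1 by
      linarith [hle b])
  exact ⟨a, ha, hlt.le⟩

/-! ### Subgroups coarsely equivalent to coarsely geodesic spaces -/

/-- A subgroup that is coarsely equivalent, with the induced word metric, to a coarsely geodesic
space is finitely generated and quasi-isometric to that space. -/
theorem groupQuasiIsometricToSpace_of_coarseEquiv {G : Type*} [Group G] (S : FinGenSet G)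
    (P : Subgroup G) {B : Type*} [MetricSpace B] (τ : P → B) {a b K : ℝ} (ha : 0 ≤ a)
    (h₁ : ∀ g h : P, wordDist S g h ≤ a * dist (τ g) (τ h) + b)
    (h₂ : ∀ g h : P, dist (τ g) (τ h) ≤ a * wordDist S g h + b)
    (hK : ∀ y, ∃ g, dist (τ g) y ≤ K)
    (hchain : ∀ y y' : B, ∃ (n : ℕ) (u : ℕ → B), u 0 = y ∧ u n = y' ∧
      (∀ i < n, dist (u i) (u (i + 1)) ≤ 1) ∧ (n : ℝ) ≤ dist y y' + 1) :
    GroupQuasiIsometricToSpace P B := by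
  choose σ hσ using hK
  -- Lifts under `σ` of points at distance at most 1 have `τ`-images at distance at most `2 * K +
  -- 1`, so they differ by an element of the finite ball of radius `R`. Lifting chains from `τ 1`
  -- shows that this ball generates `P`, and the lengths of chains bound the new word metric.
  set R := a * (2 * K + 1) + b with hR
  have hK0 : 0 ≤ K := dist_nonneg.trans (hσ (τ 1))
  have hfin : {p : P | wordDist S 1 (p : G) ≤ R}.Finite :=
    (finite_wordDist_le S R).preimage Subtype.val_injective.injOn
  have hmem : ∀ g h : P, dist (τ g) (τ h) ≤ 2 * K + 1 → g⁻¹ * h ∈ hfin.toFinset := by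
    intro g h hd
    rw [Set.Finite.mem_toFinset, Set.mem_ofPred_eq, Subgroup.coe_mul, Subgroup.coe_inv,
      wordDist_inv_mul]
    have h1 := mul_le_mul_of_nonneg_left hd ha
    linarith [h₁ g h]
  have hself : ∀ g, g⁻¹ * σ (τ g) ∈ hfin.toFinset := fun g => hmem _ _ (by
    rw [dist_comm]; linarith [hσ (τ g)])
  have hself' : ∀ g, (σ (τ g))⁻¹ * g ∈ hfin.toFinset := fun g => hmem _ _ (by
    linarith [hσ (τ g)])
  have hnext : ∀ y y', dist y y' ≤ 1 → (σ y)⁻¹ * σ y' ∈ hfin.toFinset := fun y y' hd => hmem _ _ (by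
    linarith [hσ y, hσ y', dist_triangle4 (τ (σ y)) y y' (τ (σ y')), dist_comm y' (τ (σ y'))])
  have hclos : Subgroup.closure (hfin.toFinset : Set P) = ⊤ := by
    refine (Subgroup.eq_top_iff' _).2 fun p => ?_
    obtain ⟨n, u, h0, hn, hu, -⟩ := hchain (τ 1) (τ p)
    have key : ∀ i ≤ n, σ (u i) ∈ Subgroup.closure (hfin.toFinset : Set P) := by
      intro i
      induction i with
      | zero =>
        intro _
        rw [h0]
        simpa using Subgroup.subset_closure (hself 1)
      | succ i ih =>
        intro hi
        have := mul_mem (ih (by omega)) (Subgroup.subset_closure (hnext _ _ (hu i (by omega))))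
        rwa [mul_inv_cancel_left] at this
    have := mul_mem (key n le_rfl) (Subgroup.subset_closure (hn ▸ hself' p))
    rwa [mul_inv_cancel_left] at this
  let E : FinGenSet P := ⟨hfin.toFinset, hclos⟩
  have hE : ∀ g h : P, g⁻¹ * h ∈ hfin.toFinset → wordDist E g h ≤ 1 := fun g h hgh => by
    rw [← wordDist_inv_mul]
    exact wordDist_gen_le E hgh
  have hlow : ∀ g h : P, wordDist E g h ≤ dist (τ g) (τ h) + 3 := by
    intro g h
    obtain ⟨n, u, h0, hn, hu, hle⟩ := hchain (τ g) (τ h)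
    have key : ∀ i ≤ n, wordDist E g (σ (u i)) ≤ i + 1 := by
      intro i
      induction i with
      | zero =>
        intro _
        rw [h0]
        simpa using hE _ _ (hself g)
      | succ i ih =>
        intro hi
        have h1 := ih (by omega)
        have h2 := hE _ _ (hnext _ _ (hu i (by omega)))
        have h3 := wordDist_triangle E g (σ (u i)) (σ (u (i + 1)))
        push_cast
        linarith
    have h1 := key n le_rfl
    rw [hn] at h1
    have h2 := hE _ _ (hself' h)
    have h3 := wordDist_triangle E g (σ (τ h)) h
    linarith
  have hup : ∀ g h : P, dist (τ g) (τ h) ≤ max 1 (a * R + b) * wordDist E g h := by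
    refine dist_le_mul_wordDist E τ fun g s hs => ?_
    refine le_trans ?_ (le_max_right _ _)
    have h1 := h₂ g (g * s)
    rw [Subgroup.coe_mul, wordDist_self_mul] at h1
    have h2 : wordDist S 1 (s : G) ≤ R := hfin.mem_toFinset.1 hs
    have h3 := mul_le_mul_of_nonneg_left h2 ha
    linarith
  have hL1 : (1 : ℝ) ≤ max 1 (a * R + b) := le_max_left _ _
  have hqie : QIEWith (X := CayleyVertices E) (max 1 (a * R + b)) 3 τ := by
    intro g h
    have hw : 0 ≤ wordDist E g h := wordDist_nonneg E g h
    refine ⟨?_, ?_⟩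
    · rw [CayleyVertices.dist_eq]
      have := mul_le_mul_of_nonneg_right (inv_le_one_of_one_le₀ hL1) hw
      linarith [hlow g h]
    · rw [CayleyVertices.dist_eq]
      linarith [hup g h]
  exact ⟨E, hqie.quasiIsometric hL1 (by norm_num) fun y => ⟨σ y, hσ y⟩⟩

/-! ### Coarse actions on families of subsets -/

/-- `f` and `f'` are quasi-inverse quasi-isometries between `Γ` and `X`. -/
structure IsQuasiInversePair {Γ X : Type*} [Group Γ] (S : FinGenSet Γ) [MetricSpace X]
    (f : Γ → X) (f' : X → Γ) (L C : ℝ) : Prop where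
  one_le : 1 ≤ L
  nonneg : 0 ≤ C
  dist_le : ∀ a b, dist (f a) (f b) ≤ L * wordDist S a b + C
  le_dist : ∀ a b, wordDist S a b ≤ L * dist (f a) (f b) + L * C
  wordDist_le : ∀ x y, wordDist S (f' x) (f' y) ≤ L * dist x y + C
  le_wordDist : ∀ x y, dist x y ≤ L * wordDist S (f' x) (f' y) + L * C
  left : ∀ g, wordDist S (f' (f g)) g ≤ C
  right : ∀ x, dist (f (f' x)) x ≤ C

namespace IsQuasiInversePair

variable {Γ X : Type*} [Group Γ] {S : FinGenSet Γ} [MetricSpace X] {f : Γ → X} {f' : X → Γ}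
  {L C : ℝ}

theorem dist_mul_le (h : IsQuasiInversePair S f f' L C) (g : Γ) (x y : X) :
    dist (f (g * f' x)) (f (g * f' y)) ≤ L * (L * dist x y + C) + C := by
  have h1 := h.dist_le (g * f' x) (g * f' y)
  rw [wordDist_mul_left] at h1
  have h2 := mul_le_mul_of_nonneg_left (h.wordDist_le x y) (zero_le_one.trans h.one_le)
  linarith

theorem le_dist_mul (h : IsQuasiInversePair S f f' L C) (g : Γ) (x y : X) :
    dist x y ≤ L * (L * dist (f (g * f' x)) (f (g * f' y)) + L * C) + L * C := by
  have h1 := h.le_dist (g * f' x) (g * f' y)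
  rw [wordDist_mul_left] at h1
  have h2 := mul_le_mul_of_nonneg_left h1 (zero_le_one.trans h.one_le)
  linarith [h.le_wordDist x y]

theorem qieWith_mul (h : IsQuasiInversePair S f f' L C) (g : Γ) :
    QIEWith (L * L) (L * C + C) fun x => f (g * f' x) := by
  intro x y
  have hL0 : 0 < L := zero_lt_one.trans_le h.one_le
  have hC := h.nonneg
  refine ⟨?_, by linarith [h.dist_mul_le g x y]⟩
  rw [sub_le_iff_le_add, inv_mul_le_iff₀ (by positivity)]
  have : L * C ≤ L * L * (L * C) := le_mul_of_one_le_left (by positivity)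
    (one_le_mul_of_one_le_of_one_le h.one_le h.one_le)
  linarith [h.le_dist_mul g x y]

theorem dist_mul_mul_le (h : IsQuasiInversePair S f f' L C) (g k : Γ) (x : X) :
    dist (f (g * f' (f (k * f' x)))) (f (g * k * f' x)) ≤ L * C + C := by
  have h1 := h.dist_le (g * f' (f (k * f' x))) (g * k * f' x)
  rw [mul_assoc, wordDist_mul_left] at h1
  have h2 := mul_le_mul_of_nonneg_left (h.left (k * f' x)) (zero_le_one.trans h.one_le)
  rw [mul_assoc]
  linarith

theorem dist_f_mul_le (h : IsQuasiInversePair S f f' L C) (g u : Γ) :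
    dist (f g) (f (g * u)) ≤ L * wordDist S 1 u + C := by
  have h1 := h.dist_le g (g * u)
  rwa [wordDist_self_mul] at h1

end IsQuasiInversePair

theorem QuasiIsometric.exists_isQuasiInversePair {Γ X : Type*} [Group Γ] {S : FinGenSet Γ}
    [MetricSpace X] (h : QuasiIsometric (CayleyVertices S) X) :
    ∃ (f : Γ → X) (f' : X → Γ) (L C : ℝ), IsQuasiInversePair S f f' L C := by
  obtain ⟨f, f', ⟨L₁, C₁, hL₁, hC₁, h₁⟩, ⟨L₂, C₂, hL₂, hC₂, h₂⟩, ⟨K₁, hK₁⟩, ⟨K₂, hK₂⟩⟩ := h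
  have hL := hL₁.trans (le_max_left L₁ L₂)
  have q₁ : QIEWith _ _ f := QIEWith.mono h₁ hL₁ (le_max_left L₁ L₂)
    ((le_max_left C₁ C₂).trans (le_max_left _ (max K₁ K₂)))
  have q₂ : QIEWith _ _ f' := QIEWith.mono h₂ hL₂ (le_max_right L₁ L₂)
    ((le_max_right C₁ C₂).trans (le_max_left _ (max K₁ K₂)))
  exact ⟨f, f', max L₁ L₂, max (max C₁ C₂) (max K₁ K₂), hL,
    hC₁.trans ((le_max_left C₁ C₂).trans (le_max_left _ _)), fun a b => (q₁ a b).2,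
    fun a b => q₁.dist_le hL a b, fun x y => (q₂ x y).2, fun x y => q₂.dist_le hL x y,
    fun g => (hK₁ g).trans ((le_max_left _ _).trans (le_max_right _ _)),
    fun x => (hK₂ x).trans ((le_max_right _ _).trans (le_max_right _ _))⟩

/-- `Γ` acts on `𝒜` in such a way that the maps `x ↦ f (g * f' x)` send `A` close to `g • A`,
where `f` and `f'` are quasi-inverse quasi-isometries between `Γ` and `X`. -/
structure IsCoarseAction {Γ X : Type*} [Group Γ] (S : FinGenSet Γ) [MetricSpace X]
    (𝒜 : Set (Set X)) [MulAction Γ 𝒜] (f : Γ → X) (f' : X → Γ) (L C M : ℝ) : Prop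
    extends IsQuasiInversePair S f f' L C where
  near : ∀ (g : Γ) (A : 𝒜), ∀ x ∈ A.1, ∃ a ∈ (g • A).1, dist (f (g * f' x)) a ≤ M

namespace IsCoarseAction

variable {Γ X : Type*} [Group Γ] {S : FinGenSet Γ} [MetricSpace X] {𝒜 : Set (Set X)}
  [MulAction Γ 𝒜] {f : Γ → X} {f' : X → Γ} {L C M : ℝ}

/-- Every point of `g • A` is close to the image of a point of `A`. -/
theorem exists_near (h : IsCoarseAction S 𝒜 f f' L C M) (g : Γ) (A : 𝒜) {x : X}
    (hx : x ∈ (g • A).1) :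
    ∃ a ∈ A.1, dist (f (g * f' a)) x ≤ L * (L * M + C) + L * C + 3 * C := by
  -- Go back by `g⁻¹` and forth by `g`; the errors are those of approximation in `A`, of composing
  -- the two translations, and of `f ∘ f'`.
  obtain ⟨a, ha, hd⟩ := h.near g⁻¹ (g • A) x hx
  rw [inv_smul_smul] at ha
  refine ⟨a, ha, ?_⟩
  have h1 := h.dist_mul_le g a (f (g⁻¹ * f' x))
  have h2 := h.dist_mul_mul_le g g⁻¹ x
  rw [mul_inv_cancel, one_mul] at h2
  have h3 := h.right x
  have h4 := dist_triangle4 (f (g * f' a)) (f (g * f' (f (g⁻¹ * f' x)))) (f (f' x)) x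
  have hL0 : 0 ≤ L := zero_le_one.trans h.one_le
  rw [dist_comm a] at h1
  have h5 : L * (L * dist (f (g⁻¹ * f' x)) a + C) ≤ L * (L * M + C) := by gcongr
  linarith

/-- The translation by `g`, corrected by a choice of nearby points in `g • A`, is a quasi-isometry;
`exists_near` makes it coarsely onto. -/
theorem quasiIsometric_smul (h : IsCoarseAction S 𝒜 f f' L C M) (g : Γ) (A : 𝒜) :
    QuasiIsometric A.1 (g • A).1 := by
  choose ψ hψ hd using h.near g A
  have hL1 : 1 ≤ L * L := one_le_mul_of_one_le_of_one_le h.one_le h.one_le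
  have hL0 : 0 < L := zero_lt_one.trans_le h.one_le
  have hC := h.nonneg
  have hqie : QIEWith (L * L) (2 * |M| + (L * C + C)) (fun x : A.1 =>
      (⟨ψ x.1 x.2, hψ x.1 x.2⟩ : (g • A).1)) := by
    intro x y
    have e1 := hd x.1 x.2
    have e2 := hd y.1 y.2
    have e3 := h.qieWith_mul g x.1 y.1
    have e5 := dist_triangle4_left (f (g * f' x.1)) (f (g * f' y.1)) (ψ x.1 x.2) (ψ y.1 y.2)
    have e6 := dist_triangle4_right (f (g * f' x.1)) (f (g * f' y.1)) (ψ x.1 x.2) (ψ y.1 y.2)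
    have e7 := le_abs_self M
    simp only [Subtype.dist_eq]
    exact ⟨by linarith [e3.1], by linarith [e3.2]⟩
  refine hqie.quasiIsometric hL1 (by positivity) (K := M + (L * (L * M + C) + L * C + 3 * C)) ?_
  rintro ⟨y, hy⟩
  obtain ⟨x, hx, hxy⟩ := h.exists_near g A hy
  refine ⟨⟨x, hx⟩, ?_⟩
  have e1 := hd x hx
  have e2 := dist_triangle_left (ψ x hx) y (f (g * f' x))
  simp only [Subtype.dist_eq]
  linarith

/-- Translation by `(f' x)⁻¹` takes `x` to `f 1`. So every orbit of non-empty members meets the set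
of members near `f 1`, which local finiteness makes finite. -/
theorem mem_finite (h : IsCoarseAction S 𝒜 f f' L C M) (A : 𝒜) {x : X} (hx : x ∈ A.1) :
    ∃ a ∈ ((f' x)⁻¹ • A).1, dist (f 1) a ≤ M := by
  simpa using h.near (f' x)⁻¹ A x hx

theorem finite_orbits (h : IsCoarseAction S 𝒜 f f' L C M) (hne : ∀ A ∈ 𝒜, A.Nonempty)
    (hfin : {A : 𝒜 | ∃ a ∈ A.1, dist (f 1) a ≤ M}.Finite) :
    Finite (MulAction.orbitRel.Quotient Γ 𝒜) := by
  have := hfin.to_subtype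
  refine Finite.of_surjective (fun A : {A : 𝒜 | ∃ a ∈ A.1, dist (f 1) a ≤ M} =>
    (Quotient.mk'' A.1 : MulAction.orbitRel.Quotient Γ 𝒜)) fun p => ?_
  induction p using Quotient.inductionOn' with
  | h A =>
    obtain ⟨x, hx⟩ := hne A.1 A.2
    refine ⟨⟨(f' x)⁻¹ • A, h.mem_finite A hx⟩, ?_⟩
    exact Quotient.sound' (MulAction.orbitRel_apply.2 ⟨(f' x)⁻¹, rfl⟩)

/-- The stabilizer of `A` acts coboundedly on `A`. -/
theorem exists_cobounded (h : IsCoarseAction S 𝒜 f f' L C M)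
    (hfin : {A : 𝒜 | ∃ a ∈ A.1, dist (f 1) a ≤ M}.Finite) (A : 𝒜) (a₀ : X) :
    ∃ R : ℝ, ∀ x ∈ A.1, ∃ g ∈ MulAction.stabilizer Γ A, dist (f (g * f' a₀)) x ≤ R := by
  classical
  -- One point of `A` for each translate of `A` near `f 1`. If `x` and `y` give the same translate,
  -- then `f' x * (f' y)⁻¹` stabilizes `A` and takes `y` close to `x`; there are finitely many `y`
  -- to compare with `a₀`.
  let rep : 𝒜 → X := fun A' => if hA : ∃ x ∈ A.1, (f' x)⁻¹ • A = A' then hA.choose else a₀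
  obtain ⟨R, hR⟩ := (hfin.image fun A' => dist a₀ (rep A')).bddAbove
  refine ⟨L * (L * R + C) + C + C, fun x hx => ?_⟩
  have hex : ∃ y ∈ A.1, (f' y)⁻¹ • A = (f' x)⁻¹ • A := ⟨x, hx, rfl⟩
  have hrep : rep ((f' x)⁻¹ • A) = hex.choose := dif_pos hex
  obtain ⟨-, hy⟩ := hex.choose_spec
  rw [← hrep] at hy
  have hd : dist a₀ (rep ((f' x)⁻¹ • A)) ≤ R := hR ⟨_, h.mem_finite A hx, rfl⟩
  set y := rep ((f' x)⁻¹ • A)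
  refine ⟨f' x * (f' y)⁻¹, ?_, ?_⟩
  · rw [MulAction.mem_stabilizer_iff, mul_smul, hy, smul_inv_smul]
  · have h1 := h.dist_mul_le (f' x * (f' y)⁻¹) a₀ y
    rw [inv_mul_cancel_right] at h1
    have h2 := h.right x
    have h3 := dist_triangle (f (f' x * (f' y)⁻¹ * f' a₀)) (f (f' x)) x
    have hL0 : 0 ≤ L := zero_le_one.trans h.one_le
    have h4 : L * (L * dist a₀ y + C) ≤ L * (L * R + C) := by gcongr
    linarith

/-- The stabilizer of `A` is quasi-isometric to every model of `A`. -/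
theorem stabilizer_quasiIsometric (h : IsCoarseAction S 𝒜 f f' L C M)
    (hfin : {A : 𝒜 | ∃ a ∈ A.1, dist (f 1) a ≤ M}.Finite) (A : 𝒜) (hne : A.1.Nonempty)
    {B : Type*} [MetricSpace B] {m : B → X} {L' C' c : ℝ} (hm : IsCoarseModel A.1 m L' C' c)
    (hL' : 1 ≤ L') : GroupQuasiIsometricToSpace (MulAction.stabilizer Γ A) B := by
  obtain ⟨a₀, ha₀⟩ := hne
  obtain ⟨R, hR⟩ := h.exists_cobounded hfin A a₀
  have hL0 : 0 < L := zero_lt_one.trans_le h.one_le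
  have hL0' : 0 < L' := zero_lt_one.trans_le hL'
  have hC := h.nonneg
  set u := f' a₀
  -- The orbit of `a₀` under the stabilizer stays near `A`, so it can be followed in the model;
  -- cobounded action makes the resulting map coarsely onto.
  have hτ : ∀ g : MulAction.stabilizer Γ A, ∃ b, dist (m b) (f ((g : Γ) * u)) ≤ M + c := by
    intro g
    obtain ⟨a, ha, hd⟩ := h.near g A a₀ ha₀
    rw [MulAction.mem_stabilizer_iff.1 g.2] at ha
    obtain ⟨b, hb⟩ := hm.dense a ha
    refine ⟨b, ?_⟩
    rw [dist_comm] at hd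
    linarith [dist_triangle (m b) a (f ((g : Γ) * u))]
  choose τ hτ using hτ
  set w := wordDist S 1 u with hw
  have hw0 : 0 ≤ w := wordDist_nonneg S 1 u
  have hwi : wordDist S 1 u⁻¹ = w := by
    rw [hw, wordDist_comm S 1 u, ← wordDist_inv_mul S u 1, mul_one]
  set N := |M + c| with hN
  have hN0 : 0 ≤ N := abs_nonneg _
  have hMN : M + c ≤ N := le_abs_self _
  refine groupQuasiIsometricToSpace_of_coarseEquiv S _ τ (a := L * L')
    (b := max (L * (|C'| + 2 * N) + L * C + 2 * w) (L' * (L * (2 * w) + C + 2 * N) + L' * |C'|))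
    (K := L' * (R + c + N) + L' * |C'|) (by positivity) ?_ ?_ ?_ hm.chain
  · intro g k
    refine le_trans ?_ (add_le_add_right (le_max_left _ _) _)
    have e1 := wordDist_mul_right_le S (g * u : Γ) (k * u) u⁻¹
    rw [mul_inv_cancel_right, mul_inv_cancel_right, hwi] at e1
    have e2 := h.le_dist (g * u) (k * u)
    have e3 := (hm.qie (τ g) (τ k)).2
    have e4 := dist_triangle4_left (m (τ g)) (m (τ k)) (f (g * u)) (f (k * u))
    have e5 : dist (f (g * u)) (f (k * u)) ≤ L' * dist (τ g) (τ k) + |C'| + 2 * N := by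
      linarith [hτ g, hτ k, le_abs_self C']
    have e6 := mul_le_mul_of_nonneg_left e5 hL0.le
    linarith
  · intro g k
    refine le_trans ?_ (add_le_add_right (le_max_right _ _) _)
    have e1 := wordDist_mul_right_le S (g : Γ) k u
    have e2 := h.dist_le (g * u) (k * u)
    have e3 := hm.qie.dist_le hL' (τ g) (τ k)
    have e4 := dist_triangle4_right (m (τ g)) (m (τ k)) (f (g * u)) (f (k * u))
    have e5 := mul_le_mul_of_nonneg_left e1 hL0.le
    have e6 : dist (m (τ g)) (m (τ k)) ≤ L * wordDist S (g : Γ) k + (L * (2 * w) + C + 2 * N) := by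
      linarith [hτ g, hτ k]
    have e7 := mul_le_mul_of_nonneg_left e6 hL0'.le
    have e8 := mul_le_mul_of_nonneg_left (le_abs_self C') hL0'.le
    linarith
  · intro b
    obtain ⟨x, hx, hd⟩ := hm.near b
    obtain ⟨g, hg, hd'⟩ := hR x hx
    refine ⟨⟨g, hg⟩, ?_⟩
    have e1 := hm.qie.dist_le hL' (τ ⟨g, hg⟩) b
    have e2 := hτ ⟨g, hg⟩
    have e3 := dist_triangle4 (m (τ ⟨g, hg⟩)) (f (g * u)) x (m b)
    rw [dist_comm x] at e3
    have e4 : dist (m (τ ⟨g, hg⟩)) (m b) ≤ R + c + N := by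
      have : dist (m (τ ⟨g, hg⟩)) (f (g * u)) ≤ M + c := e2
      linarith
    have e5 := mul_le_mul_of_nonneg_left e4 hL0'.le
    have e8 := mul_le_mul_of_nonneg_left (le_abs_self C') hL0'.le
    linarith

end IsCoarseAction

/-! ### The action of a group quasi-isometric to an asymptotically tree-graded space -/

theorem IsCoarseModel.exists_lt_dist {X B : Type*} [MetricSpace X] [MetricSpace B] [Nonempty B]
    {A : Set X} {f : B → X} {L C c : ℝ} (h : IsCoarseModel A f L C c) (hL : 1 ≤ L) (R : ℝ) :
    ∃ x ∈ A, ∃ y ∈ A, R < dist x y := by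
  obtain ⟨b⟩ := ‹Nonempty B›
  set r := max (2 * |c| + 1) (L * (|R| + 2 * |c| + |C| + 1)) with hr
  obtain ⟨b', h1, -⟩ := h.far r (le_max_left _ _) b
  obtain ⟨x, hx, hxd⟩ := h.near b
  obtain ⟨y, hy, hyd⟩ := h.near b'
  refine ⟨x, hx, y, hy, ?_⟩
  have h2 : L * (|R| + 2 * |c| + |C| + 1) ≤ dist b b' := (le_max_right _ _).trans h1
  have h3 := h2.trans (h.qie.dist_le hL b b')
  rw [← mul_add] at h3
  have h4 := le_of_mul_le_mul_left h3 (by linarith)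
  have h5 := dist_triangle4_right (f b) (f b') x y
  linarith [le_abs_self R, le_abs_self c, le_abs_self C]

/-- Otherwise the unbounded image of `A` would lie in the bounded intersection of neighbourhoods of
`A₁` and `A₂`. -/
theorem IsAsymptoticallyTreeGraded.eq_of_near {X : Type*} [MetricSpace X] {𝒜 : Set (Set X)}
    (h : IsAsymptoticallyTreeGraded 𝒜) {A A₁ A₂ : Set X} (hA₁ : A₁ ∈ 𝒜) (hA₂ : A₂ ∈ 𝒜)
    (hA : ∀ R : ℝ, ∃ x ∈ A, ∃ y ∈ A, R < dist x y) {φ : X → X} {L C δ₁ δ₂ : ℝ} (hL : 1 ≤ L)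
    (hφ : QIEWith L C φ) (h₁ : ∀ x ∈ A, ∃ a ∈ A₁, dist (φ x) a ≤ δ₁)
    (h₂ : ∀ x ∈ A, ∃ a ∈ A₂, dist (φ x) a ≤ δ₂) : A₁ = A₂ := by
  by_contra hne
  obtain ⟨R, hR⟩ := h.exists_dist_le (max δ₁ δ₂)
  obtain ⟨x, hx, y, hy, hd⟩ := hA (L * R + L * C)
  have g₁ : ∀ x ∈ A, ∃ a ∈ A₁, dist (φ x) a ≤ max δ₁ δ₂ := fun x hx =>
    let ⟨a, ha, h⟩ := h₁ x hx; ⟨a, ha, h.trans (le_max_left _ _)⟩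
  have g₂ : ∀ x ∈ A, ∃ a ∈ A₂, dist (φ x) a ≤ max δ₁ δ₂ := fun x hx =>
    let ⟨a, ha, h⟩ := h₂ x hx; ⟨a, ha, h.trans (le_max_right _ _)⟩
  have h3 := hR A₁ hA₁ A₂ hA₂ hne (φ x) (φ y) (g₁ x hx) (g₂ x hx) (g₁ y hy) (g₂ y hy)
  have h4 := hφ.dist_le hL x y
  have h5 := mul_le_mul_of_nonneg_left h3 (zero_le_one.trans hL)
  linarith

/-- Let `g` send `A` to the member of `𝒜` near its image. The translation by `g * k` is at bounded
distance from the composite of those by `k` and `g`, so uniqueness of this member gives the action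
laws exactly. The constant `M` is independent of `g` and `A` because `exists_uniform_near` is
uniform. -/
theorem IsAsymptoticallyTreeGraded.exists_isCoarseAction {Γ : Type*} [Group Γ] {S : FinGenSet Γ}
    {X : Type*} [MetricSpace X] {𝒜 : Set (Set X)} (h : IsAsymptoticallyTreeGraded 𝒜)
    (hne : ∀ A ∈ 𝒜, A.Nonempty) {L₀ C₀ c : ℝ} (hL₀ : 1 ≤ L₀) (hC₀ : 0 ≤ C₀)
    (hmodel : ∀ A ∈ 𝒜, ∃ (B : Type*) (_ : MetricSpace B) (m : B → X), IsCoarseModel A m L₀ C₀ c)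
    {f : Γ → X} {f' : X → Γ} {L C : ℝ} (hf : IsQuasiInversePair S f f' L C) :
    ∃ (_ : MulAction Γ 𝒜) (M : ℝ), IsCoarseAction S 𝒜 f f' L C M := by
  have hLL : 1 ≤ L * L := one_le_mul_of_one_le_of_one_le hf.one_le hf.one_le
  have hL0 : 0 ≤ L := zero_le_one.trans hf.one_le
  obtain ⟨M₀, hM₀⟩ := h.exists_uniform_near hne (C' := L * C + C) (c := c) hL₀ hC₀ hLL
  set M := L * L * c + (L * C + C) + M₀ with hM
  have hact : ∀ (g : Γ) (A : 𝒜), ∃ A' : 𝒜, ∀ x ∈ A.1, ∃ a ∈ A'.1, dist (f (g * f' x)) a ≤ M := by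
    intro g A
    obtain ⟨B, _, m, hm⟩ := hmodel A.1 A.2
    obtain ⟨a₀, ha₀⟩ := hne A.1 A.2
    have : Nonempty B := let ⟨b, _⟩ := hm.dense a₀ ha₀; ⟨b⟩
    obtain ⟨A', hA', hnear⟩ := hM₀ B A.1 m hm _ (hf.qieWith_mul g)
    refine ⟨⟨A', hA'⟩, fun x hx => ?_⟩
    obtain ⟨b, hb⟩ := hm.dense x hx
    obtain ⟨a, ha, hd⟩ := hnear b
    refine ⟨a, ha, ?_⟩
    have h1 := (hf.qieWith_mul g (m b) x).2
    have h2 := dist_triangle_left (f (g * f' x)) a (f (g * f' (m b)))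
    have h3 := mul_le_mul_of_nonneg_left hb (zero_le_one.trans hLL)
    linarith
  have huniq : ∀ (g : Γ) (A A₁ A₂ : 𝒜) (δ₁ δ₂ : ℝ),
      (∀ x ∈ A.1, ∃ a ∈ A₁.1, dist (f (g * f' x)) a ≤ δ₁) →
      (∀ x ∈ A.1, ∃ a ∈ A₂.1, dist (f (g * f' x)) a ≤ δ₂) → A₁ = A₂ := by
    intro g A A₁ A₂ δ₁ δ₂ h₁ h₂
    obtain ⟨B, _, m, hm⟩ := hmodel A.1 A.2
    obtain ⟨a₀, ha₀⟩ := hne A.1 A.2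
    have : Nonempty B := let ⟨b, _⟩ := hm.dense a₀ ha₀; ⟨b⟩
    exact Subtype.ext (h.eq_of_near A₁.2 A₂.2 (hm.exists_lt_dist hL₀) hLL (hf.qieWith_mul g) h₁ h₂)
  choose act hact using hact
  have hone : ∀ A, act 1 A = A := fun A => by
    refine huniq 1 A (act 1 A) A M C (hact 1 A) fun x hx => ⟨x, hx, ?_⟩
    rw [one_mul]
    exact hf.right x
  have hmul : ∀ g k A, act (g * k) A = act g (act k A) := fun g k A => by
    refine huniq (g * k) A (act (g * k) A) (act g (act k A)) M
      (L * C + C + (L * (L * M + C) + C) + M) (hact (g * k) A) fun x hx => ?_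
    obtain ⟨a, ha, hd⟩ := hact k A x hx
    obtain ⟨a', ha', hd'⟩ := hact g _ a ha
    refine ⟨a', ha', ?_⟩
    have h1 := hf.dist_mul_mul_le g k x
    have h2 := hf.dist_mul_le g (f (k * f' x)) a
    have h3 : L * (L * dist (f (k * f' x)) a + C) ≤ L * (L * M + C) := by gcongr
    have h4 := dist_triangle4 (f (g * k * f' x)) (f (g * f' (f (k * f' x)))) (f (g * f' a)) a'
    rw [dist_comm (f (g * k * f' x)) (f (g * f' (f (k * f' x))))] at h4
    linarith
  let inst : MulAction Γ 𝒜 := { smul := act, one_smul := hone, mul_smul := hmul }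
  exact ⟨inst, M, hf, hact⟩

/-- The cosets of the stabilizers of representatives of the orbits correspond to the members
of `𝒜`. -/
theorem IsCoarseAction.isGroupTreeGraded {Γ X : Type*} [Group Γ] {S : FinGenSet Γ} [MetricSpace X]
    {𝒜 : Set (Set X)} [MulAction Γ 𝒜] {f : Γ → X} {f' : X → Γ} {L C M : ℝ}
    (h : IsCoarseAction S 𝒜 f f' L C M) (htg : IsAsymptoticallyTreeGraded 𝒜)
    (hne : ∀ A ∈ 𝒜, A.Nonempty) (hfin : {A : 𝒜 | ∃ a ∈ A.1, dist (f 1) a ≤ M}.Finite)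
    {m : ℕ} (A : Fin m → 𝒜) (hA : ∀ B : 𝒜, ∃ (i : Fin m) (g : Γ), B = g • A i)
    (hinj : ∀ i j (g : Γ), A i = g • A j → i = j) (T : FinGenSet Γ) :
    IsGroupTreeGraded T fun i => MulAction.stabilizer Γ (A i) := by
  have hL0 : 0 < L := zero_lt_one.trans_le h.one_le
  have hC := h.nonneg
  obtain ⟨L₁, hL₁, hST⟩ := exists_wordDist_le_mul S T
  obtain ⟨L₂, hL₂, hTS⟩ := exists_wordDist_le_mul T S
  have hL₁0 : 0 < L₁ := zero_lt_one.trans_le hL₁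
  have hL₂0 : 0 < L₂ := zero_lt_one.trans_le hL₂
  set L' := L * L₁ * L₂ with hL'def
  have hL' : 1 ≤ L' := one_le_mul_of_one_le_of_one_le
    (one_le_mul_of_one_le_of_one_le h.one_le hL₁) hL₂
  have hqie : QIEWith (X := CayleyVertices T) L' C f := by
    intro a b
    rw [CayleyVertices.dist_eq]
    have hw := wordDist_nonneg T a b
    constructor
    · rw [sub_le_iff_le_add, inv_mul_le_iff₀ (by positivity)]
      have h1 := h.le_dist a b
      have h2 := mul_le_mul_of_nonneg_left h1 hL₂0.le
      have h3 : 0 ≤ L₂ * (L * dist (f a) (f b) + L * C) := by positivity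
      have h4 := mul_le_mul_of_nonneg_right hL₁ h3
      linarith [hTS a b]
    · have h1 := h.dist_le a b
      have h2 := mul_le_mul_of_nonneg_left (hST a b) hL0.le
      have h3 : 0 ≤ L * (L₁ * wordDist T a b) := by positivity
      have h4 := mul_le_mul_of_nonneg_right hL₂ h3
      linarith
  choose a₀ ha₀ using fun i => hne (A i).1 (A i).2
  choose R hR using fun i => h.exists_cobounded hfin (A i) (a₀ i)
  obtain ⟨W, hW⟩ := (Set.finite_range fun i => wordDist S 1 (f' (a₀ i))).bddAbove
  obtain ⟨R', hR'⟩ := (Set.finite_range R).bddAbove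
  have hW' : ∀ i (g : Γ), dist (f g) (f (g * f' (a₀ i))) ≤ L * W + C := fun i g =>
    (h.dist_f_mul_le g _).trans (by
      have := mul_le_mul_of_nonneg_left (hW ⟨i, rfl⟩) hL0.le
      linarith)
  set M₁ := L * (L * M + C) + L * C + 3 * C with hM₁
  set K := max C (max (L * W + C + M) (L * W + C + (L * C + C) + (L * (L * R' + C) + C) + M₁))
  refine htg.of_quasiIsometry (K := K) hqie hL'
    (fun x => ⟨f' x, (h.right x).trans (le_max_left _ _)⟩)
    (isGeodesicSubset_cone_cayley T)
    -- The member `g • A i` is paired with the coset of the stabilizer of `A i` that contains `g`,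
    -- that is, with all `x` such that `x • A i = g • A i`. Since the `A i` are in different orbits,
    -- each member determines its coset.
    (fun B Q => ∃ (g : Γ) (i : Fin m), B = (g • A i).1 ∧
      Q = {x : Γ | g⁻¹ * x ∈ MulAction.stabilizer Γ (A i)}) ?_ ?_ ?_ ?_ ?_
  · rintro _ ⟨g, i, rfl⟩
    exact ⟨_, (g • A i).2, g, i, rfl, rfl⟩
  · intro B hB
    obtain ⟨i, g, hg⟩ := hA ⟨B, hB⟩
    exact ⟨_, ⟨g, i, rfl⟩, g, i, by rw [← hg], rfl⟩
  · rintro _ _ _ ⟨g, i, rfl, rfl⟩ ⟨k, j, hgk, rfl⟩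
    have hgk' : g • A i = k • A j := Subtype.ext hgk
    have hij : i = j := hinj i j (g⁻¹ * k) (by rw [mul_smul, ← hgk', inv_smul_smul])
    subst hij
    refine Set.ext fun (x : Γ) => ?_
    have key : ∀ g : Γ, g⁻¹ * x ∈ MulAction.stabilizer Γ (A i) ↔ x • A i = g • A i := fun g => by
      rw [MulAction.mem_stabilizer_iff, mul_smul, inv_smul_eq_iff]
    exact (key g).trans ((by rw [hgk'] : _ ↔ _).trans (key k).symm)
  · rintro _ _ ⟨g, i, rfl, rfl⟩ (b : Γ) hb
    have hb' : b • A i = g • A i := by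
      have : g⁻¹ * b ∈ MulAction.stabilizer Γ (A i) := hb
      rwa [MulAction.mem_stabilizer_iff, mul_smul, inv_smul_eq_iff] at this
    obtain ⟨a, ha, hd⟩ := h.near b (A i) (a₀ i) (ha₀ i)
    refine ⟨a, by rwa [hb'] at ha, le_trans ?_ ((le_max_left _ _).trans (le_max_right _ _))⟩
    exact (dist_triangle _ _ _).trans (add_le_add (hW' i b) hd)
  · rintro _ _ ⟨g, i, rfl, rfl⟩ x hx
    obtain ⟨a, ha, hd⟩ := h.exists_near g (A i) hx
    obtain ⟨p, hp, hpd⟩ := hR i a ha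
    refine ⟨g * p, ?_, le_trans ?_ ((le_max_right _ _).trans (le_max_right _ _))⟩
    · change g⁻¹ * (g * p) ∈ MulAction.stabilizer Γ (A i)
      rwa [inv_mul_cancel_left]
    · have e1 := hW' i (g * p)
      have e2 := h.dist_mul_mul_le g p (a₀ i)
      have e3 := h.dist_mul_le g (f (p * f' (a₀ i))) a
      have e4 : L * (L * dist (f (p * f' (a₀ i))) a + C) ≤ L * (L * R' + C) := by
        gcongr
        exact hpd.trans (hR' ⟨i, rfl⟩)
      have e5 := dist_triangle (f (g * p)) (f (g * p * f' (a₀ i))) x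
      have e6 := dist_triangle4 (f (g * p * f' (a₀ i))) (f (g * f' (f (p * f' (a₀ i)))))
        (f (g * f' a)) x
      rw [dist_comm (f (g * p * f' (a₀ i))) (f (g * f' (f (p * f' (a₀ i)))))] at e6
      linarith

/-- Rigidity for spaces asymptotically tree-graded with respect to subsets with uniform models. -/
theorem IsAsymptoticallyTreeGraded.exists_subgroups {Γ : Type*} [Group Γ] {X : Type*}
    [MetricSpace X] {𝒜 : Set (Set X)} (h : IsAsymptoticallyTreeGraded 𝒜)
    (hne : ∀ A ∈ 𝒜, A.Nonempty) {L₀ C₀ c : ℝ} (hL₀ : 1 ≤ L₀) (hC₀ : 0 ≤ C₀)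
    (hmodel : ∀ A ∈ 𝒜, ∃ (B : Type*) (_ : MetricSpace B) (m : B → X), IsCoarseModel A m L₀ C₀ c)
    (x₀ : X) (hfin : ∀ R : ℝ, {A ∈ 𝒜 | (A ∩ Metric.ball x₀ R).Nonempty}.Finite)
    (hΓ : GroupQuasiIsometricToSpace Γ X) :
    ∃ (m : ℕ) (A : Fin m → Set X) (P : Fin m → Subgroup Γ), (∀ i, A i ∈ 𝒜) ∧
      (∀ B ∈ 𝒜, ∃ i, QuasiIsometric B (A i)) ∧
      (∀ i (B : Type*) [MetricSpace B] (m : B → X), IsCoarseModel (A i) m L₀ C₀ c →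
        GroupQuasiIsometricToSpace (P i) B) ∧
      ∀ T : FinGenSet Γ, IsGroupTreeGraded T P := by
  obtain ⟨S, hS⟩ := hΓ
  obtain ⟨f, f', L, C, hf⟩ := hS.exists_isQuasiInversePair
  obtain ⟨_, M, hact⟩ := h.exists_isCoarseAction hne hL₀ hC₀ hmodel hf
  have hfin' : {A : 𝒜 | ∃ a ∈ A.1, dist (f 1) a ≤ M}.Finite := by
    refine Set.Finite.of_finite_image ((hfin (dist x₀ (f 1) + M + 1)).subset ?_)
      Subtype.val_injective.injOn
    rintro _ ⟨A, ⟨a, ha, hd⟩, rfl⟩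
    refine ⟨A.2, a, ha, ?_⟩
    rw [Metric.mem_ball, dist_comm]
    linarith [dist_triangle x₀ (f 1) a]
  have := hact.finite_orbits hne hfin'
  obtain ⟨m, ⟨σ⟩⟩ := Finite.exists_equiv_fin (MulAction.orbitRel.Quotient Γ 𝒜)
  let A : Fin m → 𝒜 := fun i => (σ.symm i).out
  have hAmk : ∀ i, (Quotient.mk'' (A i) : MulAction.orbitRel.Quotient Γ 𝒜) = σ.symm i :=
    fun i => Quotient.out_eq' _
  have hA : ∀ B : 𝒜, ∃ (i : Fin m) (g : Γ), B = g • A i := by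
    intro B
    have h1 := hAmk (σ (Quotient.mk'' B))
    rw [Equiv.symm_apply_apply] at h1
    obtain ⟨g, hg⟩ := MulAction.orbitRel_apply.1 (Quotient.exact' h1.symm)
    exact ⟨_, g, hg.symm⟩
  have hinj : ∀ i j (g : Γ), A i = g • A j → i = j := by
    intro i j g hg
    refine σ.symm.injective ?_
    rw [← hAmk i, ← hAmk j]
    exact Quotient.sound' (MulAction.orbitRel_apply.2 ⟨g, hg.symm⟩)
  refine ⟨m, fun i => (A i).1, fun i => MulAction.stabilizer Γ (A i), fun i => (A i).2, ?_, ?_, ?_⟩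
  · intro B hB
    obtain ⟨i, g, hg⟩ := hA ⟨B, hB⟩
    refine ⟨i, ?_⟩
    have := hact.quasiIsometric_smul g⁻¹ ⟨B, hB⟩
    rwa [hg, inv_smul_smul, ← hg] at this
  · intro i B _ m hm
    exact hact.stabilizer_quasiIsometric hfin' (A i) (hne _ (A i).2) hm hL₀
  · exact hact.isGroupTreeGraded h hne hfin' A hA hinj

/-! ### Models of geodesic subsets -/

/-- Chains come from sampling a geodesic in `A` at integer times, capped at its length; long
geodesics are windows of the given bi-infinite ones. -/
theorem isCoarseModel_val {X : Type*} [MetricSpace X] {A : Set X} {c : ℝ} (hc : 0 ≤ c)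
    (hgeo : IsGeodesicSubset A) (hu : IsUnconstricted A)
    (hline : ∀ a ∈ A, ∃ γ : ℝ → X, Isometry γ ∧ (∀ t, γ t ∈ A) ∧ ∃ t, dist a (γ t) ≤ c) :
    IsCoarseModel A (Subtype.val : A → X) 1 0 c where
  qie x y := by simp [Subtype.dist_eq]
  near b := ⟨b.1, b.2, by simpa using hc⟩
  dense a ha := ⟨⟨a, ha⟩, by simpa using hc⟩
  unconstricted := hu
  chain := by
    rintro ⟨b, hb⟩ ⟨b', hb'⟩
    obtain ⟨_, ⟨γ, h0, h1, hd, rfl⟩, hsub⟩ := hgeo b hb b' hb'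
    set D := dist b b' with hD
    have hD0 : 0 ≤ D := dist_nonneg
    have hmem : ∀ i : ℕ, min (i : ℝ) D ∈ Set.Icc 0 D := fun i =>
      ⟨le_min (Nat.cast_nonneg i) hD0, min_le_right _ _⟩
    refine ⟨⌈D⌉₊, fun i => ⟨γ (min i D), hsub ⟨_, hmem i, rfl⟩⟩, ?_, ?_, ?_, ?_⟩
    · simp [min_eq_left hD0, h0]
    · simp [min_eq_right (Nat.le_ceil D), h1]
    · intro i _
      rw [Subtype.dist_eq, hd _ (hmem i) _ (hmem (i + 1))]
      have h2 : min (i : ℝ) D ≤ min ((i + 1 : ℕ) : ℝ) D := min_le_min (by simp) le_rfl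
      have h3 : min ((i + 1 : ℕ) : ℝ) D ≤ min (i : ℝ) D + 1 := by
        rw [← min_add_add_right]
        exact min_le_min (by simp) (by linarith)
      rw [abs_sub_comm, abs_of_nonneg (by linarith)]
      linarith
    · exact (Nat.ceil_lt_add_one hD0).le
  line := by
    rintro ⟨b, hb⟩ r
    obtain ⟨γ, hγ, hA, t, ht⟩ := hline b hb
    refine ⟨fun i => ⟨γ (t + i), hA _⟩, ?_, fun i _ j _ => ?_⟩
    · simpa [Subtype.dist_eq, dist_comm] using ht
    · rw [Subtype.dist_eq, hγ.dist_eq, Real.dist_eq, add_sub_add_left_eq_sub]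

/-! ### Models of cosets -/

section cosets

variable {G : Type*} [Group G]

/-- Balls are finite, so some element has length more than `2 * r`; left-translate a geodesic to it
so that its point of index `r` becomes `b`. -/
theorem exists_centered_word_geodesic [Infinite G] (S : FinGenSet G) (b : G) (r : ℕ) :
    ∃ γ : ℤ → G, γ 0 = b ∧ ∀ i ∈ Set.Icc (-(r : ℤ)) r, ∀ j ∈ Set.Icc (-(r : ℤ)) r,
      wordDist S (γ i) (γ j) = |(i : ℝ) - j| := by
  obtain ⟨h, hh⟩ : ∃ h : G, (2 * r : ℝ) < wordDist S 1 h := by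
    by_contra! hcon
    exact Set.infinite_univ ((finite_wordDist_le S (2 * r)).subset fun h _ => hcon h)
  obtain ⟨N, γ, hN, -, -, -, hd⟩ := exists_word_geodesic S 1 h
  have hrN : 2 * r < N := by
    rw [← hN] at hh
    exact_mod_cast hh
  refine ⟨fun i => b * ((γ r)⁻¹ * γ (r + i).toNat), by simp, ?_⟩
  rintro i ⟨hi, hi'⟩ j ⟨hj, hj'⟩
  rw [wordDist_mul_left, wordDist_mul_left, hd _ (by omega) _ (by omega)]
  have e : ∀ i : ℤ, -(r : ℤ) ≤ i → (((r + i).toNat : ℕ) : ℝ) = r + i := fun i hi => by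
    have : (((r + i).toNat : ℕ) : ℤ) = r + i := Int.toNat_of_nonneg (by omega)
    exact_mod_cast congrArg (Int.cast : ℤ → ℝ) this
  rw [e i hi, e j hj, add_sub_add_left_eq_sub]

theorem exists_wordDist_coe_le (S : FinGenSet G) {P : Subgroup G} (T : FinGenSet P) :
    ∃ K : ℝ, ∀ h h' : P, wordDist S h h' ≤ K * wordDist T h h' := by
  obtain ⟨K, hK⟩ := (T.gens.finite_toSet.image fun s : P => wordDist S 1 (s : G)).bddAbove
  refine ⟨K, dist_le_mul_wordDist (Y := CayleyVertices S) T (fun h => (h : G)) fun h s hs => ?_⟩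
  change wordDist S h ((h * s : P) : G) ≤ K
  rw [Subgroup.coe_mul, wordDist_self_mul]
  exact hK ⟨s, hs, rfl⟩

/-- Geodesics with endpoints in a peripheral subgroup stay close to it. -/
theorem IsGroupTreeGraded.exists_infDist_lt {S : FinGenSet G} {k : ℕ} {H : Fin k → Subgroup G}
    (h : IsGroupTreeGraded S H) : ∃ D₀ : ℝ, ∀ (j : Fin k) (N : ℕ) (γ : ℕ → G),
      (∀ i ≤ N, ∀ i' ≤ N, wordDist S (γ i) (γ i') = |(i : ℝ) - i'|) → γ 0 ∈ H j → γ N ∈ H j →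
      ∀ i ≤ N, ∃ p ∈ H j, wordDist S (γ i) p < D₀ := by
  obtain ⟨D₀, hD₀, hhalf⟩ := IsAsymptoticallyTreeGraded.exists_infDist_le_half h le_rfl 0
  refine ⟨D₀, fun j N γ hγ h0 hN i hi => ?_⟩
  let A : Set (CayleyVertices S) := {x : G | (1 : G)⁻¹ * x ∈ H j}
  have hA : A ∈ leftCosets S H := ⟨1, j, rfl⟩
  have hAmem : ∀ x : G, x ∈ H j → (x : CayleyVertices S) ∈ A := fun x hx => by
    change (1 : G)⁻¹ * x ∈ H j
    rwa [inv_one, one_mul]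
  have hne : A.Nonempty := ⟨(1 : G), hAmem 1 (one_mem _)⟩
  let δ : ℕ → ℝ := fun i => Metric.infDist (α := CayleyVertices S) (γ i) A
  obtain ⟨i₀, hi₀, hmax⟩ := Finset.exists_max_image (Finset.range (N + 1)) δ ⟨0, by simp⟩
  have hi₀N : i₀ ≤ N := by simpa [Nat.lt_succ_iff] using hi₀
  have hlt : δ i₀ < D₀ := by
    by_contra! hge
    have e : ∀ i : ℤ, -(i₀ : ℤ) ≤ i → (((i₀ + i).toNat : ℕ) : ℝ) = i₀ + i := fun i hi => by
      have : (((i₀ + i).toNat : ℕ) : ℤ) = i₀ + i := Int.toNat_of_nonneg (by omega)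
      exact_mod_cast congrArg (Int.cast : ℤ → ℝ) this
    have e0 : ((i₀ : ℤ) + 0).toNat = i₀ := by omega
    have eN : ((i₀ : ℤ) + ((N - i₀ : ℕ) : ℤ)).toNat = N := by omega
    have el : ((i₀ : ℤ) + -(i₀ : ℤ)).toNat = 0 := by omega
    let γ' : ℤ → CayleyVertices S := fun i => γ ((i₀ : ℤ) + i).toNat
    -- Halve at the point farthest from `A`, taking `D` to be this maximal distance. The endpoints
    -- lie in `A`, so no length is required.
    have key : Metric.infDist (γ' 0) A ≤ δ i₀ / 2 := by
      refine hhalf (δ i₀) hge A hA hne i₀ (N - i₀) γ' ?_ ?_ (Or.inr ?_) (Or.inr ?_)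
      · rintro i ⟨hi, hi'⟩ i' ⟨hj, hj'⟩
        have hd : dist (γ' i) (γ' i') = |(i : ℝ) - i'| := by
          refine (hγ _ (by omega) _ (by omega)).trans ?_
          rw [e i hi, e i' hj, add_sub_add_left_eq_sub]
        rw [hd]
        simp
      · rintro i ⟨hi, hi'⟩
        exact hmax ((i₀ : ℤ) + i).toNat (Finset.mem_range.2 (by omega))
      · refine hAmem (γ _) ?_
        rw [el]
        exact h0
      · refine hAmem (γ _) ?_
        rw [eN]
        exact hN
    have hδ : Metric.infDist (γ' 0) A = δ i₀ := congrArg δ e0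
    linarith
  have hi' : δ i < D₀ := (hmax i (Finset.mem_range.2 (by omega))).trans_lt hlt
  obtain ⟨(p : G), (hp : (1 : G)⁻¹ * p ∈ H j), hd⟩ :=
    (Metric.infDist_lt_iff (α := CayleyVertices S) (x := γ i) hne).1 hi'
  refine ⟨p, ?_, hd⟩
  rwa [inv_one, one_mul] at hp

/-- Finitely generated peripheral subgroups are undistorted. -/
theorem IsGroupTreeGraded.exists_wordDist_le {S : FinGenSet G} {k : ℕ} {H : Fin k → Subgroup G}
    (h : IsGroupTreeGraded S H) (j : Fin k) (T : FinGenSet (H j)) :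
    ∃ K : ℝ, ∀ p p' : H j, wordDist T p p' ≤ K * wordDist S p p' + 2 * K := by
  obtain ⟨D₀, hD₀⟩ := h.exists_infDist_lt
  -- Replacing consecutive points of an `S`-geodesic by points of `H j` within `D₀` gives steps of
  -- length at most `2 * D₀ + 1`. Finitely many elements occur, and `K` bounds their `T`-length; the
  -- extra `2 * K` is for the two ends.
  have hfin : {p : H j | wordDist S 1 (p : G) ≤ 2 * D₀ + 1}.Finite :=
    (finite_wordDist_le S _).preimage Subtype.val_injective.injOn
  obtain ⟨K, hK⟩ := (hfin.image fun p => wordDist T 1 p).bddAbove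
  have hK' : ∀ p p' : H j, wordDist S p p' ≤ 2 * D₀ + 1 → wordDist T p p' ≤ K := by
    intro p p' hpp
    rw [← wordDist_inv_mul]
    refine hK ⟨_, ?_, rfl⟩
    rw [Set.mem_ofPred_eq, Subgroup.coe_mul, Subgroup.coe_inv, wordDist_inv_mul]
    exact hpp
  refine ⟨K, fun p p' => ?_⟩
  obtain ⟨N, γ, hN, h0, hN', -, hd⟩ := exists_word_geodesic S (p : G) p'
  have hex : ∀ i : ℕ, ∃ q : H j, i ≤ N → wordDist S (γ i) q < D₀ := by
    intro i
    by_cases hi : i ≤ N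
    · obtain ⟨q, hq, hlt⟩ := hD₀ j N γ hd (h0 ▸ p.2) (hN' ▸ p'.2) i hi
      exact ⟨⟨q, hq⟩, fun _ => hlt⟩
    · exact ⟨1, fun h => absurd h hi⟩
  choose q hq using hex
  have hD0 : 0 < D₀ := (wordDist_nonneg S _ _).trans_lt (hq 0 (Nat.zero_le _))
  have key : ∀ i ≤ N, wordDist T p (q i) ≤ K * i + K := by
    intro i
    induction i with
    | zero =>
      intro _
      have h1 := hq 0 (Nat.zero_le _)
      rw [h0] at h1
      simpa using hK' p (q 0) (by linarith)
    | succ i ih =>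
      intro hi
      have h1 := ih (by omega)
      have h2 := hq i (by omega)
      have h3 := hq (i + 1) hi
      have h4 := hd i (by omega) (i + 1) hi
      rw [Nat.cast_add, Nat.cast_one, sub_add_cancel_left, abs_neg, abs_one] at h4
      have h5 := wordDist_triangle S (q i : G) (γ i) (q (i + 1))
      have h6 := wordDist_triangle S (γ i) (γ (i + 1)) (q (i + 1))
      rw [wordDist_comm S (q i : G) (γ i)] at h5
      have h7 := hK' (q i) (q (i + 1)) (by linarith)
      have h8 := wordDist_triangle T p (q i) (q (i + 1))
      push_cast
      linarith
  have h1 := key N le_rfl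
  have h2 := hq N le_rfl
  rw [hN', wordDist_comm] at h2
  have h3 := hK' (q N) p' (by linarith)
  have h4 := wordDist_triangle T p (q N) p'
  rw [hN] at h1
  linarith

/-- Left translation is an isometry, so one set of constants serves for all cosets of `P`. -/
theorem isCoarseModel_coset (S : FinGenSet G) {P : Subgroup G} [Infinite P] (T : FinGenSet P)
    (hT : IsUnconstricted (CayleyVertices T)) {L C : ℝ} (hL : 1 ≤ L) (hC : 0 ≤ C)
    (h₁ : ∀ p p' : P, wordDist S p p' ≤ L * wordDist T p p')
    (h₂ : ∀ p p' : P, wordDist T p p' ≤ L * wordDist S p p' + L * C) (g : G) :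
    IsCoarseModel (X := CayleyVertices S) (B := CayleyVertices T) {x : G | g⁻¹ * x ∈ P}
      (fun p : P => g * (p : G)) L C 0 where
  qie := by
    intro (p : P) (p' : P)
    change L⁻¹ * wordDist T p p' - C ≤ wordDist S (g * p) (g * p') ∧
      wordDist S (g * p) (g * p') ≤ L * wordDist T p p' + C
    rw [wordDist_mul_left]
    refine ⟨?_, (h₁ p p').trans (by linarith)⟩
    rw [sub_le_iff_le_add, inv_mul_le_iff₀ (by linarith), mul_add]
    exact h₂ p p'
  near := by
    intro (p : P)
    refine ⟨g * (p : G), ?_, (wordDist_self S _).le⟩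
    change g⁻¹ * (g * (p : G)) ∈ P
    rw [inv_mul_cancel_left]
    exact p.2
  dense := by
    intro (a : G) ha
    refine ⟨(⟨g⁻¹ * a, ha⟩ : P), ?_⟩
    change wordDist S (g * (g⁻¹ * a)) a ≤ 0
    rw [mul_inv_cancel_left, wordDist_self]
  unconstricted := hT
  chain := by
    intro (b : P) (b' : P)
    obtain ⟨N, γ, hN, h0, hN', -, hd⟩ := exists_word_geodesic T b b'
    refine ⟨N, γ, h0, hN', fun i hi => ?_, ?_⟩
    · change wordDist T (γ i) (γ (i + 1)) ≤ 1
      rw [hd i (by omega) (i + 1) (by omega)]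
      simp
    · change (N : ℝ) ≤ wordDist T b b' + 1
      linarith
  line := by
    intro (b : P) r
    obtain ⟨γ, h0, hγ⟩ := exists_centered_word_geodesic T b r
    refine ⟨γ, ?_, hγ⟩
    change wordDist T (γ 0) b ≤ 0
    rw [h0, wordDist_self]

/-- A coset that meets the ball is represented by an element of the ball, which is finite. -/
theorem finite_leftCosets_ball (S : FinGenSet G) {k : ℕ} (H : Fin k → Subgroup G) (R : ℝ) :
    {A ∈ leftCosets S H | (A ∩ Metric.ball ((1 : G) : CayleyVertices S) R).Nonempty}.Finite := by
  refine (Set.Finite.image2 (fun (x : G) (i : Fin k) =>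
    ({y : G | x⁻¹ * y ∈ H i} : Set (CayleyVertices S))) (finite_wordDist_le S R)
    (Set.finite_univ (α := Fin k))).subset ?_
  rintro _ ⟨⟨g, i, rfl⟩, (x : G), hx, hxR⟩
  have hx' : g⁻¹ * x ∈ H i := hx
  have hxR' : wordDist S x 1 < R := hxR
  rw [wordDist_comm] at hxR'
  refine ⟨x, hxR'.le, i, trivial, Set.ext fun (y : G) => ?_⟩
  change (x : G)⁻¹ * y ∈ H i ↔ g⁻¹ * y ∈ H i
  have e : g⁻¹ * y = g⁻¹ * (x : G) * ((x : G)⁻¹ * y) := by group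
  rw [e]
  exact (Subgroup.mul_mem_cancel_left (H i) hx').symm

/-- The word metric witnessing the quasi-isometry may differ from that of `S`; the two are
bilipschitz equivalent. -/
theorem GroupsQuasiIsometric.toSpace {Γ : Type*} [Group Γ] (h : GroupsQuasiIsometric Γ G)
    (S : FinGenSet G) : GroupQuasiIsometricToSpace Γ (CayleyVertices S) := by
  obtain ⟨U, T, hQI⟩ := h
  obtain ⟨f, f', L, C, hf⟩ := hQI.exists_isQuasiInversePair
  obtain ⟨L₁, hL₁, hST⟩ := exists_wordDist_le_mul S T
  obtain ⟨L₂, hL₂, hTS⟩ := exists_wordDist_le_mul T S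
  have hL0 : 0 < L := zero_lt_one.trans_le hf.one_le
  have hL₁0 : 0 < L₁ := zero_lt_one.trans_le hL₁
  have hL₂0 : 0 < L₂ := zero_lt_one.trans_le hL₂
  have hC := hf.nonneg
  have hL' : 1 ≤ L * L₁ * L₂ := one_le_mul_of_one_le_of_one_le
    (one_le_mul_of_one_le_of_one_le hf.one_le hL₁) hL₂
  have hqie : QIEWith (X := CayleyVertices U) (Y := CayleyVertices S) (L * L₁ * L₂) (L₁ * C) f := by
    intro (a : Γ) (b : Γ)
    change (L * L₁ * L₂)⁻¹ * wordDist U a b - L₁ * C ≤ wordDist S (f a) (f b) ∧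
      wordDist S (f a) (f b) ≤ L * L₁ * L₂ * wordDist U a b + L₁ * C
    have e1 : wordDist T (f a) (f b) ≤ L * wordDist U a b + C := hf.dist_le a b
    have e2 : wordDist U a b ≤ L * wordDist T (f a) (f b) + L * C := hf.le_dist a b
    have w1 := wordDist_nonneg U a b
    have w2 := wordDist_nonneg S (f a) (f b)
    constructor
    · rw [sub_le_iff_le_add, inv_mul_le_iff₀ (by positivity)]
      have e3 := mul_le_mul_of_nonneg_left (hTS (f a) (f b)) hL0.le
      have e4 : L * (L₂ * wordDist S (f a) (f b)) ≤ L₁ * (L * (L₂ * wordDist S (f a) (f b))) :=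
        le_mul_of_one_le_left (by positivity) hL₁
      have e5 : L * C ≤ L₁ * L₁ * L₂ * (L * C) := le_mul_of_one_le_left (by positivity)
        (one_le_mul_of_one_le_of_one_le (one_le_mul_of_one_le_of_one_le hL₁ hL₁) hL₂)
      linarith
    · have e3 := mul_le_mul_of_nonneg_left e1 hL₁0.le
      have e4 : L₁ * (L * wordDist U a b) ≤ L₂ * (L₁ * (L * wordDist U a b)) :=
        le_mul_of_one_le_left (by positivity) hL₂
      linarith [hST (f a) (f b)]
  refine ⟨U, hqie.quasiIsometric hL' (by positivity) (K := L₁ * C) fun y => ⟨f' y, ?_⟩⟩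
  have e1 : wordDist T (f (f' y)) y ≤ C := hf.right y
  exact (hST (f (f' y)) y).trans (mul_le_mul_of_nonneg_left e1 hL₁0.le)

end cosets

/-! ### The theorem for groups and for spaces -/

theorem mainTheorem3 {Γ : Type*} [Group Γ] [Group.FG Γ] :
    -- the result for groups
    (∀ {G : Type*} [Group G] (S : FinGenSet G) (k : ℕ) (H : Fin k → Subgroup G),
      IsGroupTreeGraded S H →
      (∀ j, Infinite (H j)) →
      (∀ j, IsUnconstrictedGroup (H j)) →
      GroupsQuasiIsometric Γ G →
      ∃ (m : ℕ) (P : Fin m → Subgroup Γ),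
        (∀ T : FinGenSet Γ, IsGroupTreeGraded T P) ∧
        ∀ i, ∃ j, GroupsQuasiIsometric (P i) (H j)) ∧
    -- the result for spaces
    (∀ {X : Type*} [MetricSpace X] (𝒜 : Set (Set X)) (c : ℝ) (x₀ : X),
      (∀ A ∈ 𝒜, A.Nonempty) →
      IsAsymptoticallyTreeGraded 𝒜 →
      IsUniformlyUnconstricted 𝒜 →
      (∀ A ∈ 𝒜, ∀ a ∈ A, ∃ γ : ℝ → X, Isometry γ ∧ (∀ t, γ t ∈ A) ∧ ∃ t, dist a (γ t) ≤ c) →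
      (∀ R : ℝ, {A ∈ 𝒜 | (A ∩ Metric.ball x₀ R).Nonempty}.Finite) →
      GroupQuasiIsometricToSpace Γ X →
      ∃ (m : ℕ) (A : Fin m → Set X) (P : Fin m → Subgroup Γ),
        (∀ i, A i ∈ 𝒜) ∧
        (∀ B ∈ 𝒜, ∃ i, QuasiIsometric B (A i)) ∧
        (∀ i, GroupQuasiIsometricToSpace (P i) (A i)) ∧
        (∀ T : FinGenSet Γ, IsGroupTreeGraded T P)) := by
  refine ⟨?_, ?_⟩
  · intro G _ S k H htg hinf hunc hΓ
    choose T hT using hunc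
    choose K₁ hK₁ using fun j => exists_wordDist_coe_le S (T j)
    choose K₂ hK₂ using fun j => htg.exists_wordDist_le j (T j)
    obtain ⟨N₁, hN₁⟩ := (Set.finite_range K₁).bddAbove
    obtain ⟨N₂, hN₂⟩ := (Set.finite_range K₂).bddAbove
    set L := max 1 (max N₁ N₂) with hLdef
    have hL : 1 ≤ L := le_max_left _ _
    have hL₁ : ∀ j, K₁ j ≤ L := fun j =>
      (hN₁ ⟨j, rfl⟩).trans ((le_max_left _ _).trans (le_max_right _ _))
    have hL₂ : ∀ j, K₂ j ≤ L := fun j =>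
      (hN₂ ⟨j, rfl⟩).trans ((le_max_right _ _).trans (le_max_right _ _))
    -- The additive constant 2 absorbs the term `2 * K₂ j` of the distortion bound, since `K₂ j ≤
    -- L`.
    have hmodel : ∀ (g : G) (j : Fin k), IsCoarseModel (X := CayleyVertices S)
        (B := CayleyVertices (T j)) {x : G | g⁻¹ * x ∈ H j} (fun p : H j => g * (p : G)) L 2 0 := by
      intro g j
      have := hinf j
      refine isCoarseModel_coset S (T j) (hT j) hL (by norm_num) (fun p p' => ?_)
        (fun p p' => ?_) g
      · exact (hK₁ j p p').trans (mul_le_mul_of_nonneg_right (hL₁ j) (wordDist_nonneg _ _ _))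
      · have := mul_le_mul_of_nonneg_right (hL₂ j) (wordDist_nonneg S (p : G) p')
        linarith [hK₂ j p p', hL₂ j]
    obtain ⟨m, A, P, hA, -, hP, htgP⟩ := IsAsymptoticallyTreeGraded.exists_subgroups
      (L₀ := L) (C₀ := 2) (c := 0) htg
      (by
        rintro _ ⟨g, j, rfl⟩
        refine ⟨g, ?_⟩
        change g⁻¹ * g ∈ H j
        rw [inv_mul_cancel]
        exact one_mem _)
      hL (by norm_num) (by
        rintro _ ⟨g, j, rfl⟩
        exact ⟨CayleyVertices (T j), inferInstance, _, hmodel g j⟩)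
      ((1 : G) : CayleyVertices S) (finite_leftCosets_ball S H) (hΓ.toSpace S)
    refine ⟨m, P, htgP, fun i => ?_⟩
    obtain ⟨g, j, hj⟩ := hA i
    obtain ⟨U, hU⟩ := hP i (CayleyVertices (T j)) _ (by rw [hj]; exact hmodel g j)
    exact ⟨j, U, T j, hU⟩
  · intro X _ 𝒜 c x₀ hne htg hunc hline hfin hΓ
    have hmodel : ∀ A ∈ 𝒜, IsCoarseModel A (Subtype.val : A → X) 1 0 (max c 0) := by
      intro A hA
      refine isCoarseModel_val (le_max_right _ _) (hunc.1 A hA) ?_ fun a ha => ?_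
      -- A constant sequence suffices: uniformity over `𝒜` comes from the geodesics near all points.
      · obtain ⟨ω, d, h⟩ := hunc.2 (fun _ => A) fun _ => hA
        exact ⟨ω, d, h⟩
      · obtain ⟨γ, h1, h2, t, ht⟩ := hline A hA a ha
        exact ⟨γ, h1, h2, t, ht.trans (le_max_left _ _)⟩
    obtain ⟨m, A, P, hA, hQI, hP, htgP⟩ := htg.exists_subgroups hne le_rfl le_rfl
      (fun A hA => ⟨A, inferInstance, _, hmodel A hA⟩) x₀ hfin hΓ
    exact ⟨m, A, P, hA, hQI, fun i => hP i (A i) _ (hmodel _ (hA i)), htgP⟩
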